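/- Conventions. A Hamiltonian on $D\times\mathbb{R}^n$, with $D\subseteq\mathbb{R}^n$ open and connected, is a real function $H(\mathbf{x},\mathbf{p})$; its velocity is $v^i=\partial H/\partial p_i$ and its force is $F^i=\{\partial H/\partial p_i,H\}$, where $\{f,g\}=\sum_k\left(\frac{\partial f}{\partial x^k}\frac{\partial g}{\partial p_k}-\frac{\partial g}{\partial x^k}\frac{\partial f}{\partial p_k}\right)$. $H$ is regular if it is analytic on $D\times\mathbb{R}^n$, for every $\mathbf{x}\in D$ the map $\mathbf{p}\mapsto\mathbf{v}$ is a bijection of $\mathbb{R}^n$, and $(\mathbf{x},\mathbf{p})\mapsto(\mathbf{x},\mathbf{v})$ is an analytic diffeomorphism of $D\times\mathbb{R}^n$. The force is velocity-independent if it is a function of $\mathbf{x}$ only, and an isotropic simple harmonic motion (SHM) if $\mathbf{F}=a\mathbf{x}+\mathbf{b}$ on $D$ for a fixed scalar $a$ and vector $\mathbf{b}$. A permissible canonical transformation is a finite composition of maps of the types (1) $\mathbf{x}\mapsto N\mathbf{x}+\mathbf{b}$, $\mathbf{p}\mapsto(N^T)^{-1}\mathbf{p}$ with a fixed invertible matrix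 $N$ and vector $\mathbf{b}$ (so that $D$ becomes $ND+\mathbf{b}$), and (2) $\mathbf{x}\mapsto\mathbf{x}$, $\mathbf{p}\mapsto\mathbf{p}+\mathbf{V}(\mathbf{x})$ with an analytic curl-free vector field $\mathbf{V}$ on the domain ($\partial_iV_j=\partial_jV_i$). Theorem. Let $D\subseteq\mathbb{R}^2$ be open and connected, and let $H$ be a regular Hamiltonian on $D\times\mathbb{R}^2$ that generates a velocity-independent force which is not an isotropic SHM. Then after a permissible canonical transformation (the new domain being again denoted $D$), with $\mathbf{x}=(x,y)$ and $\mathbf{p}=(p_x,p_y)$, $H$ has one of the following forms on $D\times\mathbb{R}^2$. 1. Anisotropic quadratic: $H=\frac12\sum_{i,j}M^{ij}p_ip_j+U(\mathbf{x})$, where $M$ is a fixed symmetric invertible real $2\times2$ matrix and $U:D\to\mathbb{R}$ is analytic. 2. Separable: $H=H_1(x,p_x)+H_2(y,p_y)$, where $H_1$, $H_2$ are regular one-dimensional Hamiltonians, over open intervals $I_1,I_2$ with $D\subseteq I_1\times I_2$, each generating a velocity-independent force. 3. Seesaw, where $I$ denotes an open interval that contains $x$ for all $(x,y)\in D$: (a)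 $$H=y\,\partial_x\eta(x,p_y)+u(x)\,\partial_x\eta(x,p_y)+p_x\,\partial_{p_y}\eta(x,p_y)+G(\eta(x,p_y))-\partial_{p_y}\eta(x,p_y)\int_0^{p_y}G'(\eta(x,p))\,\mathrm{d}p,$$ where $\eta$ is a regular one-dimensional Hamiltonian over $I$ generating a velocity-independent force that is not identically zero, $G$ is analytic at every point of the range $\eta(I\times\mathbb{R})$, and $u$ is a meromorphic function on $I$ such that $u(x)\,\partial_x\eta(x,p)$ extends analytically to $I\times\mathbb{R}$ (the extended value being used in the formula at the singularities of $u$). (b) $$H=\left(p_x+c(x)+d(x)\int^{p_y}\frac{\mathrm{d}p}{r(p)^2}\right)r(p_y)+u(p_y),$$ where $r:\mathbb{R}\to\mathbb{R}$ is an analytic diffeomorphism, $c,d:I\to\mathbb{R}$ and $u:\mathbb{R}\to\mathbb{R}$ are analytic, and $R(p)=\int^{p}\mathrm{d}s/r(s)^2$ is a function with $R'=1/r^2$ wherever $r\ne0$, such that $d(x)\,R(p)\,r(p)$ extends analytically to $I\times\mathbb{R}$ (the extended value being used in the formula at the zero of $r$). Conversely, for every open connected $D\subseteq\mathbb{R}^2$,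 every $H$ of one of these forms on $D\times\mathbb{R}^2$ is a regular Hamiltonian that generates a velocity-independent force. -/

import Mathlib

open Set
open scoped Matrix

namespace HamForce

/-- Coordinate space `ℝⁿ`, used for positions, momenta and velocities. (Only analyticity and
derivatives are used, so the choice of the norm on `ℝⁿ` plays no role.) -/
abbrev Vec (n : ℕ) : Type := Fin n → ℝ

/-- A function of `(x, p)`. A Hamiltonian on `D × ℝⁿ` is given by such a function, of which only the
values at `x ∈ D` are ever used. -/
abbrev PhaseFun (n : ℕ) : Type := Vec n → Vec n → ℝ

/-- `∂f/∂xⁱ` at fixed momentum. -/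
noncomputable def dX {n : ℕ} (i : Fin n) (f : PhaseFun n) : PhaseFun n :=
  fun x p => fderiv ℝ (fun y => f y p) x (Pi.single i 1)

/-- `∂f/∂pᵢ` at fixed position. -/
noncomputable def dP {n : ℕ} (i : Fin n) (f : PhaseFun n) : PhaseFun n :=
  fun x p => fderiv ℝ (fun q => f x q) p (Pi.single i 1)

/-- The Poisson bracket `{f, g} = ∑ᵢ (∂f/∂xⁱ ∂g/∂pᵢ - ∂g/∂xⁱ ∂f/∂pᵢ)`. -/
noncomputable def poisson {n : ℕ} (f g : PhaseFun n) : PhaseFun n :=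
  fun x p => ∑ i, (dX i f x p * dP i g x p - dX i g x p * dP i f x p)

/-- The velocity `vⁱ = ∂H/∂pᵢ` as a function of `(x, p)`. -/
noncomputable def velocity {n : ℕ} (H : PhaseFun n) (x p : Vec n) : Vec n :=
  fun i => dP i H x p

/-- The force (for unit mass) `Fⁱ = dvⁱ/dt = {∂H/∂pᵢ, H}` as a function of `(x, p)`. -/
noncomputable def force {n : ℕ} (H : PhaseFun n) (x p : Vec n) : Vec n :=
  fun i => poisson (dP i H) H x p

/-- `H` is a regular Hamiltonian on `D × ℝⁿ`: it is analytic in `(x, p)`, and `(x, p) ↦ (x, v)` is an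
analytic diffeomorphism of `D × ℝⁿ` onto itself, i.e. at every `x ∈ D` the map `p ↦ v` is a bijection
of `ℝⁿ`, with an inverse `v ↦ P x v` that is analytic in `(x, v)`. -/
def IsRegular {n : ℕ} (D : Set (Vec n)) (H : PhaseFun n) : Prop :=
  AnalyticOnNhd ℝ (fun z : Vec n × Vec n => H z.1 z.2) (D ×ˢ univ) ∧
  ∃ P : Vec n → Vec n → Vec n,
    AnalyticOnNhd ℝ (fun z : Vec n × Vec n => P z.1 z.2) (D ×ˢ univ) ∧
    ∀ x ∈ D, (∀ p, P x (velocity H x p) = p) ∧ (∀ v, velocity H x (P x v) = v)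

/-- The force generated by `H` over `D` depends on the position only. -/
def VelocityIndependent {n : ℕ} (D : Set (Vec n)) (H : PhaseFun n) : Prop :=
  ∃ F : Vec n → Vec n, ∀ x ∈ D, ∀ p, force H x p = F x

/-- The force generated by `H` over `D` is an isotropic simple harmonic motion, `F = a x + b`. -/
def IsIsotropicSHM {n : ℕ} (D : Set (Vec n)) (H : PhaseFun n) : Prop :=
  ∃ (a : ℝ) (b : Vec n), ∀ x ∈ D, ∀ p, force H x p = a • x + b

/-- Type 1: `x ↦ N x + b`, `p ↦ (Nᵀ)⁻¹ p`, taking the Hamiltonian `S.2` over `S.1` to the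
Hamiltonian `S'.2` over `S'.1`. -/
def IsType1 {n : ℕ} (S S' : Set (Vec n) × PhaseFun n) : Prop :=
  ∃ (N : Matrix (Fin n) (Fin n) ℝ) (b : Vec n), IsUnit N.det ∧
    S'.1 = (fun x => N *ᵥ x + b) '' S.1 ∧
    ∀ x ∈ S.1, ∀ p, S'.2 (N *ᵥ x + b) ((Nᵀ)⁻¹ *ᵥ p) = S.2 x p

/-- Type 2: `x ↦ x`, `p ↦ p + V(x)`, with `V` an analytic curl-free vector field on the domain. -/
def IsType2 {n : ℕ} (S S' : Set (Vec n) × PhaseFun n) : Prop :=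
  ∃ V : Vec n → Vec n, AnalyticOnNhd ℝ V S.1 ∧
    (∀ x ∈ S.1, ∀ i j, fderiv ℝ V x (Pi.single i 1) j = fderiv ℝ V x (Pi.single j 1) i) ∧
    S'.1 = S.1 ∧
    ∀ x ∈ S.1, ∀ p, S'.2 x (p + V x) = S.2 x p

/-- `S'` arises from `S` by a permissible canonical transformation: a finite composition of
transformations of type 1 and type 2. -/
def Permissible {n : ℕ} : Set (Vec n) × PhaseFun n → Set (Vec n) × PhaseFun n → Prop :=
  Relation.ReflTransGen fun S S' => IsType1 S S' ∨ IsType2 S S'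

/-- A function of two real variables as a function on the phase space of one spatial dimension. -/
def lift1 (h : ℝ → ℝ → ℝ) : PhaseFun 1 := fun x p => h (x 0) (p 0)

/-- A subset of `ℝ` as a one-dimensional spatial domain. -/
def dom1 (I : Set ℝ) : Set (Vec 1) := {x | x 0 ∈ I}

/-- `h(x, p)` is a regular one-dimensional Hamiltonian over the open connected set `I ⊆ ℝ` that
generates a velocity-independent force. -/
def IsGood1D (I : Set ℝ) (h : ℝ → ℝ → ℝ) : Prop :=
  IsOpen I ∧ IsConnected I ∧ IsRegular (dom1 I) (lift1 h) ∧
    VelocityIndependent (dom1 I) (lift1 h)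

/-- `H = ½ Mⁱʲ pᵢ pⱼ + U(x)`, `M` invertible (and symmetric), `U` analytic. -/
def IsAnisotropicQuadratic (D : Set (Vec 2)) (H : PhaseFun 2) : Prop :=
  ∃ (M : Matrix (Fin 2) (Fin 2) ℝ) (U : Vec 2 → ℝ),
    M.IsSymm ∧ IsUnit M.det ∧ AnalyticOnNhd ℝ U D ∧
    ∀ x ∈ D, ∀ p, H x p = (1 / 2) * ∑ i, ∑ j, M i j * p i * p j + U x

/-- `H = H₁(x, p_x) + H₂(y, p_y)`. -/
def IsSeparable (D : Set (Vec 2)) (H : PhaseFun 2) : Prop :=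
  ∃ (I₁ I₂ : Set ℝ) (H₁ H₂ : ℝ → ℝ → ℝ),
    IsGood1D I₁ H₁ ∧ IsGood1D I₂ H₂ ∧ (∀ x ∈ D, x 0 ∈ I₁ ∧ x 1 ∈ I₂) ∧
    ∀ x ∈ D, ∀ p, H x p = H₁ (x 0) (p 0) + H₂ (x 1) (p 1)

/-- Seesaw Hamiltonians of type (a):
`H = y ∂ₓη + u(x) ∂ₓη + p_x ∂_pη + G(η) - ∂_pη ∫₀^{p_y} G'(η(x, s)) ds`, with `η` and its partial
derivatives taken at `(x, p_y)`. The function `u` may have isolated singularities, as long as the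
product `u(x) ∂ₓη(x, p)` is analytic; `w` is this product, with the singularities removed. (Since `u`
is a quotient of analytic functions of `x`, its singularities are poles.) -/
def IsSeesawA (D : Set (Vec 2)) (H : PhaseFun 2) : Prop :=
  ∃ (I : Set ℝ) (η : ℝ → ℝ → ℝ) (G u : ℝ → ℝ) (w : ℝ → ℝ → ℝ),
    IsGood1D I η ∧
    (∃ x ∈ dom1 I, ∃ p, force (lift1 η) x p ≠ 0) ∧
    AnalyticOnNhd ℝ G {e | ∃ s ∈ I, ∃ q, e = η s q} ∧
    MeromorphicOn u I ∧
    AnalyticOnNhd ℝ (fun z : ℝ × ℝ => w z.1 z.2) (I ×ˢ univ) ∧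
    (∀ s ∈ I, AnalyticAt ℝ u s → ∀ q, w s q = u s * deriv (fun t => η t q) s) ∧
    (∀ x ∈ D, x 0 ∈ I) ∧
    ∀ x ∈ D, ∀ p,
      H x p = x 1 * deriv (fun t => η t (p 1)) (x 0) + w (x 0) (p 1)
        + p 0 * deriv (fun q => η (x 0) q) (p 1) + G (η (x 0) (p 1))
        - deriv (fun q => η (x 0) q) (p 1) * ∫ s in (0 : ℝ)..(p 1), deriv G (η (x 0) s)

/-- Seesaw Hamiltonians of type (b): `H = (p_x + c(x) + d(x) R(p_y)) r(p_y) + u(p_y)`, with `r` an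
analytic diffeomorphism of `ℝ` and `R(p) = ∫ᵖ ds / r(s)²`. As `r` has a zero, where `1 / r²` has a
double pole, `R` is an antiderivative of `1 / r²` off that zero, regularised there by the requirement
that `d(x) R(p) r(p)` be analytic; `w` is this product, with the singularity removed. -/
def IsSeesawB (D : Set (Vec 2)) (H : PhaseFun 2) : Prop :=
  ∃ (I : Set ℝ) (r c d u R : ℝ → ℝ) (w : ℝ → ℝ → ℝ),
    IsOpen I ∧ IsConnected I ∧
    AnalyticOnNhd ℝ r univ ∧ Function.Bijective r ∧ (∀ q, deriv r q ≠ 0) ∧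
    AnalyticOnNhd ℝ c I ∧ AnalyticOnNhd ℝ d I ∧ AnalyticOnNhd ℝ u univ ∧
    (∀ q, r q ≠ 0 → HasDerivAt R (1 / r q ^ 2) q) ∧
    AnalyticOnNhd ℝ (fun z : ℝ × ℝ => w z.1 z.2) (I ×ˢ univ) ∧
    (∀ s ∈ I, ∀ q, r q ≠ 0 → w s q = d s * R q * r q) ∧
    (∀ x ∈ D, x 0 ∈ I) ∧
    ∀ x ∈ D, ∀ p, H x p = (p 0 + c (x 0)) * r (p 1) + w (x 0) (p 1) + u (p 1)

/-- `H` over `D` is anisotropic quadratic, separable, or Seesaw (of type (a) or (b)). -/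
def IsListedForm (D : Set (Vec 2)) (H : PhaseFun 2) : Prop :=
  IsAnisotropicQuadratic D H ∨ IsSeparable D H ∨ (IsSeesawA D H ∨ IsSeesawB D H)

end HamForce

/-!
The classification rests on differentiating the velocity-independent force in the momenta. With
`A = ∂v/∂p` (`hess`) and `J = ∂F/∂x` (`forceJac`), the momentum derivative of `F` splits into a
symmetric and an antisymmetric part, which vanish separately: the entries of `A` are conserved, and
the two velocities are in involution (`VelInd.br_eq_zero`). By the Jacobi identity `J A` is then
symmetric (`VelInd.forceJac_hess`), which in the plane is a single linear relation: the vector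
`hessVec` of the entries of `A` is orthogonal to a vector `jacVec` made of the traceless part of `J`.
As the velocities are in involution, the momentum field on which they vanish has no curl, and a
permissible shift makes the velocity vanish at zero momentum (`normalHam_gauge`).

The vector `jacVec` depends on the position only, and its derivative along the motion is orthogonal to
`hessVec` as well, because `A` is conserved. At a given position, `hessVec` and its value at zero
momentum are therefore both orthogonal to `jacVec` and to its derivative, so that one of these two
pairs is dependent; by analyticity it is the same pair throughout (`NormalHam.alternative`). If it is
the first, then `A` is constant and `H` is quadratic. If it is the second, then `jacVec` has a fixed
direction. It is not identically zero, since otherwise the force would be an isotropic simple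
harmonic motion (`NormalHam.exists_jacVec_ne_zero`), and the outcome is one constant linear relation
between the entries of `A`. A change of basis brings it to a normal form according to the sign of its
discriminant (`exists_basis`).

* Negative: `H` is harmonic in the momenta, so `v₁ - i v₂` is an entire injective function of
  `p₁ + i p₂`, hence linear (`entire_eq_mul`), and `H` is quadratic again.
* Positive: `∂²H/∂p₁∂p₂ = 0`, and all other mixed second derivatives turn out to vanish too
  (`NormalHam.mixed_eq_zero`), so `H` separates.
* Zero: `∂²H/∂p₁² = 0`, and `H = y ∂ₓη + p_x ∂ₚη + s` with functions `η` and `s` of `(x, p_y)`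
  (`NormalHam.exists_eq_seesaw`). Here `η` is a Hamiltonian of one degree of freedom with
  velocity-independent force, and what remains is a linear equation for `s`.

That equation is solved with the conserved quantities of `η`. If the force of `η` is not identically
zero, then every function in involution with `η` is a single analytic function of `η`
(`Good1.exists_factor`): motions pass turning points, so conserved quantities are even in the velocity
(`Conserved.even`), hence locally analytic functions of the energy even where the velocity vanishes,
and the local functions agree where they overlap. This gives type (a) (`Good1.exists_seesawA`). If the
force of `η` vanishes, then `η` depends on the momentum only and the equation is solved by a
quadrature, which gives type (b) (`Good1.exists_seesawB`).

The converse is a computation of the force and of the inverse of the map from momenta to velocities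
for each of the forms (`IsListedForm.regular`). In type (a) the relation between `u` and `∂ₓη` is
available off the singularities of `u`, and in type (b) the one for the antiderivative of `1 / r²` off
the zero of `r`; continuity extends the resulting identities.
-/

open scoped Topology
open Filter

namespace HamForce

/-! ### Connectedness and the identity principle -/

/-- Induction on a preconnected set: a property that holds at one point, and spreads between any two
points of some neighbourhood of each point of the set, holds at every point of the set. -/
theorem _root_.IsPreconnected.forall_of_locally {X : Type*} [TopologicalSpace X] {D : Set X}
    (hD : IsPreconnected D) {p : X → Prop} {z₀ : X} (h₀ : z₀ ∈ D) (hp : p z₀)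
    (h : ∀ z ∈ D, ∃ N ∈ 𝓝 z, ∀ a ∈ N ∩ D, ∀ b ∈ N ∩ D, p a → p b) : ∀ z ∈ D, p z := by
  have : PreconnectedSpace D := isPreconnected_iff_preconnectedSpace.1 hD
  have hcl : IsClopen {z : D | p z} := by
    constructor
    · rw [← isOpen_compl_iff, isOpen_iff_mem_nhds]
      intro z hz
      obtain ⟨N, hN, hNp⟩ := h z z.2
      filter_upwards [preimage_coe_mem_nhds_subtype.2 (mem_nhdsWithin_of_mem_nhds hN)] with b hb hpb
      exact hz (hNp b ⟨hb, b.2⟩ z ⟨mem_of_mem_nhds hN, z.2⟩ hpb)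
    · rw [isOpen_iff_mem_nhds]
      intro z hz
      obtain ⟨N, hN, hNp⟩ := h z z.2
      filter_upwards [preimage_coe_mem_nhds_subtype.2 (mem_nhdsWithin_of_mem_nhds hN)] with b hb
      exact hNp z ⟨mem_of_mem_nhds hN, z.2⟩ b ⟨hb, b.2⟩ hz
  intro z hz
  have := hcl.eq_univ ⟨⟨z₀, h₀⟩, hp⟩
  exact (this.symm ▸ mem_univ (⟨z, hz⟩ : D) : (⟨z, hz⟩ : D) ∈ {z : D | p z})

/-- On a connected open set a product of analytic functions vanishes only if a factor does. -/
theorem eqOn_zero_of_mul_eq_zero {E : Type*} [NormedAddCommGroup E] [NormedSpace ℝ E] {U : Set E}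
    (hUo : IsOpen U) (hU : IsPreconnected U) {f g : E → ℝ} (hf : AnalyticOnNhd ℝ f U)
    (hg : AnalyticOnNhd ℝ g U) (h : ∀ z ∈ U, f z * g z = 0) :
    (∀ z ∈ U, f z = 0) ∨ ∀ z ∈ U, g z = 0 := by
  by_cases hz : ∃ z ∈ U, f z ≠ 0
  · obtain ⟨z, hzU, hfz⟩ := hz
    refine Or.inr fun y hy => hg.eqOn_zero_of_preconnected_of_eventuallyEq_zero hU hzU ?_ hy
    filter_upwards [(hf z hzU).continuousAt.eventually_ne hfz, hUo.mem_nhds hzU] with y hy hyU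
    exact (mul_eq_zero.1 (h y hyU)).resolve_left hy
  · push Not at hz
    exact Or.inl hz

/-- Analytic functions agreeing on a set with interior points agree on a preconnected set that
contains it. -/
theorem eqOn_of_eqOn_subset {E : Type*} [NormedAddCommGroup E] [NormedSpace ℝ E] {U V : Set E}
    {f g : E → ℝ} (hf : AnalyticOnNhd ℝ f U) (hg : AnalyticOnNhd ℝ g U) (hU : IsPreconnected U)
    (hV : (interior V).Nonempty) (hVU : V ⊆ U) (h : EqOn f g V) : EqOn f g U := by
  obtain ⟨z, hz⟩ := hV
  exact hf.eqOn_of_preconnected_of_eventuallyEq hg hU (hVU (interior_subset hz))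
    (h.eventuallyEq_of_mem (mem_interior_iff_mem_nhds.1 hz))

/-- Monodromy for functions that factor locally through a real-valued map `π`: if a function `k` on
a connected set is near each point an analytic function of `π` (and of a real parameter), then it is
so globally. The fibres of `π` need not be connected; the local factors are continued along the
interval of values of `π`, which is simply connected. -/
theorem exists_analytic_factor {X : Type*} [TopologicalSpace X] {D : Set X}
    (hD : IsConnected D) {π : X → ℝ} (hπ : ∀ z ∈ D, ContinuousAt π z) {k : X → ℝ → ℝ}
    (hint : ∀ z ∈ D, ∀ N ∈ 𝓝 z, (interior (π '' N)).Nonempty)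
    (hloc : ∀ z ∈ D, ∃ J : Set ℝ, IsOpen J ∧ IsPreconnected J ∧ π z ∈ J ∧ ∃ G : ℝ × ℝ → ℝ,
      AnalyticOnNhd ℝ G (J ×ˢ univ) ∧ ∀ᶠ y in 𝓝 z, ∀ e, k y e = G (π y, e)) :
    ∃ G : ℝ × ℝ → ℝ, AnalyticOnNhd ℝ G ((π '' D) ×ˢ univ) ∧ ∀ z ∈ D, ∀ e, k z e = G (π z, e) := by
  -- two local factors at the same point agree on the whole intersection of their intervals
  have huniq : ∀ z ∈ D, ∀ J J' : Set ℝ, ∀ G G' : ℝ × ℝ → ℝ, IsOpen J → IsOpen J' →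
      IsPreconnected J → IsPreconnected J' → π z ∈ J → π z ∈ J' →
      AnalyticOnNhd ℝ G (J ×ˢ univ) → AnalyticOnNhd ℝ G' (J' ×ˢ univ) →
      (∀ᶠ y in 𝓝 z, ∀ e, k y e = G (π y, e)) → (∀ᶠ y in 𝓝 z, ∀ e, k y e = G' (π y, e)) →
      EqOn G G' ((J ∩ J') ×ˢ univ) := by
    intro z hz J J' G G' hJ hJ' hJc hJc' hzJ hzJ' hG hG' hk hk'
    have hc : IsPreconnected (J ∩ J') := by
      rw [isPreconnected_iff_ordConnected] at *
      exact hJc.inter hJc'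
    have hm : ∀ᶠ y in 𝓝 z, π y ∈ J ∩ J' :=
      (hπ z hz).eventually ((hJ.inter hJ').mem_nhds ⟨hzJ, hzJ'⟩)
    have hN := hint z hz _ (hk.and (hk'.and hm))
    refine eqOn_of_eqOn_subset
      (V := (π '' {y | (∀ e, k y e = G (π y, e)) ∧ (∀ e, k y e = G' (π y, e)) ∧ π y ∈ J ∩ J'})
        ×ˢ univ)
      (hG.mono (prod_mono inter_subset_left subset_rfl))
      (hG'.mono (prod_mono inter_subset_right subset_rfl)) (hc.prod isPreconnected_univ) ?_ ?_ ?_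
    · rw [interior_prod_eq, interior_univ]
      exact hN.prod univ_nonempty
    · rintro ⟨t, e⟩ ⟨⟨y, hy, rfl⟩, -⟩
      exact ⟨hy.2.2, trivial⟩
    · rintro ⟨t, e⟩ ⟨⟨y, hy, rfl⟩, -⟩
      exact (hy.1 e).symm.trans (hy.2.1 e)
  obtain ⟨z₀, hz₀⟩ := hD.nonempty
  -- every point shares a factor with the base point
  have hex : ∀ z ∈ D, ∃ J : Set ℝ, IsOpen J ∧ IsPreconnected J ∧ π z₀ ∈ J ∧ π z ∈ J ∧
      ∃ G : ℝ × ℝ → ℝ, AnalyticOnNhd ℝ G (J ×ˢ univ) ∧ (∀ᶠ y in 𝓝 z₀, ∀ e, k y e = G (π y, e)) ∧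
        ∀ᶠ y in 𝓝 z, ∀ e, k y e = G (π y, e) := by
    refine hD.isPreconnected.forall_of_locally hz₀ ?_ ?_
    · obtain ⟨J, hJ, hJc, hzJ, G, hG, hk⟩ := hloc z₀ hz₀
      exact ⟨J, hJ, hJc, hzJ, hzJ, G, hG, hk, hk⟩
    · intro z hz
      obtain ⟨J', hJ', hJc', hzJ', G', hG', hk'⟩ := hloc z hz
      have hm : ∀ᶠ y in 𝓝 z, π y ∈ J' := (hπ z hz).eventually (hJ'.mem_nhds hzJ')
      refine ⟨_, hm.and hk'.eventually_nhds, ?_⟩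
      rintro a ⟨⟨ha, hka⟩, haD⟩ b ⟨⟨hb, hkb⟩, hbD⟩ ⟨J, hJ, hJc, h0J, haJ, G, hG, hk0, hkG⟩
      have heq := huniq a haD J J' G G' hJ hJ' hJc hJc' haJ ha hG hG' hkG hka
      classical
      let K : ℝ × ℝ → ℝ := fun w => if w.1 ∈ J then G w else G' w
      have hKG : ∀ w : ℝ × ℝ, w.1 ∈ J → K w = G w := fun w hw => if_pos hw
      have hKG' : ∀ w : ℝ × ℝ, w.1 ∈ J' → K w = G' w := by
        intro w hw
        by_cases hwJ : w.1 ∈ J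
        · rw [hKG w hwJ]; exact heq ⟨⟨hwJ, hw⟩, trivial⟩
        · exact if_neg hwJ
      refine ⟨J ∪ J', hJ.union hJ', hJc.union (π a) haJ ha hJc', Or.inl h0J, Or.inr hb, K, ?_,
        ?_, ?_⟩
      · rintro w ⟨hw | hw, -⟩
        · refine (hG w ⟨hw, trivial⟩).congr ?_
          filter_upwards [continuousAt_fst.eventually (hJ.mem_nhds hw)] with v hv
          exact (hKG v hv).symm
        · refine (hG' w ⟨hw, trivial⟩).congr ?_
          filter_upwards [continuousAt_fst.eventually (hJ'.mem_nhds hw)] with v hv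
          exact (hKG' v hv).symm
      · filter_upwards [hk0, (hπ z₀ hz₀).eventually (hJ.mem_nhds h0J)] with y hy hyJ e
        rw [hy e, hKG (π y, e) hyJ]
      · have hbJ : ∀ᶠ y in 𝓝 b, π y ∈ J' := (hπ b hbD).eventually (hJ'.mem_nhds hb)
        filter_upwards [hkb, hbJ] with y hy hyJ e
        rw [hy e, hKG' (π y, e) hyJ]
  choose! J hJ hJc h0J hzJ G hG hk0 hkz using hex
  have hagree : ∀ z ∈ D, ∀ z' ∈ D, EqOn (G z) (G z') ((J z ∩ J z') ×ˢ univ) := fun z hz z' hz' =>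
    huniq z₀ hz₀ _ _ _ _ (hJ z hz) (hJ z' hz') (hJc z hz) (hJc z' hz') (h0J z hz) (h0J z' hz')
      (hG z hz) (hG z' hz') (hk0 z hz) (hk0 z' hz')
  classical
  let K : ℝ × ℝ → ℝ := fun w => if h : ∃ z ∈ D, w.1 ∈ J z then G h.choose w else 0
  have hK : ∀ z ∈ D, ∀ w : ℝ × ℝ, w.1 ∈ J z → K w = G z w := by
    intro z hz w hw
    have h : ∃ z ∈ D, w.1 ∈ J z := ⟨z, hz, hw⟩
    simp only [K, dif_pos h]
    exact hagree _ h.choose_spec.1 z hz ⟨⟨h.choose_spec.2, hw⟩, trivial⟩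
  refine ⟨K, ?_, ?_⟩
  · rintro ⟨-, e⟩ ⟨⟨z, hz, rfl⟩, -⟩
    refine (hG z hz (π z, e) ⟨hzJ z hz, trivial⟩).congr ?_
    filter_upwards [continuousAt_fst.eventually ((hJ z hz).mem_nhds (hzJ z hz))] with v hv
    exact (hK z hz v hv).symm
  · intro z hz e
    rw [hK z hz (π z, e) (hzJ z hz)]
    exact (hkz z hz).self_of_nhds e

/-! ### Analyticity of primitives -/

section Primitives

variable {E F : Type*} [NormedAddCommGroup E] [NormedSpace ℝ E]
  [NormedAddCommGroup F] [NormedSpace ℝ F] [CompleteSpace F]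

/-- Averaging an analytic function over a continuous family of linear contractions of its argument
gives an analytic function: the power series may be integrated term by term. -/
theorem analyticAt_integral_comp_clm {f : E → F} {z₀ : E} (hf : AnalyticAt ℝ f z₀)
    {L : ℝ → E →L[ℝ] E} (hL : Continuous L) (hL1 : ∀ t ∈ Icc (0 : ℝ) 1, ‖L t‖ ≤ 1) :
    AnalyticAt ℝ (fun w => ∫ t in (0 : ℝ)..1, f (z₀ + L t w)) 0 := by
  obtain ⟨p, r, hp⟩ := hf
  let q : FormalMultilinearSeries ℝ E F := fun n =>
    ∫ t in (0 : ℝ)..1, (p n).compContinuousLinearMap (fun _ => L t)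
  have hcont : ∀ n, Continuous fun t => (p n).compContinuousLinearMap (fun _ : Fin n => L t) := by
    intro n
    have h1 : Continuous fun t : ℝ => (fun _ : Fin n => L t) := continuous_pi fun _ => hL
    exact ((ContinuousMultilinearMap.compContinuousLinearMapContinuousMultilinear ℝ
      (fun _ : Fin n => E) (fun _ : Fin n => E) F).cont.comp h1).clm_apply continuous_const
  have hbd : ∀ n, ∀ t ∈ Icc (0 : ℝ) 1,
      ‖(p n).compContinuousLinearMap (fun _ : Fin n => L t)‖ ≤ ‖p n‖ := by
    intro n t ht
    refine (ContinuousMultilinearMap.norm_compContinuousLinearMap_le _ _).trans ?_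
    refine mul_le_of_le_one_right (norm_nonneg _) ?_
    simpa using pow_le_one₀ (norm_nonneg _) (hL1 t ht)
  have hq : ∀ n, ‖q n‖ ≤ ‖p n‖ := by
    intro n
    have := intervalIntegral.norm_integral_le_of_norm_le_const (a := (0 : ℝ)) (b := 1)
      (f := fun t => (p n).compContinuousLinearMap (fun _ : Fin n => L t)) (C := ‖p n‖)
      (fun t ht => hbd n t (by
        rw [uIoc_of_le zero_le_one] at ht; exact ⟨ht.1.le, ht.2⟩))
    simpa using this
  refine ⟨q, r, ⟨?_, hp.r_pos, ?_⟩⟩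
  · refine hp.r_le.trans ?_
    refine ENNReal.le_of_forall_nnreal_lt fun s hs => ?_
    obtain ⟨C, -, hC⟩ := p.norm_mul_pow_le_of_lt_radius hs
    exact q.le_radius_of_bound C fun n =>
      (mul_le_mul_of_nonneg_right (hq n) (by positivity)).trans (hC n)
  · intro y hy
    rw [zero_add]
    have hyr : ∀ t ∈ Icc (0 : ℝ) 1, L t y ∈ Metric.eball (0 : E) r := by
      intro t ht
      have h1 : ‖L t y‖ ≤ ‖y‖ := by
        simpa using (L t).le_of_opNorm_le (hL1 t ht) y
      rw [Metric.mem_eball, edist_zero_right] at hy ⊢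
      refine lt_of_le_of_lt ?_ hy
      rw [enorm_le_iff_norm_le]
      exact h1
    have hsum : Summable fun n => ‖p n‖ * ‖y‖ ^ n := by
      have : (‖y‖₊ : ENNReal) < p.radius := by
        rw [Metric.mem_eball, edist_zero_right] at hy
        exact lt_of_lt_of_le hy hp.r_le
      simpa using p.summable_norm_mul_pow this
    have key := intervalIntegral.hasSum_integral_of_dominated_convergence
      (a := (0 : ℝ)) (b := 1) (μ := MeasureTheory.volume)
      (F := fun n t => (p n) (fun _ => L t y)) (f := fun t => f (z₀ + L t y))
      (bound := fun n _ => ‖p n‖ * ‖y‖ ^ n)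
      (fun n => by
        have h := (hcont n)
        have : Continuous fun t => (p n) (fun _ : Fin n => L t y) := by
          have h3 : Continuous fun t : ℝ => (fun _ : Fin n => L t y) :=
            continuous_pi fun _ => hL.clm_apply continuous_const
          exact (p n).cont.comp h3
        exact this.aestronglyMeasurable)
      (fun n => Filter.Eventually.of_forall fun t ht => by
        rw [uIoc_of_le zero_le_one] at ht
        have ht' : t ∈ Icc (0 : ℝ) 1 := ⟨ht.1.le, ht.2⟩
        refine ((p n).le_opNorm _).trans ?_
        refine mul_le_mul_of_nonneg_left ?_ (norm_nonneg _)
        simp only [Finset.prod_const, Finset.card_univ, Fintype.card_fin]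
        exact pow_le_pow_left₀ (norm_nonneg _)
          (by simpa using (L t).le_of_opNorm_le (hL1 t ht') y) _)
      (Filter.Eventually.of_forall fun _ _ => hsum) (by simp)
      (Filter.Eventually.of_forall fun t ht => by
        rw [uIoc_of_le zero_le_one] at ht
        exact hp.hasSum (hyr t ⟨ht.1.le, ht.2⟩))
    convert key using 2 with n
    have := ContinuousLinearMap.intervalIntegral_comp_comm
      (ContinuousMultilinearMap.apply ℝ (fun _ : Fin n => E) F (fun _ => y))
      ((hcont n).intervalIntegrable (μ := MeasureTheory.volume) 0 1)
    simpa [q] using this.symm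

/-- A function with analytic derivative is analytic. -/
theorem analyticAt_of_hasFDerivAt {f : E → F} {ω : E → E →L[ℝ] F} {z₀ : E}
    (hω : AnalyticAt ℝ ω z₀) (hf : ∀ᶠ z in 𝓝 z₀, HasFDerivAt f (ω z) z) : AnalyticAt ℝ f z₀ := by
  have hA := analyticAt_integral_comp_clm (z₀ := z₀) hω
    (L := fun t => t • ContinuousLinearMap.id ℝ E) (by fun_prop) (by
      intro t ht
      rw [norm_smul, Real.norm_of_nonneg ht.1]
      exact mul_le_one₀ ht.2 (norm_nonneg (ContinuousLinearMap.id ℝ E))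
        ContinuousLinearMap.norm_id_le)
  have hB : AnalyticAt ℝ (fun z => f z₀ +
      (∫ t in (0 : ℝ)..1, ω (z₀ + (t • ContinuousLinearMap.id ℝ E) (z - z₀))) (z - z₀)) z₀ := by
    have h0 : AnalyticAt ℝ (fun z : E => z - z₀) z₀ := by fun_prop
    refine analyticAt_const.add (AnalyticAt.comp₂
      (h := fun q : (E →L[ℝ] F) × E => q.1 q.2)
      ((ContinuousLinearMap.id ℝ (E →L[ℝ] F)).analyticAt_bilinear _) ?_ h0)
    exact AnalyticAt.comp_of_eq (g := fun w => ∫ t in (0 : ℝ)..1,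
      ω (z₀ + (t • ContinuousLinearMap.id ℝ E) w)) hA h0 (by simp)
  refine hB.congr ?_
  have h1 := hf.and (hω.eventually_analyticAt)
  obtain ⟨ε, hε, hball⟩ := Metric.eventually_nhds_iff_ball.1 h1
  filter_upwards [Metric.ball_mem_nhds z₀ hε] with z hz
  have hmem : ∀ t ∈ Icc (0 : ℝ) 1, z₀ + t • (z - z₀) ∈ Metric.ball z₀ ε := by
    intro t ht
    rw [Metric.mem_ball, dist_eq_norm] at hz ⊢
    rw [add_sub_cancel_left, norm_smul, Real.norm_of_nonneg ht.1]
    exact lt_of_le_of_lt (mul_le_of_le_one_left (norm_nonneg _) ht.2) hz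
  have hcont : ContinuousOn (fun t : ℝ => ω (z₀ + t • (z - z₀))) (Icc 0 1) := by
    intro t ht
    have h3 : ContinuousAt ω (z₀ + t • (z - z₀)) := (hball _ (hmem t ht)).2.continuousAt
    exact (ContinuousAt.comp (f := fun t : ℝ => z₀ + t • (z - z₀)) h3
      (by fun_prop)).continuousWithinAt
  have hint : IntervalIntegrable (fun t : ℝ => ω (z₀ + t • (z - z₀))) MeasureTheory.volume 0 1 :=
    (by rwa [uIcc_of_le zero_le_one] : ContinuousOn _ (uIcc (0 : ℝ) 1)).intervalIntegrable
  have hder : ∀ t ∈ uIcc (0 : ℝ) 1, HasDerivAt (fun t : ℝ => f (z₀ + t • (z - z₀)))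
      (ω (z₀ + t • (z - z₀)) (z - z₀)) t := by
    intro t ht
    rw [uIcc_of_le zero_le_one] at ht
    have h4 : HasDerivAt (fun t : ℝ => z₀ + t • (z - z₀)) (z - z₀) t := by
      simpa using ((hasDerivAt_id t).smul_const (z - z₀)).const_add z₀
    exact (hball _ (hmem t ht)).1.comp_hasDerivAt t h4
  have h5 := intervalIntegral.integral_eq_sub_of_hasDerivAt hder
    (ContinuousOn.intervalIntegrable (by
      rw [uIcc_of_le zero_le_one]; exact hcont.clm_apply continuousOn_const))
  have h6 := ContinuousLinearMap.intervalIntegral_comp_comm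
      (ContinuousLinearMap.apply ℝ F (z - z₀)) hint
  simp only [ContinuousLinearMap.apply_apply] at h6
  simp only [smul_apply, ContinuousLinearMap.id_apply]
  rw [← h6, h5]
  simp

end Primitives

/-- Integration of an analytic function of two variables over the second one. -/
theorem analyticOnNhd_integral_snd {I : Set ℝ} (hI : IsOpen I) {f : ℝ × ℝ → ℝ}
    (hf : AnalyticOnNhd ℝ f (I ×ˢ univ)) :
    AnalyticOnNhd ℝ (fun z : ℝ × ℝ => ∫ s in (0 : ℝ)..z.2, f (z.1, s)) (I ×ˢ univ) := by
  -- near any point there is an analytic function whose increments are the integrals of `f`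
  have hloc : ∀ x₀ ∈ I, ∀ p₀ : ℝ, ∃ g : ℝ × ℝ → ℝ, AnalyticAt ℝ g (x₀, p₀) ∧
      ∀ z, g z = ∫ s in p₀..z.2, f (z.1, s) := by
    intro x₀ hx₀ p₀
    let L : ℝ → ℝ × ℝ →L[ℝ] ℝ × ℝ := fun t =>
      (ContinuousLinearMap.inl ℝ ℝ ℝ).comp (ContinuousLinearMap.fst ℝ ℝ ℝ) +
      t • (ContinuousLinearMap.inr ℝ ℝ ℝ).comp (ContinuousLinearMap.snd ℝ ℝ ℝ)
    have hA := analyticAt_integral_comp_clm (hf (x₀, p₀) ⟨hx₀, trivial⟩) (L := L)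
      (by fun_prop) (by
        intro t ht
        refine ContinuousLinearMap.opNorm_le_bound _ zero_le_one fun z => ?_
        have e : L t z = (z.1, t * z.2) := by ext <;> simp [L]
        rw [e, one_mul, Prod.norm_mk, norm_mul, Real.norm_of_nonneg ht.1]
        exact max_le (norm_fst_le z)
          ((mul_le_of_le_one_left (norm_nonneg _) ht.2).trans (norm_snd_le z)))
    refine ⟨fun z => (z.2 - p₀) * ∫ t in (0 : ℝ)..1, f ((x₀, p₀) + L t (z - (x₀, p₀))), ?_, ?_⟩
    · refine (analyticAt_snd.sub analyticAt_const).mul ?_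
      have : AnalyticAt ℝ (fun z : ℝ × ℝ => z - (x₀, p₀)) (x₀, p₀) := by fun_prop
      exact AnalyticAt.comp_of_eq (g := fun w => ∫ t in (0 : ℝ)..1, f ((x₀, p₀) + L t w))
        hA this (by simp)
    · intro z
      have e : ∀ t : ℝ, (x₀, p₀) + L t (z - (x₀, p₀)) = (z.1, p₀ + (z.2 - p₀) * t) := by
        intro t; ext <;> simp [L]; ring
      simp only [e]
      have := intervalIntegral.smul_integral_comp_add_mul (a := (0 : ℝ)) (b := 1)
        (fun s => f (z.1, s)) (z.2 - p₀) p₀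
      simpa using this
  have hcont : ∀ x ∈ I, Continuous fun s => f (x, s) := fun x hx =>
    continuous_iff_continuousAt.2 fun s =>
      ContinuousAt.comp (f := fun s : ℝ => (x, s)) (hf (x, s) ⟨hx, trivial⟩).continuousAt
        (by fun_prop)
  rintro ⟨x₀, p₁⟩ ⟨hx₀, -⟩
  refine isPreconnected_univ.forall_of_locally (X := ℝ) (z₀ := 0)
    (p := fun p => AnalyticAt ℝ (fun z : ℝ × ℝ => ∫ s in (0 : ℝ)..z.2, f (z.1, s)) (x₀, p))
    trivial ?_ ?_ p₁ trivial
  · obtain ⟨g, hg, hgi⟩ := hloc x₀ hx₀ 0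
    exact hg.congr (Filter.Eventually.of_forall hgi)
  · intro p _
    obtain ⟨g, hg, hgi⟩ := hloc x₀ hx₀ p
    have hc : Tendsto (fun q : ℝ => (x₀, q)) (𝓝 p) (𝓝 (x₀, p)) :=
      (Continuous.prodMk_right x₀).tendsto p
    refine ⟨_, hc.eventually hg.eventually_analyticAt, ?_⟩
    rintro a ⟨ha, -⟩ b ⟨hb, -⟩ hFa
    have hm : AnalyticAt ℝ (fun z : ℝ × ℝ => (z.1, a)) (x₀, b) :=
      analyticAt_fst.prod analyticAt_const
    have h1 := ((AnalyticAt.comp_of_eq (f := fun z : ℝ × ℝ => (z.1, a)) hFa hm rfl).add hb).sub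
      (AnalyticAt.comp_of_eq (f := fun z : ℝ × ℝ => (z.1, a)) ha hm rfl)
    refine h1.congr ?_
    have hI' : ∀ᶠ z : ℝ × ℝ in 𝓝 (x₀, b), z.1 ∈ I :=
      continuousAt_fst.eventually (hI.mem_nhds hx₀)
    filter_upwards [hI'] with z hz
    have hi := fun u v => (hcont z.1 hz).intervalIntegrable (μ := MeasureTheory.volume) u v
    simp only [Pi.add_apply, Pi.sub_apply, Function.comp_apply, hgi]
    rw [add_sub_assoc, intervalIntegral.integral_interval_sub_left (hi _ _) (hi _ _),
      intervalIntegral.integral_add_adjacent_intervals (hi _ _) (hi _ _)]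

/-! ### Directional derivatives of analytic functions -/

section DirectionalDerivative

variable {E F : Type*} [NormedAddCommGroup E] [NormedSpace ℝ E]
  [NormedAddCommGroup F] [NormedSpace ℝ F]

/-- The derivative of `f` in the direction `e`, as a function of the point. -/
noncomputable def dd (e : E) (f : E → ℝ) : E → ℝ := fun z => fderiv ℝ f z e

theorem analyticAt_dd {f : E → ℝ} {z : E} (hf : AnalyticAt ℝ f z) (e : E) :
    AnalyticAt ℝ (dd e f) z :=
  ((ContinuousLinearMap.apply ℝ ℝ e).analyticAt _).comp hf.fderiv

theorem analyticOnNhd_dd {f : E → ℝ} {U : Set E} (hf : AnalyticOnNhd ℝ f U) (e : E) :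
    AnalyticOnNhd ℝ (dd e f) U := fun z hz => analyticAt_dd (hf z hz) e

theorem dd_congr {f g : E → ℝ} {z : E} (h : f =ᶠ[𝓝 z] g) (e : E) : dd e f z = dd e g z := by
  rw [dd, dd, h.fderiv_eq]

theorem dd_congr_on {f g : E → ℝ} {U : Set E} (hU : IsOpen U) (h : EqOn f g U) (e : E) :
    EqOn (dd e f) (dd e g) U :=
  fun _ hz => dd_congr (h.eventuallyEq_of_mem (hU.mem_nhds hz)) e

theorem dd_const (e : E) (c : ℝ) (z : E) : dd e (fun _ => c) z = 0 := by simp [dd]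

theorem dd_eq_zero_of_eqOn_const {f : E → ℝ} {U : Set E} (hU : IsOpen U) {c : ℝ}
    (h : ∀ z ∈ U, f z = c) (e : E) : ∀ z ∈ U, dd e f z = 0 := fun z hz => by
  rw [dd_congr_on hU (g := fun _ => c) h e hz, dd_const]

theorem dd_comm {f : E → ℝ} {z : E} (hf : AnalyticAt ℝ f z) (a b : E) :
    dd a (dd b f) z = dd b (dd a f) z := by
  have hd : DifferentiableAt ℝ (fderiv ℝ f) z := hf.fderiv.differentiableAt
  have key : ∀ a b, dd a (dd b f) z = fderiv ℝ (fderiv ℝ f) z a b := by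
    intro a b
    have h1 := fderiv_clm_apply hd (differentiableAt_const b)
    change fderiv ℝ (fun y => fderiv ℝ f y b) z a = _
    rw [h1]
    simp
  rw [key, key]
  exact (hf.contDiffAt (n := ⊤)).isSymmSndFDerivAt (by simp) a b

theorem dd_comm_inner {f : E → ℝ} {z : E} (hf : AnalyticAt ℝ f z) (a b c : E) :
    dd a (dd b (dd c f)) z = dd a (dd c (dd b f)) z :=
  dd_congr (hf.eventually_analyticAt.mono fun _ hy => dd_comm hy b c) a

theorem dd_add {f g : E → ℝ} {z : E} (hf : AnalyticAt ℝ f z) (hg : AnalyticAt ℝ g z) (e : E) :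
    dd e (fun y => f y + g y) z = dd e f z + dd e g z := by
  simp [dd, fderiv_fun_add hf.differentiableAt hg.differentiableAt]

theorem dd_sub {f g : E → ℝ} {z : E} (hf : AnalyticAt ℝ f z) (hg : AnalyticAt ℝ g z) (e : E) :
    dd e (fun y => f y - g y) z = dd e f z - dd e g z := by
  simp [dd, fderiv_fun_sub hf.differentiableAt hg.differentiableAt]

theorem dd_neg (f : E → ℝ) (z : E) (e : E) :
    dd e (fun y => -f y) z = -dd e f z := by
  simp [dd, fderiv_fun_neg]

theorem dd_mul {f g : E → ℝ} {z : E} (hf : AnalyticAt ℝ f z) (hg : AnalyticAt ℝ g z) (e : E) :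
    dd e (fun y => f y * g y) z = dd e f z * g z + f z * dd e g z := by
  simp [dd, fderiv_fun_mul hf.differentiableAt hg.differentiableAt]
  ring

theorem dd_const_mul {f : E → ℝ} {z : E} (c : ℝ) (hf : AnalyticAt ℝ f z) (e : E) :
    dd e (fun y => c * f y) z = c * dd e f z := by
  rw [dd_mul analyticAt_const hf, dd_const, zero_mul, zero_add]

theorem dd_div {f g : E → ℝ} {z : E} (hf : AnalyticAt ℝ f z) (hg : AnalyticAt ℝ g z)
    (h0 : g z ≠ 0) (e : E) :
    dd e (fun y => f y / g y) z = (dd e f z * g z - f z * dd e g z) / g z ^ 2 := by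
  have h1 : dd e f z = dd e (fun y => (f y / g y) * g y) z := by
    refine dd_congr ?_ e
    filter_upwards [hg.continuousAt.eventually_ne h0] with y hy
    field_simp
  rw [h1, dd_mul (hf.fun_div hg h0) hg]
  field_simp
  ring

theorem dd_sum {ι : Type*} (s : Finset ι) {f : ι → E → ℝ} {z : E}
    (hf : ∀ i ∈ s, AnalyticAt ℝ (f i) z) (e : E) :
    dd e (fun y => ∑ i ∈ s, f i y) z = ∑ i ∈ s, dd e (f i) z := by
  simp [dd, fderiv_fun_sum fun i hi => (hf i hi).differentiableAt]

theorem dd_comp {f : F → ℝ} {φ : E → F} {z : E} (hf : AnalyticAt ℝ f (φ z))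
    (hφ : DifferentiableAt ℝ φ z) (e : E) :
    dd e (fun y => f (φ y)) z = dd (fderiv ℝ φ z e) f (φ z) := by
  have := fderiv_comp z hf.differentiableAt hφ
  simp only [dd]
  erw [this]
  rfl

theorem dd_comp_clm {f : F → ℝ} (L : E →L[ℝ] F) {z : E} (hf : AnalyticAt ℝ f (L z)) (e : E) :
    dd e (fun y => f (L y)) z = dd (L e) f (L z) := by
  rw [dd_comp hf L.differentiableAt, L.fderiv]

theorem dd_comp_real {g : ℝ → ℝ} {f : E → ℝ} {z : E} (hg : AnalyticAt ℝ g (f z))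
    (hf : AnalyticAt ℝ f z) (e : E) : dd e (fun y => g (f y)) z = deriv g (f z) * dd e f z := by
  rw [dd_comp hg hf.differentiableAt]
  simp only [dd]
  rw [← toSpanSingleton_deriv]
  simp [mul_comm]

theorem dd_clm (L : E →L[ℝ] ℝ) (e z : E) : dd e (fun y => L y) z = L e := by
  simp only [dd]
  rw [L.fderiv]

theorem dd_zero_dir (f : E → ℝ) (z : E) : dd 0 f z = 0 := by simp [dd]

theorem dd_add_dir (a b : E) (f : E → ℝ) (z : E) : dd (a + b) f z = dd a f z + dd b f z := by
  simp [dd]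

theorem dd_smul_dir (c : ℝ) (a : E) (f : E → ℝ) (z : E) : dd (c • a) f z = c * dd a f z := by
  simp [dd]

/-- The derivative along a line is a directional derivative. -/
theorem hasDerivAt_line {f : E → ℝ} {z e : E} {t : ℝ} (hf : AnalyticAt ℝ f (z + t • e)) :
    HasDerivAt (fun s : ℝ => f (z + s • e)) (dd e f (z + t • e)) t := by
  have h4 : HasDerivAt (fun t : ℝ => z + t • e) e t := by
    simpa using ((hasDerivAt_id t).smul_const e).const_add z
  exact hf.differentiableAt.hasFDerivAt.comp_hasDerivAt t h4

/-- A function is constant along a line on which its derivative in the direction of the line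
vanishes. -/
theorem eq_of_dd_eq_zero {f : E → ℝ} {z e : E} (hf : ∀ t : ℝ, AnalyticAt ℝ f (z + t • e))
    (h : ∀ t : ℝ, dd e f (z + t • e) = 0) (t : ℝ) : f (z + t • e) = f z := by
  have := is_const_of_deriv_eq_zero (f := fun s : ℝ => f (z + s • e))
    (fun s => (hasDerivAt_line (hf s)).differentiableAt)
    (fun s => by rw [(hasDerivAt_line (hf s)).deriv, h s]) t 0
  simpa using this

end DirectionalDerivative

/-! ### Functions of one position and one momentum -/

/-- The direction of the position in the phase plane. -/
def e1 : ℝ × ℝ := (1, 0)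

/-- The direction of the momentum in the phase plane. -/
def e2 : ℝ × ℝ := (0, 1)

/-- The Poisson bracket on the phase plane. -/
noncomputable def br1 (f g : ℝ × ℝ → ℝ) : ℝ × ℝ → ℝ :=
  fun z => dd e1 f z * dd e2 g z - dd e1 g z * dd e2 f z

theorem analyticAt_br1 {f g : ℝ × ℝ → ℝ} {z : ℝ × ℝ} (hf : AnalyticAt ℝ f z)
    (hg : AnalyticAt ℝ g z) : AnalyticAt ℝ (br1 f g) z :=
  ((analyticAt_dd hf _).mul (analyticAt_dd hg _)).sub
    ((analyticAt_dd hg _).mul (analyticAt_dd hf _))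

theorem dd_br1 {f g : ℝ × ℝ → ℝ} {z : ℝ × ℝ} (hf : AnalyticAt ℝ f z) (hg : AnalyticAt ℝ g z)
    (e : ℝ × ℝ) : dd e (br1 f g) z = br1 (dd e f) g z + br1 f (dd e g) z := by
  have h := fun e => analyticAt_dd hf e
  have h' := fun e => analyticAt_dd hg e
  change dd e (fun z => dd e1 f z * dd e2 g z - dd e1 g z * dd e2 f z) z = _
  simp only [br1]
  rw [dd_sub ((h _).fun_mul (h' _)) ((h' _).fun_mul (h _)), dd_mul (h _) (h' _), dd_mul (h' _) (h _)]
  simp only [dd_comm hf e, dd_comm hg e]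
  ring

theorem dd_e1_eq_deriv {f : ℝ × ℝ → ℝ} {x p : ℝ} (hf : AnalyticAt ℝ f (x, p)) :
    dd e1 f (x, p) = deriv (fun t => f (t, p)) x := by
  have h : HasDerivAt (fun t : ℝ => (t, p)) e1 x := (hasDerivAt_id x).prodMk (hasDerivAt_const x p)
  exact (hf.differentiableAt.hasFDerivAt.comp_hasDerivAt (f := fun t : ℝ => (t, p)) x h).deriv.symm

theorem hasDerivAt_snd {f : ℝ × ℝ → ℝ} {x p : ℝ} (hf : AnalyticAt ℝ f (x, p)) :
    HasDerivAt (fun t => f (x, t)) (dd e2 f (x, p)) p := by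
  have h : HasDerivAt (fun t : ℝ => (x, t)) e2 p := (hasDerivAt_const p x).prodMk (hasDerivAt_id p)
  exact hf.differentiableAt.hasFDerivAt.comp_hasDerivAt (f := fun t : ℝ => (x, t)) p h

theorem hasDerivAt_fst {f : ℝ × ℝ → ℝ} {x p : ℝ} (hf : AnalyticAt ℝ f (x, p)) :
    HasDerivAt (fun t => f (t, p)) (dd e1 f (x, p)) x := by
  have h : HasDerivAt (fun t : ℝ => (t, p)) e1 x := (hasDerivAt_id x).prodMk (hasDerivAt_const x p)
  exact hf.differentiableAt.hasFDerivAt.comp_hasDerivAt (f := fun t : ℝ => (t, p)) x h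

theorem dd_e2_eq_deriv {f : ℝ × ℝ → ℝ} {x p : ℝ} (hf : AnalyticAt ℝ f (x, p)) :
    dd e2 f (x, p) = deriv (fun t => f (x, t)) p := (hasDerivAt_snd hf).deriv.symm

theorem analyticAt_slice {f : ℝ × ℝ → ℝ} {x p : ℝ} (hf : AnalyticAt ℝ f (x, p)) :
    AnalyticAt ℝ (fun t => f (x, t)) p :=
  AnalyticAt.comp_of_eq (f := fun t : ℝ => (x, t)) hf (analyticAt_const.prod analyticAt_id) rfl

theorem analyticAt_slice_fst {f : ℝ × ℝ → ℝ} {x p : ℝ} (hf : AnalyticAt ℝ f (x, p)) :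
    AnalyticAt ℝ (fun t => f (t, p)) x :=
  AnalyticAt.comp_of_eq (f := fun t : ℝ => (t, p)) hf (analyticAt_id.prod analyticAt_const) rfl

theorem analyticAt_comp_fst {f : ℝ → ℝ} {z : ℝ × ℝ} (hf : AnalyticAt ℝ f z.1) :
    AnalyticAt ℝ (fun y : ℝ × ℝ => f y.1) z := AnalyticAt.comp hf analyticAt_fst

theorem analyticAt_comp_snd {f : ℝ → ℝ} {z : ℝ × ℝ} (hf : AnalyticAt ℝ f z.2) :
    AnalyticAt ℝ (fun y : ℝ × ℝ => f y.2) z := AnalyticAt.comp hf analyticAt_snd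

theorem dd_comp_fst {f : ℝ → ℝ} {z : ℝ × ℝ} (hf : AnalyticAt ℝ f z.1) (e : ℝ × ℝ) :
    dd e (fun y : ℝ × ℝ => f y.1) z = deriv f z.1 * e.1 := by
  rw [dd_comp_real hf analyticAt_fst]
  exact congrArg _ (dd_clm (ContinuousLinearMap.fst ℝ ℝ ℝ) e z)

theorem dd_comp_snd {f : ℝ → ℝ} {z : ℝ × ℝ} (hf : AnalyticAt ℝ f z.2) (e : ℝ × ℝ) :
    dd e (fun y : ℝ × ℝ => f y.2) z = deriv f z.2 * e.2 := by
  rw [dd_comp_real hf analyticAt_snd]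
  exact congrArg _ (dd_clm (ContinuousLinearMap.snd ℝ ℝ ℝ) e z)

/-- A closed analytic pair of functions on a strip is the gradient of an analytic function. -/
theorem exists_potential {I : Set ℝ} (hI : IsOpen I) (hIc : IsConnected I) {a b : ℝ × ℝ → ℝ}
    (ha : AnalyticOnNhd ℝ a (I ×ˢ univ)) (hb : AnalyticOnNhd ℝ b (I ×ˢ univ))
    (hab : ∀ z ∈ I ×ˢ (univ : Set ℝ), dd e2 a z = dd e1 b z) :
    ∃ f : ℝ × ℝ → ℝ, AnalyticOnNhd ℝ f (I ×ˢ univ) ∧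
      ∀ z ∈ I ×ˢ (univ : Set ℝ), dd e1 f z = a z ∧ dd e2 f z = b z := by
  have hconv : Convex ℝ (I ×ˢ (univ : Set ℝ)) :=
    (isPreconnected_iff_ordConnected.1 hIc.isPreconnected).convex.prod convex_univ
  let A : ℝ × ℝ →L[ℝ] ℝ := ContinuousLinearMap.fst ℝ ℝ ℝ
  let B : ℝ × ℝ →L[ℝ] ℝ := ContinuousLinearMap.snd ℝ ℝ ℝ
  let ω : ℝ × ℝ → (ℝ × ℝ →L[ℝ] ℝ) := fun z => a z • A + b z • B
  have hω : AnalyticOnNhd ℝ ω (I ×ˢ univ) := fun z hz =>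
    ((ha z hz).smul analyticAt_const).add ((hb z hz).smul analyticAt_const)
  obtain ⟨f, hf⟩ := hconv.exists_forall_hasFDerivAt_of_fderiv_symmetric (hI.prod isOpen_univ)
    (ω := ω) hω.differentiableOn (by
      intro z hz u v
      have h1 : HasFDerivAt ω ((fderiv ℝ a z).smulRight A + (fderiv ℝ b z).smulRight B) z :=
        ((ha z hz).differentiableAt.hasFDerivAt.smul_const A).add
          ((hb z hz).differentiableAt.hasFDerivAt.smul_const B)
      have key : ∀ (g : ℝ × ℝ → ℝ) (w : ℝ × ℝ),
          fderiv ℝ g z w = w.1 * dd e1 g z + w.2 * dd e2 g z := by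
        intro g w
        have : w = w.1 • e1 + w.2 • e2 := by ext <;> simp [e1, e2]
        conv_lhs => rw [this]
        simp [dd]
      rw [h1.fderiv]
      simp [key, A, B, hab z hz]
      ring)
  have hfd : ∀ z ∈ I ×ˢ (univ : Set ℝ), dd e1 f z = a z ∧ dd e2 f z = b z := by
    intro z hz
    simp only [dd, (hf z hz).fderiv]
    simp [ω, A, B, e1, e2]
  refine ⟨f, fun z hz => analyticAt_of_hasFDerivAt (hω z hz) ?_, hfd⟩
  filter_upwards [(hI.prod isOpen_univ).mem_nhds hz] with y hy using hf y hy

/-- An analytic function on an open interval has an analytic primitive. -/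
theorem exists_primitive {I : Set ℝ} (hI : IsOpen I) (hIc : IsConnected I) {g : ℝ → ℝ}
    (hg : AnalyticOnNhd ℝ g I) :
    ∃ G : ℝ → ℝ, AnalyticOnNhd ℝ G I ∧ ∀ x ∈ I, deriv G x = g x := by
  obtain ⟨f, hf, hfd⟩ := exists_potential hI hIc (a := fun z => g z.1) (b := fun _ => 0)
    (fun z hz => analyticAt_comp_fst (hg _ hz.1)) (fun _ _ => analyticAt_const) (by
      intro z hz
      rw [dd_comp_fst (hg _ hz.1), dd_const]
      simp [e2])
  refine ⟨fun x => f (x, 0), fun x hx => analyticAt_slice_fst (hf _ ⟨hx, trivial⟩),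
    fun x hx => ?_⟩
  rw [← dd_e1_eq_deriv (hf _ ⟨hx, trivial⟩), (hfd _ ⟨hx, trivial⟩).1]

/-- A solution of the linear equation `δ' r = δ r'` is a multiple of the solution `r`. -/
theorem eq_mul_of_deriv_mul_eq {δ r : ℝ → ℝ} (hδ : AnalyticOnNhd ℝ δ univ)
    (hr : AnalyticOnNhd ℝ r univ) (h : ∀ p, deriv δ p * r p = δ p * deriv r p) {p₀ : ℝ}
    (h0 : r p₀ ≠ 0) : ∀ p, δ p = δ p₀ / r p₀ * r p := by
  obtain ⟨ε, hε, hb⟩ := Metric.eventually_nhds_iff_ball.1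
    ((hr p₀ trivial).continuousAt.eventually_ne h0)
  have hconst : ∀ p ∈ Metric.ball p₀ ε, δ p / r p = δ p₀ / r p₀ := by
    intro p hp
    refine Metric.isOpen_ball.is_const_of_deriv_eq_zero (f := fun p => δ p / r p) ?_ ?_ ?_ hp
      (Metric.mem_ball_self hε)
    · exact (convex_ball _ _).isPreconnected
    · intro q hq
      exact ((hδ q trivial).differentiableAt.div (hr q trivial).differentiableAt
        (hb q hq)).differentiableWithinAt
    · intro q hq
      have := ((hδ q trivial).differentiableAt.hasDerivAt.div
        (hr q trivial).differentiableAt.hasDerivAt (hb q hq)).deriv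
      erw [this, h q, sub_self, zero_div]
      rfl
  have h2 : EqOn δ (fun p => δ p₀ / r p₀ * r p) univ := by
    refine hδ.eqOn_of_preconnected_of_eventuallyEq (fun p _ => analyticAt_const.mul (hr p trivial))
      isPreconnected_univ (mem_univ p₀) ?_
    filter_upwards [Metric.ball_mem_nhds p₀ hε] with p hp
    have := hconst p hp
    rw [← this, div_mul_cancel₀ _ (hb p hp)]
  exact fun p => h2 trivial

/-! ### Hamiltonians as functions on phase space -/

section PhaseSpace

variable {n : ℕ}

/-- The direction of the `i`-th position coordinate in phase space. -/
noncomputable def eX (i : Fin n) : Vec n × Vec n := (Pi.single i 1, 0)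

/-- The direction of the `i`-th momentum coordinate in phase space. -/
noncomputable def eP (i : Fin n) : Vec n × Vec n := (0, Pi.single i 1)

/-- A curried Hamiltonian as a function on phase space. -/
def unc (H : PhaseFun n) : Vec n × Vec n → ℝ := fun z => H z.1 z.2

/-- The Poisson bracket of functions on phase space. -/
noncomputable def br (f g : Vec n × Vec n → ℝ) : Vec n × Vec n → ℝ :=
  fun z => ∑ k, (dd (eX k) f z * dd (eP k) g z - dd (eX k) g z * dd (eP k) f z)

/-- The velocity of a Hamiltonian on phase space. -/
noncomputable def vel (h : Vec n × Vec n → ℝ) (z : Vec n × Vec n) : Vec n := fun i => dd (eP i) h z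

/-- The `i`-th component of the force of a Hamiltonian on phase space. -/
noncomputable def frc (h : Vec n × Vec n → ℝ) (i : Fin n) : Vec n × Vec n → ℝ :=
  br (dd (eP i) h) h

/-- A regular Hamiltonian on phase space, together with the inverse of the velocity map. -/
structure Reg (D : Set (Vec n)) (h : Vec n × Vec n → ℝ) (P : Vec n × Vec n → Vec n) : Prop where
  an : AnalyticOnNhd ℝ h (D ×ˢ univ)
  anP : AnalyticOnNhd ℝ P (D ×ˢ univ)
  left : ∀ x ∈ D, ∀ p, P (x, vel h (x, p)) = p
  right : ∀ x ∈ D, ∀ v, vel h (x, P (x, v)) = v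

/-- The force of a Hamiltonian on phase space depends on the position only. -/
def VelInd (D : Set (Vec n)) (h : Vec n × Vec n → ℝ) : Prop :=
  ∃ F : Vec n → Vec n, ∀ x ∈ D, ∀ p, ∀ i, frc h i (x, p) = F x i

theorem analyticAt_br {f g : Vec n × Vec n → ℝ} {z : Vec n × Vec n} (hf : AnalyticAt ℝ f z)
    (hg : AnalyticAt ℝ g z) : AnalyticAt ℝ (br f g) z :=
  Finset.analyticAt_fun_sum _ fun _ _ => ((analyticAt_dd hf _).mul (analyticAt_dd hg _)).sub
    ((analyticAt_dd hg _).mul (analyticAt_dd hf _))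

theorem analyticAt_frc {h : Vec n × Vec n → ℝ} {z : Vec n × Vec n} (hh : AnalyticAt ℝ h z)
    (i : Fin n) : AnalyticAt ℝ (frc h i) z := analyticAt_br (analyticAt_dd hh _) hh

theorem dd_br {f g : Vec n × Vec n → ℝ} {z : Vec n × Vec n} (hf : AnalyticAt ℝ f z)
    (hg : AnalyticAt ℝ g z) (e : Vec n × Vec n) :
    dd e (br f g) z = br (dd e f) g z + br f (dd e g) z := by
  have h := fun e => analyticAt_dd hf e
  have h' := fun e => analyticAt_dd hg e
  change dd e (fun z => ∑ k, (dd (eX k) f z * dd (eP k) g z - dd (eX k) g z * dd (eP k) f z)) z = _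
  rw [dd_sum _ fun k _ => ((h _).fun_mul (h' _)).fun_sub ((h' _).fun_mul (h _))]
  simp only [br, ← Finset.sum_add_distrib]
  refine Finset.sum_congr rfl fun k _ => ?_
  rw [dd_sub ((h _).fun_mul (h' _)) ((h' _).fun_mul (h _)), dd_mul (h _) (h' _),
    dd_mul (h' _) (h _)]
  simp only [dd_comm hf e, dd_comm hg e]
  ring

theorem br_congr {f f' g g' : Vec n × Vec n → ℝ} {z : Vec n × Vec n} (hf : f =ᶠ[𝓝 z] f')
    (hg : g =ᶠ[𝓝 z] g') : br f g z = br f' g' z := by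
  simp only [br, dd_congr hf, dd_congr hg]

theorem dX_eq {H : PhaseFun n} {x p : Vec n} (hH : AnalyticAt ℝ (unc H) (x, p)) (i : Fin n) :
    dX i H x p = dd (eX i) (unc H) (x, p) := by
  have h : HasFDerivAt (fun y : Vec n => (y, p)) (ContinuousLinearMap.inl ℝ (Vec n) (Vec n)) x :=
    (hasFDerivAt_id x).prodMk (hasFDerivAt_const p x)
  have := (hH.differentiableAt.hasFDerivAt.comp (f := fun y : Vec n => (y, p)) x h).fderiv
  simp only [dX, dd]
  erw [this]
  rfl

theorem dP_eq {H : PhaseFun n} {x p : Vec n} (hH : AnalyticAt ℝ (unc H) (x, p)) (i : Fin n) :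
    dP i H x p = dd (eP i) (unc H) (x, p) := by
  have h : HasFDerivAt (fun y : Vec n => (x, y)) (ContinuousLinearMap.inr ℝ (Vec n) (Vec n)) p :=
    (hasFDerivAt_const x p).prodMk (hasFDerivAt_id p)
  have := (hH.differentiableAt.hasFDerivAt.comp (f := fun y : Vec n => (x, y)) p h).fderiv
  simp only [dP, dd]
  erw [this]
  rfl

theorem velocity_eq {H : PhaseFun n} {x p : Vec n} (hH : AnalyticAt ℝ (unc H) (x, p)) :
    velocity H x p = vel (unc H) (x, p) := funext fun i => dP_eq hH i

theorem force_eq {H : PhaseFun n} {x p : Vec n} (hH : AnalyticAt ℝ (unc H) (x, p)) (i : Fin n) :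
    force H x p i = frc (unc H) i (x, p) := by
  have h1 : unc (dP i H) =ᶠ[𝓝 (x, p)] dd (eP i) (unc H) := by
    filter_upwards [hH.eventually_analyticAt] with z hz using dP_eq hz i
  have h2 : AnalyticAt ℝ (unc (dP i H)) (x, p) := (analyticAt_dd hH _).congr h1.symm
  simp only [force, poisson, frc, br, dX_eq h2, dP_eq h2, dX_eq hH, dP_eq hH, dd_congr h1]

theorem isRegular_iff {D : Set (Vec n)} {H : PhaseFun n} :
    IsRegular D H ↔ ∃ P, Reg D (unc H) P := by
  constructor
  · rintro ⟨h, P, hP, hv⟩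
    have hve : ∀ x ∈ D, ∀ p, velocity H x p = vel (unc H) (x, p) := fun x hx p =>
      velocity_eq (h (x, p) ⟨hx, trivial⟩)
    exact ⟨fun z => P z.1 z.2, h, hP, fun x hx p => by rw [← hve x hx]; exact (hv x hx).1 p,
      fun x hx v => by rw [← hve x hx]; exact (hv x hx).2 v⟩
  · rintro ⟨P, h⟩
    have hve : ∀ x ∈ D, ∀ p, velocity H x p = vel (unc H) (x, p) := fun x hx p =>
      velocity_eq (h.an (x, p) ⟨hx, trivial⟩)
    exact ⟨h.an, fun x v => P (x, v), h.anP, fun x hx =>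
      ⟨fun p => by rw [hve x hx]; exact h.left x hx p,
        fun v => by rw [hve x hx]; exact h.right x hx v⟩⟩

theorem velocityIndependent_iff {D : Set (Vec n)} {H : PhaseFun n}
    (h : AnalyticOnNhd ℝ (unc H) (D ×ˢ univ)) :
    VelocityIndependent D H ↔ VelInd D (unc H) := by
  have hf : ∀ x ∈ D, ∀ p i, force H x p i = frc (unc H) i (x, p) := fun x hx p i =>
    force_eq (h (x, p) ⟨hx, trivial⟩) i
  constructor
  · rintro ⟨F, hF⟩
    exact ⟨F, fun x hx p i => by rw [← hf x hx, hF x hx]⟩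
  · rintro ⟨F, hF⟩
    exact ⟨F, fun x hx p => funext fun i => by rw [hf x hx, hF x hx]⟩

end PhaseSpace

/-! ### Hamiltonians of one degree of freedom -/

/-- A regular Hamiltonian on a strip of the phase plane with velocity-independent force `F`, together
with the inverse `Q` of the velocity map. -/
structure Good1 (I : Set ℝ) (η Q : ℝ × ℝ → ℝ) (F : ℝ → ℝ) : Prop where
  isOpen : IsOpen I
  conn : IsConnected I
  an : AnalyticOnNhd ℝ η (I ×ˢ univ)
  anQ : AnalyticOnNhd ℝ Q (I ×ˢ univ)
  left : ∀ x ∈ I, ∀ p, Q (x, dd e2 η (x, p)) = p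
  right : ∀ x ∈ I, ∀ v, dd e2 η (x, Q (x, v)) = v
  force : ∀ x ∈ I, ∀ p, br1 (dd e2 η) η (x, p) = F x

/-- The linear identification of the phase space of one degree of freedom with the plane. -/
noncomputable def plane : Vec 1 × Vec 1 →L[ℝ] ℝ × ℝ :=
  ((ContinuousLinearMap.proj 0).comp (ContinuousLinearMap.fst ℝ (Vec 1) (Vec 1))).prod
    ((ContinuousLinearMap.proj 0).comp (ContinuousLinearMap.snd ℝ (Vec 1) (Vec 1)))

theorem plane_apply (z : Vec 1 × Vec 1) : plane z = (z.1 0, z.2 0) := rfl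

theorem unc_lift1 (η : ℝ → ℝ → ℝ) : unc (lift1 η) = fun z => (fun w : ℝ × ℝ => η w.1 w.2) (plane z) :=
  rfl

theorem analyticAt_unc_lift1_iff {η : ℝ → ℝ → ℝ} {z : Vec 1 × Vec 1} :
    AnalyticAt ℝ (unc (lift1 η)) z ↔ AnalyticAt ℝ (fun w : ℝ × ℝ => η w.1 w.2) (plane z) := by
  constructor
  · intro h
    let M : ℝ × ℝ →L[ℝ] Vec 1 × Vec 1 :=
      (ContinuousLinearMap.pi fun _ => ContinuousLinearMap.fst ℝ ℝ ℝ).prod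
        (ContinuousLinearMap.pi fun _ => ContinuousLinearMap.snd ℝ ℝ ℝ)
    have hM : M (plane z) = z := by
      refine Prod.ext (funext fun i => ?_) (funext fun i => ?_) <;>
        simp [M, plane_apply, Subsingleton.elim i 0]
    exact AnalyticAt.comp_of_eq (g := unc (lift1 η)) h (M.analyticAt _) hM
  · intro h
    exact h.comp (plane.analyticAt z)

theorem dd_eP_lift1 {η : ℝ → ℝ → ℝ} {z : Vec 1 × Vec 1}
    (h : AnalyticAt ℝ (fun w : ℝ × ℝ => η w.1 w.2) (plane z)) :
    dd (eP 0) (unc (lift1 η)) z = dd e2 (fun w : ℝ × ℝ => η w.1 w.2) (plane z) := by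
  rw [unc_lift1, dd_comp_clm plane h]
  simp [plane_apply, eP, e2]

theorem frc_lift1 {η : ℝ → ℝ → ℝ} {z : Vec 1 × Vec 1}
    (h : AnalyticAt ℝ (fun w : ℝ × ℝ => η w.1 w.2) (plane z)) :
    frc (unc (lift1 η)) 0 z =
      br1 (dd e2 fun w : ℝ × ℝ => η w.1 w.2) (fun w : ℝ × ℝ => η w.1 w.2) (plane z) := by
  have h1 : dd (eP 0) (unc (lift1 η)) =ᶠ[𝓝 z]
      fun y => dd e2 (fun w : ℝ × ℝ => η w.1 w.2) (plane y) := by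
    filter_upwards [plane.continuous.continuousAt.eventually h.eventually_analyticAt] with y hy
    exact dd_eP_lift1 hy
  have hX : plane (eX 0) = e1 := by simp [plane_apply, eX, e1]
  have hP : plane (eP 0) = e2 := by simp [plane_apply, eP, e2]
  simp only [frc, br, Finset.univ_unique, Fin.default_eq_zero, Finset.sum_singleton, br1]
  rw [dd_congr h1, dd_congr h1, dd_comp_clm plane (analyticAt_dd h _),
    dd_comp_clm plane (analyticAt_dd h _), unc_lift1, dd_comp_clm plane h, dd_comp_clm plane h,
    hX, hP]

theorem isGood1D_iff {I : Set ℝ} {η : ℝ → ℝ → ℝ} :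
    IsGood1D I η ↔ ∃ Q F, Good1 I (fun w : ℝ × ℝ => η w.1 w.2) Q F := by
  let c : ℝ → Vec 1 := fun t _ => t
  have hc : ∀ x : Vec 1, c (x 0) = x := fun x => funext fun i => by simp [c, Subsingleton.elim i 0]
  have hcl : ∀ z : ℝ × ℝ, plane (c z.1, c z.2) = z := fun z => rfl
  have hca : ∀ t, AnalyticAt ℝ c t := fun t => by
    exact (ContinuousLinearMap.pi (R := ℝ) fun _ : Fin 1 =>
      ContinuousLinearMap.id ℝ ℝ).analyticAt t
  have hcz : ∀ z : ℝ × ℝ, AnalyticAt ℝ (fun z : ℝ × ℝ => (c z.1, c z.2)) z := fun z =>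
    ((hca _).comp analyticAt_fst).prod ((hca _).comp analyticAt_snd)
  have hvel : ∀ x p : Vec 1, AnalyticAt ℝ (fun w : ℝ × ℝ => η w.1 w.2) (x 0, p 0) →
      vel (unc (lift1 η)) (x, p) = c (dd e2 (fun w : ℝ × ℝ => η w.1 w.2) (x 0, p 0)) := by
    intro x p h
    funext i
    rw [Subsingleton.elim i 0]
    exact dd_eP_lift1 (z := (x, p)) h
  constructor
  · rintro ⟨hI, hIc, hr, hv⟩
    obtain ⟨P, hP⟩ := isRegular_iff.1 hr
    have han : AnalyticOnNhd ℝ (fun w : ℝ × ℝ => η w.1 w.2) (I ×ˢ univ) := fun z hz =>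
      analyticAt_unc_lift1_iff.1 (hP.an (c z.1, c z.2) ⟨hz.1, trivial⟩)
    obtain ⟨F, hF⟩ := (velocityIndependent_iff hP.an).1 hv
    refine ⟨fun z => P (c z.1, c z.2) 0, fun x => F (c x) 0, hI, hIc, han, ?_, ?_, ?_, ?_⟩
    · intro z hz
      have h1 : AnalyticAt ℝ (fun z : ℝ × ℝ => P (c z.1, c z.2)) z :=
        AnalyticAt.comp_of_eq (f := fun z : ℝ × ℝ => (c z.1, c z.2))
          (hP.anP (c z.1, c z.2) ⟨hz.1, trivial⟩) (hcz z) rfl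
      exact ((ContinuousLinearMap.proj (R := ℝ) (φ := fun _ : Fin 1 => ℝ) 0).analyticAt _).comp h1
    · intro x hx p
      have := hP.left (c x) hx (c p)
      rw [hvel (c x) (c p) (han _ ⟨hx, trivial⟩)] at this
      exact congrFun this 0
    · intro x hx v
      have := hP.right (c x) hx (c v)
      rw [hvel _ _ (han _ ⟨hx, trivial⟩)] at this
      exact congrFun this 0
    · intro x hx p
      rw [← hF (c x) hx (c p) 0, frc_lift1]
      · rfl
      · exact han _ ⟨hx, trivial⟩
  · rintro ⟨Q, F, h⟩
    have han : AnalyticOnNhd ℝ (unc (lift1 η)) (dom1 I ×ˢ univ) := fun z hz =>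
      analyticAt_unc_lift1_iff.2 (h.an _ ⟨hz.1, trivial⟩)
    refine ⟨h.isOpen, h.conn, isRegular_iff.2 ⟨fun z => c (Q (plane z)), han, ?_, ?_, ?_⟩,
      (velocityIndependent_iff han).2 ⟨fun x => c (F (x 0)), ?_⟩⟩
    · intro z hz
      exact (hca _).comp (AnalyticAt.comp (h.anQ (plane z) ⟨hz.1, trivial⟩) (plane.analyticAt z))
    · intro x hx p
      rw [hvel x p (h.an _ ⟨hx, trivial⟩), plane_apply]
      change c (Q (x 0, dd e2 _ (x 0, p 0))) = p
      rw [h.left _ hx, hc]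
    · intro x hx v
      rw [hvel _ _ (h.an _ ⟨hx, trivial⟩), plane_apply]
      change c (dd e2 _ (x 0, Q (x 0, v 0))) = v
      rw [h.right _ hx, hc]
    · intro x hx p i
      rw [Subsingleton.elim i 0, frc_lift1 (z := (x, p)) (h.an _ ⟨hx, trivial⟩)]
      exact h.force _ hx _

theorem force_lift1_ne_zero_iff {I : Set ℝ} {η : ℝ → ℝ → ℝ} {Q : ℝ × ℝ → ℝ} {F : ℝ → ℝ}
    (h : Good1 I (fun w : ℝ × ℝ => η w.1 w.2) Q F) :
    (∃ x ∈ dom1 I, ∃ p, force (lift1 η) x p ≠ 0) ↔ ∃ x ∈ I, F x ≠ 0 := by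
  have key : ∀ x ∈ dom1 I, ∀ p, force (lift1 η) x p = fun _ => F (x 0) := by
    intro x hx p
    funext i
    rw [force_eq (analyticAt_unc_lift1_iff.2 (h.an (x 0, p 0) ⟨hx, trivial⟩)),
      Subsingleton.elim i 0, frc_lift1 (h.an (x 0, p 0) ⟨hx, trivial⟩)]
    exact h.force _ hx _
  constructor
  · rintro ⟨x, hx, p, hne⟩
    refine ⟨x 0, hx, fun h0 => hne ?_⟩
    rw [key x hx p, h0]
    rfl
  · rintro ⟨x, hx, hne⟩
    refine ⟨fun _ => x, hx, 0, fun h0 => hne ?_⟩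
    rw [key _ hx] at h0
    exact congrFun h0 0

/-! ### Conserved quantities of one degree of freedom -/

theorem exists_analytic_inverse {f : ℝ → ℝ} {x : ℝ} (hf : AnalyticAt ℝ f x) (h0 : deriv f x ≠ 0) :
    ∃ W : ℝ → ℝ, AnalyticAt ℝ W (f x) ∧ W (f x) = x ∧ (∀ᶠ t in 𝓝 x, W (f t) = t) ∧
      ∀ᶠ y in 𝓝 (f x), f (W y) = y :=
  ⟨_, hf.analyticAt_localInverse h0,
    (HasStrictDerivAt.eventually_left_inverse (hf := hf.hasStrictDerivAt) (hf' := h0)).self_of_nhds,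
    HasStrictDerivAt.eventually_left_inverse (hf := hf.hasStrictDerivAt) (hf' := h0),
    HasStrictDerivAt.eventually_right_inverse (hf := hf.hasStrictDerivAt) (hf' := h0)⟩

/-- An even analytic function is an analytic function of the square. -/
theorem exists_comp_sq_of_even {f : ℝ → ℝ} (hf : AnalyticAt ℝ f 0)
    (he : ∀ᶠ v in 𝓝 0, f (-v) = f v) :
    ∃ g : ℝ → ℝ, AnalyticAt ℝ g 0 ∧ ∀ᶠ v in 𝓝 0, f v = g (v ^ 2) := by
  obtain ⟨p, hp⟩ := hf
  have h1 := hasFPowerSeriesAt_iff.1 hp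
  simp only [zero_add, smul_eq_mul] at h1
  obtain ⟨ε, hε, hb⟩ := Metric.eventually_nhds_iff_ball.1 (h1.and he)
  have hneg : ∀ v ∈ Metric.ball (0 : ℝ) ε, -v ∈ Metric.ball (0 : ℝ) ε := by
    intro v hv; simpa using hv
  -- only the even coefficients contribute
  have hev : ∀ v ∈ Metric.ball (0 : ℝ) ε, HasSum (fun n => (v ^ 2) ^ n * p.coeff (2 * n)) (f v) := by
    intro v hv
    have h2 := ((hb v hv).1.add (hb _ (hneg v hv)).1).mul_left (1 / 2)
    rw [(hb v hv).2] at h2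
    have h3 : (1 / 2 : ℝ) * (f v + f v) = f v := by ring
    rw [h3] at h2
    have hinj : Function.Injective fun n : ℕ => 2 * n := fun a b h => by
      simpa using h
    have h4 := (hinj.hasSum_iff (f := fun n => 1 / 2 * (v ^ n * p.coeff n + (-v) ^ n * p.coeff n))
      (a := f v) (by
        intro n hn
        have hodd : Odd n := by
          rw [← Nat.not_even_iff_odd]
          rintro ⟨m, hm⟩
          exact hn ⟨m, by simp only; omega⟩
        rw [hodd.neg_pow]; ring)).2 h2
    refine h4.congr_fun ?_ |> fun h => h
    intro n
    simp only [Function.comp]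
    rw [(even_two_mul n).neg_pow, ← pow_mul]
    ring
  let q : FormalMultilinearSeries ℝ ℝ ℝ := FormalMultilinearSeries.ofScalars ℝ fun n =>
    p.coeff (2 * n)
  refine ⟨fun t => ∑' n, t ^ n * p.coeff (2 * n), ⟨q, hasFPowerSeriesAt_iff.2 ?_⟩, ?_⟩
  · have hb2 : Metric.ball (0 : ℝ) (ε ^ 2) ∈ 𝓝 (0 : ℝ) := Metric.ball_mem_nhds _ (by positivity)
    filter_upwards [hb2] with t ht
    simp only [zero_add, smul_eq_mul, q, FormalMultilinearSeries.coeff_ofScalars]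
    refine Summable.hasSum ?_
    have hs : √|t| ∈ Metric.ball (0 : ℝ) ε := by
      rw [mem_ball_zero_iff, Real.norm_of_nonneg (Real.sqrt_nonneg _), Real.sqrt_lt' hε]
      simpa using ht
    have h5 := (hev _ hs).summable.abs
    refine Summable.of_abs (h5.congr fun n => ?_)
    rw [Real.sq_sqrt (abs_nonneg t), abs_mul, abs_mul, abs_pow, abs_pow, abs_abs]
  · filter_upwards [Metric.ball_mem_nhds (0 : ℝ) hε] with v hv
    exact (hev v hv).tsum_eq.symm

theorem exists_factor_of_deriv_ne_zero {f h : ℝ → ℝ} {v : ℝ} (hf : AnalyticAt ℝ f v)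
    (hh : AnalyticAt ℝ h v) (h0 : deriv h v ≠ 0) :
    ∃ G : ℝ → ℝ, AnalyticAt ℝ G (h v) ∧ ∀ᶠ t in 𝓝 v, f t = G (h t) := by
  obtain ⟨W, hW, hWv, hl, -⟩ := exists_analytic_inverse hh h0
  exact ⟨f ∘ W, AnalyticAt.comp_of_eq hf hW hWv, hl.mono fun t ht => by simp [ht]⟩

/-- A function factors locally through `h` also at a nondegenerate critical point of `h` at the
origin, provided both functions are even. -/
theorem exists_factor_of_even {f h b : ℝ → ℝ} {v : ℝ} (hf : AnalyticAt ℝ f v)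
    (hh : AnalyticAt ℝ h v) (hb : ContinuousAt b v) (hbv : b v ≠ 0)
    (hd : ∀ᶠ t in 𝓝 v, deriv h t = t * b t)
    (hfe : ∀ t, f (-t) = f t) (hhe : ∀ t, h (-t) = h t) :
    ∃ G : ℝ → ℝ, AnalyticAt ℝ G (h v) ∧ ∀ᶠ t in 𝓝 v, f t = G (h t) := by
  by_cases hv : v = 0
  · subst hv
    obtain ⟨f₁, hf₁, hff⟩ := exists_comp_sq_of_even hf (Eventually.of_forall hfe)
    obtain ⟨h₁, hh₁, hhh⟩ := exists_comp_sq_of_even hh (Eventually.of_forall hhe)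
    have hsq : Tendsto (fun t : ℝ => t ^ 2) (𝓝 0) (𝓝 0) := by
      have : Continuous fun t : ℝ => t ^ 2 := by fun_prop
      simpa using this.tendsto 0
    have h1 : ∀ᶠ t in 𝓝[≠] (0 : ℝ), deriv h₁ (t ^ 2) = b t / 2 := by
      filter_upwards [nhdsWithin_le_nhds hhh.eventually_nhds, nhdsWithin_le_nhds hd,
        nhdsWithin_le_nhds (hsq.eventually hh₁.eventually_analyticAt), self_mem_nhdsWithin]
        with t h1 h2 h3 h4
      have h5 : deriv h t = deriv h₁ (t ^ 2) * (2 * t) := by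
        have h6 : h =ᶠ[𝓝 t] fun s => h₁ (s ^ 2) := h1
        have h7 : HasDerivAt (fun s : ℝ => s ^ 2) (2 * t) t := by simpa using hasDerivAt_pow 2 t
        rw [h6.deriv_eq]
        exact (HasDerivAt.comp (h := fun s : ℝ => s ^ 2) t h3.differentiableAt.hasDerivAt h7).deriv
      have h4' : t ≠ 0 := h4
      rw [h2] at h5
      field_simp
      have := mul_left_cancel₀ h4' (a := t) (b := b t) (c := deriv h₁ (t ^ 2) * 2)
        (by linarith)
      linarith
    have h2 : Tendsto (fun t : ℝ => deriv h₁ (t ^ 2)) (𝓝[≠] 0) (𝓝 (deriv h₁ 0)) :=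
      ((hh₁.deriv.continuousAt.tendsto).comp hsq).mono_left nhdsWithin_le_nhds
    have h3 : Tendsto (fun t : ℝ => b t / 2) (𝓝[≠] 0) (𝓝 (b 0 / 2)) :=
      (hb.tendsto.div_const 2).mono_left nhdsWithin_le_nhds
    have h4 : deriv h₁ 0 = b 0 / 2 := tendsto_nhds_unique (h2.congr' h1) h3
    obtain ⟨G, hG, hGe⟩ := exists_factor_of_deriv_ne_zero hf₁ hh₁ (by
      rw [h4]; exact div_ne_zero hbv two_ne_zero)
    have h5 : h 0 = h₁ 0 := by simpa using hhh.self_of_nhds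
    refine ⟨G, h5 ▸ hG, ?_⟩
    filter_upwards [hff, hhh, hsq.eventually hGe] with t a1 a2 a3
    rw [a1, a2, a3]
  · refine exists_factor_of_deriv_ne_zero hf hh ?_
    rw [hd.self_of_nhds]
    exact mul_ne_zero hv hbv

/-- `κ`, a function of position and velocity, is conserved by the motions with acceleration `F`. -/
def Conserved (I : Set ℝ) (F : ℝ → ℝ) (κ : ℝ × ℝ → ℝ) : Prop :=
  AnalyticOnNhd ℝ κ (I ×ˢ univ) ∧
    ∀ x ∈ I, ∀ v, v * dd e1 κ (x, v) + F x * dd e2 κ (x, v) = 0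

theorem hasDerivAt_curve {κ : ℝ × ℝ → ℝ} {ξ ν : ℝ → ℝ} {ξ' ν' t : ℝ}
    (hκ : AnalyticAt ℝ κ (ξ t, ν t)) (hξ : HasDerivAt ξ ξ' t) (hν : HasDerivAt ν ν' t) :
    HasDerivAt (fun s => κ (ξ s, ν s))
      (ξ' * dd e1 κ (ξ t, ν t) + ν' * dd e2 κ (ξ t, ν t)) t := by
  have h := hκ.differentiableAt.hasFDerivAt.comp_hasDerivAt (f := fun s => (ξ s, ν s)) t
    (hξ.prodMk hν)
  have e : ((ξ', ν') : ℝ × ℝ) = ξ' • e1 + ν' • e2 := by ext <;> simp [e1, e2]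
  refine h.congr_deriv ?_
  rw [e]
  simp [dd]

/-- Near a point where the force does not vanish, a conserved quantity takes equal values at opposite
velocities, since the motion passes a turning point. -/
theorem Conserved.even_near {I : Set ℝ} (hI : IsOpen I) {F U : ℝ → ℝ} {κ : ℝ × ℝ → ℝ}
    (hκ : Conserved I F κ) (hU : AnalyticOnNhd ℝ U I) (hUF : ∀ x ∈ I, deriv U x = -F x)
    {x : ℝ} (hx : x ∈ I) (hF : F x ≠ 0) : ∀ᶠ v in 𝓝 0, κ (x, -v) = κ (x, v) := by
  obtain ⟨W, hW, hWx, hl, hr⟩ := exists_analytic_inverse (hU x hx)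
    (by rw [hUF x hx]; exact neg_ne_zero.2 hF)
  have hWI : ∀ᶠ y in 𝓝 (U x), W y ∈ I :=
    hW.continuousAt.eventually (by rw [hWx]; exact hI.mem_nhds hx)
  obtain ⟨ε, hε, hb⟩ := Metric.eventually_nhds_iff_ball.1
    (hWI.and (hr.eventually_nhds.and hW.eventually_analyticAt))
  -- slope of the inverse of the potential
  have hW' : ∀ y ∈ Metric.ball (U x) ε, -F (W y) * deriv W y = 1 := by
    intro y hy
    obtain ⟨h1, h2, h3⟩ := hb y hy
    have h4 : HasDerivAt (fun s => U (W s)) (deriv U (W y) * deriv W y) y :=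
      HasDerivAt.comp y (hU _ h1).differentiableAt.hasDerivAt h3.differentiableAt.hasDerivAt
    have h5 : (fun s => U (W s)) =ᶠ[𝓝 y] fun s => s := h2
    rw [← hUF _ h1, ← h4.deriv, h5.deriv_eq, deriv_id'']
  have hδ : Metric.ball (0 : ℝ) (√ε) ∈ 𝓝 (0 : ℝ) := Metric.ball_mem_nhds _ (Real.sqrt_pos.2 hε)
  filter_upwards [hδ] with v₀ hv₀
  have hsq : ∀ v ∈ Metric.ball (0 : ℝ) (√ε), v ^ 2 < ε := by
    intro v hv
    rw [mem_ball_zero_iff, Real.norm_eq_abs] at hv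
    rw [← sq_abs, ← Real.sq_sqrt hε.le]
    exact pow_lt_pow_left₀ hv (abs_nonneg v) two_ne_zero
  -- the trajectory through `(x, v₀)`, parametrised by the velocity
  let y : ℝ → ℝ := fun v => U x + (v₀ ^ 2 - v ^ 2) / 2
  have hy : ∀ v ∈ Metric.ball (0 : ℝ) (√ε), y v ∈ Metric.ball (U x) ε := by
    intro v hv
    have h1 := hsq v hv
    have h2 := hsq v₀ hv₀
    rw [Metric.mem_ball, Real.dist_eq, abs_lt]
    constructor <;> simp only [y] <;> nlinarith [sq_nonneg v, sq_nonneg v₀]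
  have hder : ∀ v ∈ Metric.ball (0 : ℝ) (√ε), HasDerivAt (fun v => κ (W (y v), v)) 0 v := by
    intro v hv
    obtain ⟨h1, h2, h3⟩ := hb _ (hy v hv)
    have hy' : HasDerivAt y (-v) v := by
      have := (((hasDerivAt_pow 2 v).const_sub (v₀ ^ 2)).div_const 2).const_add (U x)
      refine this.congr_deriv ?_
      simp; ring
    have h4 := HasDerivAt.comp v h3.differentiableAt.hasDerivAt hy'
    have h5 := hasDerivAt_curve (κ := κ) (ξ := W ∘ y) (ν := fun v => v)
      (hκ.1 (W (y v), v) ⟨h1, trivial⟩) h4 (hasDerivAt_id v)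
    refine h5.congr_deriv ?_
    have h6 := hκ.2 _ h1 v
    have h7 := hW' _ (hy v hv)
    have h8 : F (W (y v)) ≠ 0 := by
      rintro h; rw [h] at h7; simp at h7
    simp only [Function.comp]
    refine mul_left_cancel₀ h8 ?_
    rw [mul_zero, one_mul]
    linear_combination h6 + (v * dd e1 κ (W (y v), v)) * h7
  have hc := Metric.isOpen_ball.is_const_of_deriv_eq_zero (f := fun v => κ (W (y v), v))
    (convex_ball (0 : ℝ) (√ε)).isPreconnected
    (fun v hv => (hder v hv).differentiableAt.differentiableWithinAt)
    (fun v hv => (hder v hv).deriv) (x := -v₀) (y := v₀) (by simpa using hv₀) hv₀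
  have e1 : W (y (-v₀)) = x := by simp [y, hWx]
  have e2 : W (y v₀) = x := by simp [y, hWx]
  simpa only [e1, e2] using hc

/-- If the force does not vanish identically, then conserved quantities are even in the velocity. -/
theorem Conserved.even {I : Set ℝ} (hI : IsOpen I) (hIc : IsConnected I) {F : ℝ → ℝ}
    {κ : ℝ × ℝ → ℝ} (hκ : Conserved I F κ) (hFa : AnalyticOnNhd ℝ F I) {x₀ : ℝ} (hx₀ : x₀ ∈ I)
    (hF : F x₀ ≠ 0) : ∀ x ∈ I, ∀ v, κ (x, -v) = κ (x, v) := by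
  obtain ⟨U, hU, hUd⟩ := exists_primitive hI hIc (g := fun x => -F x) hFa.neg
  have hrefl : ∀ z : ℝ × ℝ, AnalyticAt ℝ (fun z : ℝ × ℝ => (z.1, -z.2)) z := fun z =>
    analyticAt_fst.prod analyticAt_snd.neg
  have hκ' : AnalyticOnNhd ℝ (fun z : ℝ × ℝ => κ (z.1, -z.2)) (I ×ˢ univ) := fun z hz =>
    AnalyticAt.comp_of_eq (f := fun z : ℝ × ℝ => (z.1, -z.2)) (hκ.1 (z.1, -z.2) ⟨hz.1, trivial⟩)
      (hrefl z) rfl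
  have hnear : ∀ x ∈ I, F x ≠ 0 → ∀ v, κ (x, -v) = κ (x, v) := by
    intro x hx hFx v
    have h1 := hκ.even_near hI hU hUd hx hFx
    exact AnalyticOnNhd.eqOn_of_preconnected_of_eventuallyEq (U := univ)
      (fun v _ => analyticAt_slice (hκ' (x, v) ⟨hx, trivial⟩))
      (fun v _ => analyticAt_slice (hκ.1 (x, v) ⟨hx, trivial⟩)) isPreconnected_univ
      (mem_univ 0) h1 (mem_univ v)
  intro x hx v
  refine hκ'.eqOn_of_preconnected_of_eventuallyEq hκ.1 (hIc.isPreconnected.prod isPreconnected_univ)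
    (z₀ := (x₀, 0)) ⟨hx₀, trivial⟩ ?_ (x := (x, v)) ⟨hx, trivial⟩
  filter_upwards [continuousAt_fst.eventually ((hFa x₀ hx₀).continuousAt.eventually_ne hF),
    continuousAt_fst.eventually (hI.mem_nhds hx₀)] with z hz hzI
  exact hnear z.1 hzI hz z.2

/-- Away from zero velocity, the value of a conserved quantity is found by following the motion, of
energy `v² / 2 + U(x)`, to a fixed position `x₀`. -/
theorem Conserved.transport {I : Set ℝ} (hI : IsOpen I) {F U : ℝ → ℝ} (hU : AnalyticOnNhd ℝ U I)
    (hUF : ∀ x ∈ I, deriv U x = -F x) {x₀ v₁ σ : ℝ} (hx₀ : x₀ ∈ I) (hσ : σ ^ 2 = 1)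
    (hv₁ : 0 < σ * v₁) {κ : ℝ × ℝ → ℝ} (hκ : Conserved I F κ) :
    ∀ᶠ z in 𝓝 (x₀, v₁), κ z = κ (x₀, σ * √(z.2 ^ 2 + 2 * U z.1 - 2 * U x₀)) := by
  have hv₁' : v₁ ≠ 0 := by rintro rfl; simp at hv₁
  have hR : ContinuousAt (fun w : (ℝ × ℝ) × ℝ => w.1.2 ^ 2 + 2 * U w.1.1 - 2 * U w.2)
      ((x₀, v₁), x₀) := by
    have h1 : ContinuousAt (fun w : (ℝ × ℝ) × ℝ => U w.1.1) ((x₀, v₁), x₀) :=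
      ContinuousAt.comp (f := fun w : (ℝ × ℝ) × ℝ => w.1.1) (hU x₀ hx₀).continuousAt (by fun_prop)
    have h2 : ContinuousAt (fun w : (ℝ × ℝ) × ℝ => U w.2) ((x₀, v₁), x₀) :=
      ContinuousAt.comp (f := fun w : (ℝ × ℝ) × ℝ => w.2) (hU x₀ hx₀).continuousAt (by fun_prop)
    have h3 : ContinuousAt (fun w : (ℝ × ℝ) × ℝ => w.1.2 ^ 2) ((x₀, v₁), x₀) := by fun_prop
    exact (h3.add (h1.const_mul 2)).sub (h2.const_mul 2)
  have hpos : ∀ᶠ w in 𝓝 ((x₀, v₁), x₀),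
      0 < w.1.2 ^ 2 + 2 * U w.1.1 - 2 * U w.2 := by
    refine hR.eventually (lt_mem_nhds ?_)
    simp only [add_sub_cancel_right]
    positivity
  rw [nhds_prod_eq, eventually_prod_iff] at hpos
  obtain ⟨pa, ha, pb, hb, hab⟩ := hpos
  obtain ⟨δ, hδ, hball⟩ := Metric.eventually_nhds_iff_ball.1 (hb.and (hI.mem_nhds hx₀))
  have hsgn : ∀ᶠ z : ℝ × ℝ in 𝓝 (x₀, v₁), 0 < σ * z.2 := by
    have : ContinuousAt (fun z : ℝ × ℝ => σ * z.2) (x₀, v₁) := by fun_prop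
    exact this.eventually (lt_mem_nhds hv₁)
  filter_upwards [ha, hsgn, continuousAt_fst.eventually (Metric.ball_mem_nhds x₀ hδ)]
    with z hz hzs hzx
  let ν : ℝ → ℝ := fun t => σ * √(z.2 ^ 2 + 2 * U z.1 - 2 * U t)
  have hder : ∀ t ∈ Metric.ball x₀ δ, HasDerivAt (fun t => κ (t, ν t)) 0 t := by
    intro t ht
    have hp := hab hz (hball t ht).1
    have htI := (hball t ht).2
    have hsq : √(z.2 ^ 2 + 2 * U z.1 - 2 * U t) ≠ 0 := (Real.sqrt_pos.2 hp).ne'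
    have h1 : HasDerivAt (fun t => z.2 ^ 2 + 2 * U z.1 - 2 * U t) (2 * F t) t := by
      have := ((hU t htI).differentiableAt.hasDerivAt.const_mul 2).const_sub (z.2 ^ 2 + 2 * U z.1)
      refine this.congr_deriv ?_
      rw [hUF t htI]; ring
    have h2 : HasDerivAt ν (σ * (2 * F t / (2 * √(z.2 ^ 2 + 2 * U z.1 - 2 * U t)))) t :=
      (h1.sqrt hp.ne').const_mul σ
    have h3 := hasDerivAt_curve (κ := κ) (ξ := fun t => t) (hκ.1 (t, ν t) ⟨htI, trivial⟩)
      (hasDerivAt_id t) h2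
    refine h3.congr_deriv ?_
    have h4 := hκ.2 t htI (ν t)
    have hν : ν t ≠ 0 := mul_ne_zero (by rintro rfl; simp at hσ) hsq
    refine mul_left_cancel₀ hν ?_
    rw [mul_zero, ← h4]
    simp only [ν]
    field_simp
    linear_combination (F t * dd e2 κ (t, σ * √(z.2 ^ 2 + 2 * U z.1 - 2 * U t))) * hσ
  have hc := Metric.isOpen_ball.is_const_of_deriv_eq_zero (f := fun t => κ (t, ν t))
    (convex_ball x₀ δ).isPreconnected
    (fun v hv => (hder v hv).differentiableAt.differentiableWithinAt)
    (fun v hv => (hder v hv).deriv) (x := z.1) (y := x₀) hzx (Metric.mem_ball_self hδ)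
  rw [← hc]
  have : ν z.1 = z.2 := by
    have h5 : |z.2| = σ * z.2 := by
      rcases (by simpa using hσ : σ = 1 ∨ σ = -1) with rfl | rfl
      · rw [one_mul] at hzs ⊢; exact abs_of_pos hzs
      · rw [abs_of_neg (by linarith)]; ring
    simp only [ν, add_sub_cancel_right, Real.sqrt_sq_eq_abs, h5]
    linear_combination z.2 * hσ
  rw [this]

/-- Two conserved quantities, the second one with a nonvanishing derivative with respect to `v²`:
the first is locally an analytic function of the second. -/
theorem Conserved.exists_local_factor {I : Set ℝ} (hI : IsOpen I) (hIc : IsConnected I)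
    {F : ℝ → ℝ} {κ θ b : ℝ × ℝ → ℝ} (hκ : Conserved I F κ) (hθ : Conserved I F θ)
    (hFa : AnalyticOnNhd ℝ F I) (hF : ∃ x ∈ I, F x ≠ 0)
    (hb : AnalyticOnNhd ℝ b (I ×ˢ univ)) (hb0 : ∀ z ∈ I ×ˢ (univ : Set ℝ), b z ≠ 0)
    (hd : ∀ x ∈ I, ∀ v, dd e2 θ (x, v) = v * b (x, v)) {x₀ : ℝ} (hx₀ : x₀ ∈ I) (v₀ : ℝ) :
    ∃ G : ℝ → ℝ, AnalyticAt ℝ G (θ (x₀, v₀)) ∧ ∀ᶠ z in 𝓝 (x₀, v₀), κ z = G (θ z) := by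
  obtain ⟨xF, hxF, hFx⟩ := hF
  have hm : ∀ v, (x₀, v) ∈ I ×ˢ (univ : Set ℝ) := fun v => ⟨hx₀, trivial⟩
  have hslice : ∀ v, AnalyticAt ℝ (fun t => θ (x₀, t)) v := fun v => analyticAt_slice (hθ.1 _ (hm v))
  obtain ⟨G, hG, hGe⟩ := exists_factor_of_even (f := fun t => κ (x₀, t)) (h := fun t => θ (x₀, t))
    (b := fun t => b (x₀, t)) (v := v₀) (analyticAt_slice (hκ.1 _ (hm _))) (hslice _)
    (analyticAt_slice (hb _ (hm _))).continuousAt (hb0 _ (hm _))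
    (Eventually.of_forall fun t => by rw [← dd_e2_eq_deriv (hθ.1 _ (hm _)), hd x₀ hx₀])
    (hκ.even hI hIc hFa hxF hFx x₀ hx₀) (hθ.even hI hIc hFa hxF hFx x₀ hx₀)
  refine ⟨G, hG, ?_⟩
  obtain ⟨U, hU, hUd⟩ := exists_primitive hI hIc (g := fun x => -F x) hFa.neg
  -- a box on which both sides are analytic
  have hcomp : AnalyticAt ℝ (fun z => G (θ z)) (x₀, v₀) := AnalyticAt.comp hG (hθ.1 _ (hm _))
  obtain ⟨ε, hε, hball⟩ := Metric.eventually_nhds_iff_ball.1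
    ((hκ.1 _ (hm v₀)).eventually_analyticAt.and hcomp.eventually_analyticAt)
  -- a nearby point of nonzero velocity
  have hGe2 := hGe.eventually_nhds.and (Metric.ball_mem_nhds v₀ hε)
  obtain ⟨v₁, ⟨hv₁G, hv₁b⟩, hv₁⟩ : ∃ v₁, ((∀ᶠ t in 𝓝 v₁, κ (x₀, t) = G (θ (x₀, t))) ∧
      v₁ ∈ Metric.ball v₀ ε) ∧ v₁ ≠ 0 := by
    by_cases h0 : v₀ = 0
    · subst h0
      have h1 : ∀ᶠ v in 𝓝[≠] (0 : ℝ), (∀ᶠ t in 𝓝 v, κ (x₀, t) = G (θ (x₀, t))) ∧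
          v ∈ Metric.ball 0 ε := nhdsWithin_le_nhds hGe2
      have h2 : ∀ᶠ v in 𝓝[≠] (0 : ℝ), v ≠ 0 := self_mem_nhdsWithin
      exact (h1.and h2).exists
    · exact ⟨v₀, hGe2.self_of_nhds, h0⟩
  obtain ⟨σ, hσ, hσv⟩ : ∃ σ : ℝ, σ ^ 2 = 1 ∧ 0 < σ * v₁ := by
    rcases lt_or_gt_of_ne hv₁ with h | h
    · exact ⟨-1, by norm_num, by linarith⟩
    · exact ⟨1, by norm_num, by linarith⟩
  have hc : Tendsto (fun z : ℝ × ℝ => σ * √(z.2 ^ 2 + 2 * U z.1 - 2 * U x₀)) (𝓝 (x₀, v₁)) (𝓝 v₁) := by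
    have h1 : ContinuousAt (fun z : ℝ × ℝ => U z.1) (x₀, v₁) :=
      ContinuousAt.comp (f := Prod.fst) (hU x₀ hx₀).continuousAt continuousAt_fst
    have h2 : ContinuousAt (fun z : ℝ × ℝ => z.2 ^ 2) (x₀, v₁) := by fun_prop
    have h3 := (((h2.add (h1.const_mul 2)).sub (continuousAt_const (y := 2 * U x₀))).sqrt).const_mul σ
    have h4 : σ * √(v₁ ^ 2 + 2 * U x₀ - 2 * U x₀) = v₁ := by
      rw [add_sub_cancel_right, Real.sqrt_sq_eq_abs]
      rcases (by simpa using hσ : σ = 1 ∨ σ = -1) with rfl | rfl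
      · rw [one_mul] at hσv ⊢; exact abs_of_pos hσv
      · rw [abs_of_neg (by linarith)]; ring
    have h5 := h3.tendsto
    simp only [Pi.add_apply, Pi.sub_apply] at h5
    rwa [h4] at h5
  have hev : (fun z => κ z) =ᶠ[𝓝 (x₀, v₁)] fun z => G (θ z) := by
    filter_upwards [hκ.transport hI hU hUd hx₀ hσ hσv, hθ.transport hI hU hUd hx₀ hσ hσv,
      hc.eventually hv₁G] with z h1 h2 h3
    rw [h1, h3, ← h2]
  have hmem : (x₀, v₁) ∈ Metric.ball (x₀, v₀) ε := by
    simpa [Prod.dist_eq, hε] using hv₁b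
  have := AnalyticOnNhd.eqOn_of_preconnected_of_eventuallyEq (U := Metric.ball (x₀, v₀) ε)
    (fun z hz => (hball z hz).1) (fun z hz => (hball z hz).2)
    (convex_ball (x₀, v₀) ε).isPreconnected hmem hev
  exact this.eventuallyEq_of_mem (Metric.ball_mem_nhds _ hε)

namespace Good1

variable {I : Set ℝ} {η Q : ℝ × ℝ → ℝ} {F : ℝ → ℝ}

theorem strip_open (h : Good1 I η Q F) : IsOpen (I ×ˢ (univ : Set ℝ)) := h.isOpen.prod isOpen_univ

/-- The derivatives of the identity `∂ₚη(x, Q(x, v)) = v`. -/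
theorem dd_inverse (h : Good1 I η Q F) {x : ℝ} (hx : x ∈ I) (v : ℝ) :
    dd e2 (dd e2 η) (x, Q (x, v)) * dd e2 Q (x, v) = 1 ∧
      dd e1 (dd e2 η) (x, Q (x, v)) + dd e2 (dd e2 η) (x, Q (x, v)) * dd e1 Q (x, v) = 0 := by
  have hQ := h.anQ (x, v) ⟨hx, trivial⟩
  have hη := analyticAt_dd (h.an (x, Q (x, v)) ⟨hx, trivial⟩) e2
  constructor
  · have h1 := hasDerivAt_curve (κ := dd e2 η) (ξ := fun _ => x) (ν := fun t => Q (x, t)) (t := v)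
      hη (hasDerivAt_const v x) (hasDerivAt_snd hQ)
    have h2 : (fun t => dd e2 η (x, Q (x, t))) = fun t => t := funext fun t => h.right x hx t
    rw [h2] at h1
    have := h1.unique (hasDerivAt_id v)
    linarith
  · have h1 := hasDerivAt_curve (κ := dd e2 η) (ξ := fun t => t) (ν := fun t => Q (t, v)) (t := x)
      hη (hasDerivAt_id x) (hasDerivAt_fst hQ)
    have h2 : (fun t => dd e2 η (t, Q (t, v))) =ᶠ[𝓝 x] fun _ => v := by
      filter_upwards [h.isOpen.mem_nhds hx] with t ht using h.right t ht v
    have := (h1.congr_of_eventuallyEq h2.symm).unique (hasDerivAt_const x v)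
    linarith

theorem ddp_ne_zero (h : Good1 I η Q F) {x : ℝ} (hx : x ∈ I) (p : ℝ) :
    dd e2 (dd e2 η) (x, p) ≠ 0 := by
  have h1 := (h.dd_inverse hx (dd e2 η (x, p))).1
  rw [h.left x hx p] at h1
  exact left_ne_zero_of_mul_eq_one h1

theorem analytic_force (h : Good1 I η Q F) : AnalyticOnNhd ℝ F I := by
  intro x hx
  have h1 : AnalyticAt ℝ (fun t => br1 (dd e2 η) η (t, 0)) x := by
    have h0 := h.an (x, 0) ⟨hx, trivial⟩
    exact analyticAt_slice_fst (analyticAt_br1 (analyticAt_dd h0 _) h0)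
  refine h1.congr ?_
  filter_upwards [h.isOpen.mem_nhds hx] with t ht using h.force t ht 0

theorem force_eq (h : Good1 I η Q F) {z : ℝ × ℝ} (hz : z ∈ I ×ˢ (univ : Set ℝ)) :
    dd e1 (dd e2 η) z * dd e2 η z - dd e1 η z * dd e2 (dd e2 η) z = F z.1 := h.force z.1 hz.1 z.2

/-- The mass `∂ₚ∂ₚη` is conserved, since the force does not depend on the momentum. -/
theorem br1_ddp (h : Good1 I η Q F) {z : ℝ × ℝ} (hz : z ∈ I ×ˢ (univ : Set ℝ)) :
    br1 (dd e2 (dd e2 η)) η z = 0 := by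
  have hη := h.an z hz
  have h1 : dd e2 (br1 (dd e2 η) η) z = 0 := by
    rw [dd_congr_on h.strip_open (g := fun w => F w.1) (fun w hw => h.force w.1 hw.1 w.2) e2 hz,
      dd_comp_fst (h.analytic_force _ hz.1)]
    simp [e2]
  rw [dd_br1 (analyticAt_dd hη _) hη] at h1
  have h2 : br1 (dd e2 η) (dd e2 η) z = 0 := by simp [br1]
  linarith

/-- Expressed in terms of position and velocity, a function in involution with `η` is conserved by
the motion. -/
theorem conserved (h : Good1 I η Q F) {k : ℝ × ℝ → ℝ} (hk : AnalyticOnNhd ℝ k (I ×ˢ univ))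
    (hbr : ∀ z ∈ I ×ˢ (univ : Set ℝ), br1 k η z = 0) :
    Conserved I F (fun z => k (z.1, Q z)) ∧
      ∀ x ∈ I, ∀ v, dd e2 (fun z => k (z.1, Q z)) (x, v) = dd e2 k (x, Q (x, v)) * dd e2 Q (x, v) := by
  have hmap : ∀ z ∈ I ×ˢ (univ : Set ℝ), AnalyticAt ℝ (fun z => (z.1, Q z)) z := fun z hz =>
    analyticAt_fst.prod (h.anQ z hz)
  have han : AnalyticOnNhd ℝ (fun z => k (z.1, Q z)) (I ×ˢ univ) := fun z hz =>
    AnalyticAt.comp_of_eq (f := fun z : ℝ × ℝ => (z.1, Q z)) (hk (z.1, Q z) ⟨hz.1, trivial⟩)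
      (hmap z hz) rfl
  have hd2 : ∀ x ∈ I, ∀ v, dd e2 (fun z => k (z.1, Q z)) (x, v) =
      dd e2 k (x, Q (x, v)) * dd e2 Q (x, v) := by
    intro x hx v
    have h1 := hasDerivAt_curve (κ := k) (ξ := fun _ => x) (ν := fun t => Q (x, t)) (t := v)
      (hk _ ⟨hx, trivial⟩) (hasDerivAt_const v x) (hasDerivAt_snd (h.anQ _ ⟨hx, trivial⟩))
    rw [(hasDerivAt_snd (han (x, v) ⟨hx, trivial⟩)).unique h1]
    ring
  refine ⟨⟨han, ?_⟩, hd2⟩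
  intro x hx v
  have h1 := hasDerivAt_curve (κ := k) (ξ := fun t => t) (ν := fun t => Q (t, v)) (t := x)
    (hk _ ⟨hx, trivial⟩) (hasDerivAt_id x) (hasDerivAt_fst (h.anQ _ ⟨hx, trivial⟩))
  rw [(hasDerivAt_fst (han (x, v) ⟨hx, trivial⟩)).unique h1, hd2 x hx v]
  obtain ⟨a1, a2⟩ := h.dd_inverse hx v
  have a3 := hbr (x, Q (x, v)) ⟨hx, trivial⟩
  have a4 := h.force_eq (z := (x, Q (x, v))) ⟨hx, trivial⟩
  have a5 := h.right x hx v
  have a6 := h.ddp_ne_zero hx (Q (x, v))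
  simp only [br1] at a3
  rw [a5] at a3 a4
  refine mul_left_cancel₀ a6 ?_
  simp only at a4
  rw [← a4]
  linear_combination (dd e2 (dd e2 η) (x, Q (x, v))) * a3 + v * dd e2 k (x, Q (x, v)) * a2 +
    dd e2 k (x, Q (x, v)) * (dd e1 (dd e2 η) (x, Q (x, v)) * v -
      dd e1 η (x, Q (x, v)) * dd e2 (dd e2 η) (x, Q (x, v))) * a1

/-- If the force does not vanish identically, then every function in involution with `η` is a single
analytic function of `η`. -/
theorem exists_factor (h : Good1 I η Q F) (hF : ∃ x ∈ I, F x ≠ 0) {k : ℝ × ℝ → ℝ}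
    (hk : AnalyticOnNhd ℝ k (I ×ˢ univ))
    (hbr : ∀ z ∈ I ×ˢ (univ : Set ℝ), br1 k η z = 0) :
    ∃ G : ℝ → ℝ, AnalyticOnNhd ℝ G (η '' (I ×ˢ univ)) ∧
      ∀ z ∈ I ×ˢ (univ : Set ℝ), k z = G (η z) := by
  obtain ⟨hκ, -⟩ := h.conserved hk hbr
  obtain ⟨hθ, hθd⟩ := h.conserved h.an (fun z _ => by simp [br1])
  obtain ⟨K, hK, hKk⟩ := exists_analytic_factor (X := ℝ × ℝ) (D := I ×ˢ univ)
    (h.conn.prod isConnected_univ) (π := η) (fun z hz => (h.an z hz).continuousAt)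
    (k := fun z _ => k z) (by
      -- the image of a neighbourhood contains an interval, as `η` is not constant in `p`
      rintro ⟨x, p⟩ ⟨hx, -⟩ N hN
      have hc : ContinuousAt (fun t : ℝ => (x, t)) p := by fun_prop
      obtain ⟨δ, hδ, hb⟩ := Metric.eventually_nhds_iff_ball.1 (hc.eventually hN)
      let S : Set ℝ := (fun t => η (x, t)) '' Metric.ball p δ
      have hcont : ∀ t, ContinuousAt (fun t => η (x, t)) t := fun t =>
        (analyticAt_slice (h.an (x, t) ⟨hx, trivial⟩)).continuousAt
      have hS : IsPreconnected S := (convex_ball p δ).isPreconnected.image _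
        fun t _ => (hcont t).continuousWithinAt
      have hSN : S ⊆ η '' N := by
        rintro _ ⟨t, ht, rfl⟩
        exact ⟨(x, t), hb t ht, rfl⟩
      obtain ⟨t, ht, hne⟩ : ∃ t ∈ Metric.ball p δ, η (x, t) ≠ η (x, p) := by
        by_contra hcon
        push Not at hcon
        have hz : ∀ t ∈ Metric.ball p δ, dd e2 η (x, t) = 0 := by
          intro t ht
          rw [dd_e2_eq_deriv (h.an (x, t) ⟨hx, trivial⟩)]
          have : (fun t => η (x, t)) =ᶠ[𝓝 t] fun _ => η (x, p) := by
            filter_upwards [Metric.isOpen_ball.mem_nhds ht] with s hs using hcon s hs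
          rw [this.deriv_eq, deriv_const]
        have hp : p + δ / 2 ∈ Metric.ball p δ := by
          simp [abs_of_pos, hδ]
        have h1 := h.left x hx p
        have h2 := h.left x hx (p + δ / 2)
        rw [hz _ (Metric.mem_ball_self hδ)] at h1
        rw [hz _ hp] at h2
        linarith
      have hoc := isPreconnected_iff_ordConnected.1 hS
      have h1 : η (x, t) ∈ S := ⟨t, ht, rfl⟩
      have h2 : η (x, p) ∈ S := ⟨p, Metric.mem_ball_self hδ, rfl⟩
      have h3 : uIcc (η (x, t)) (η (x, p)) ⊆ η '' N := (hoc.uIcc_subset h1 h2).trans hSN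
      refine Nonempty.mono (interior_mono h3) ?_
      rw [uIcc, interior_Icc, nonempty_Ioo]
      exact min_lt_max.2 hne) (by
      rintro ⟨x, p⟩ ⟨hx, -⟩
      obtain ⟨G, hG, hGe⟩ := hκ.exists_local_factor h.isOpen h.conn hθ h.analytic_force hF
        (b := dd e2 Q) (analyticOnNhd_dd h.anQ _)
        (fun z hz => right_ne_zero_of_mul_eq_one (h.dd_inverse hz.1 z.2).1)
        (fun x hx v => by rw [hθd x hx, h.right x hx]) hx (dd e2 η (x, p))
      simp only [h.left x hx p] at hG
      obtain ⟨ε, hε, hb⟩ := Metric.eventually_nhds_iff_ball.1 hG.eventually_analyticAt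
      refine ⟨Metric.ball (η (x, p)) ε, Metric.isOpen_ball, (convex_ball _ _).isPreconnected,
        Metric.mem_ball_self hε, fun w => G w.1, fun w hw => analyticAt_comp_fst (hb _ hw.1), ?_⟩
      have hc : Tendsto (fun z : ℝ × ℝ => (z.1, dd e2 η z)) (𝓝 (x, p)) (𝓝 (x, dd e2 η (x, p))) :=
        (continuousAt_fst.prodMk (analyticAt_dd (h.an (x, p) ⟨hx, trivial⟩) e2).continuousAt)
      filter_upwards [hc.eventually hGe, h.strip_open.mem_nhds (x := (x, p)) ⟨hx, trivial⟩]
        with z hz hzI _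
      simpa only [h.left z.1 hzI.1 z.2] using hz)
  refine ⟨fun e => K (e, 0), fun e he => analyticAt_slice_fst (hK _ ⟨he, trivial⟩),
    fun z hz => hKk z hz 0⟩

end Good1

/-! ### The linear equation for the momentum-dependent part of a Seesaw Hamiltonian -/

theorem dd_e2_integral {I : Set ℝ} (hI : IsOpen I) {f : ℝ × ℝ → ℝ}
    (hf : AnalyticOnNhd ℝ f (I ×ˢ univ)) {z : ℝ × ℝ} (hz : z ∈ I ×ˢ (univ : Set ℝ)) :
    dd e2 (fun z : ℝ × ℝ => ∫ s in (0 : ℝ)..z.2, f (z.1, s)) z = f z := by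
  obtain ⟨x, p⟩ := z
  have hx : x ∈ I := hz.1
  rw [dd_e2_eq_deriv (analyticOnNhd_integral_snd hI hf (x, p) hz)]
  exact Continuous.deriv_integral (fun t => f (x, t)) (continuous_iff_continuousAt.2 fun t =>
    (analyticAt_slice (hf (x, t) ⟨hx, trivial⟩)).continuousAt) 0 p

/-- The momentum-dependent part `s` contributes `{∂ₚs, η} - {s, ∂ₚη}` to the force of the Seesaw
Hamiltonian `y ∂ₓη + p_x ∂ₚη + s`. -/
noncomputable def seesawForce (η s : ℝ × ℝ → ℝ) : ℝ × ℝ → ℝ :=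
  fun z => br1 (dd e2 s) η z - br1 s (dd e2 η) z

/-- The Wronskian-type expression `∂ₚs ∂ₚη - s ∂ₚ∂ₚη`, which vanishes for multiples `s` of `∂ₚη`. -/
noncomputable def wronskian (η s : ℝ × ℝ → ℝ) : ℝ × ℝ → ℝ :=
  fun z => dd e2 s z * dd e2 η z - s z * dd e2 (dd e2 η) z

theorem analyticAt_wronskian {η s : ℝ × ℝ → ℝ} {z : ℝ × ℝ} (hη : AnalyticAt ℝ η z)
    (hs : AnalyticAt ℝ s z) : AnalyticAt ℝ (wronskian η s) z :=
  ((analyticAt_dd hs _).mul (analyticAt_dd hη _)).sub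
    (hs.mul (analyticAt_dd (analyticAt_dd hη _) _))

theorem analyticAt_seesawForce {η s : ℝ × ℝ → ℝ} {z : ℝ × ℝ} (hη : AnalyticAt ℝ η z)
    (hs : AnalyticAt ℝ s z) : AnalyticAt ℝ (seesawForce η s) z :=
  (analyticAt_br1 (analyticAt_dd hs _) hη).sub (analyticAt_br1 hs (analyticAt_dd hη _))

theorem dd_wronskian {η s : ℝ × ℝ → ℝ} {z : ℝ × ℝ} (hη : AnalyticAt ℝ η z)
    (hs : AnalyticAt ℝ s z) (e : ℝ × ℝ) : dd e (wronskian η s) z =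
      dd e (dd e2 s) z * dd e2 η z + dd e2 s z * dd e (dd e2 η) z -
        (dd e s z * dd e2 (dd e2 η) z + s z * dd e (dd e2 (dd e2 η)) z) := by
  have h1 := analyticAt_dd hs e2
  have h2 := analyticAt_dd hη e2
  have h3 := analyticAt_dd h2 e2
  change dd e (fun z => dd e2 s z * dd e2 η z - s z * dd e2 (dd e2 η) z) z = _
  rw [dd_sub (h1.fun_mul h2) (hs.fun_mul h3), dd_mul h1 h2, dd_mul hs h3]

theorem seesawForce_add {η s t : ℝ × ℝ → ℝ} {z : ℝ × ℝ} (hs : AnalyticAt ℝ s z)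
    (ht : AnalyticAt ℝ t z) :
    seesawForce η (fun y => s y + t y) z = seesawForce η s z + seesawForce η t z := by
  have h2 : dd e2 (fun y => s y + t y) =ᶠ[𝓝 z] fun y => dd e2 s y + dd e2 t y := by
    filter_upwards [hs.eventually_analyticAt, ht.eventually_analyticAt] with y h h' using
      dd_add h h' _
  have h := fun e => dd_add hs ht e
  have h' := fun e => dd_add (analyticAt_dd hs e2) (analyticAt_dd ht e2) e
  simp only [seesawForce, br1, dd_congr h2, h, h']
  ring

namespace Good1

variable {I : Set ℝ} {η Q : ℝ × ℝ → ℝ} {F : ℝ → ℝ}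

/-- The Wronskian expression changes along the motion at the rate given by the force. -/
theorem br1_wronskian (h : Good1 I η Q F) {s : ℝ × ℝ → ℝ} {z : ℝ × ℝ}
    (hz : z ∈ I ×ˢ (univ : Set ℝ)) (hs : AnalyticAt ℝ s z) :
    br1 (wronskian η s) η z = seesawForce η s z * dd e2 η z := by
  have h1 := h.br1_ddp hz
  simp only [br1] at h1
  simp only [br1, seesawForce, dd_wronskian (h.an z hz) hs]
  linear_combination (-s z) * h1

/-- At nonzero velocity the force can be read off from the Wronskian expression. -/
theorem seesawForce_eq_of_wronskian (h : Good1 I η Q F) {s : ℝ × ℝ → ℝ} {G : ℝ → ℝ} {f : ℝ → ℝ}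
    {z : ℝ × ℝ} (hz : z ∈ I ×ˢ (univ : Set ℝ)) (hs : AnalyticAt ℝ s z)
    (hG : AnalyticAt ℝ G (η z)) (hf : AnalyticAt ℝ f z.1)
    (hW : ∀ᶠ y in 𝓝 z, wronskian η s y = f y.1 - dd e2 (dd e2 η) y * G (η y))
    (h0 : dd e2 η z ≠ 0) : seesawForce η s z = deriv f z.1 := by
  have h1 := h.br1_wronskian hz hs
  have hη := h.an z hz
  have hpp := analyticAt_dd (analyticAt_dd hη e2) e2
  have hGη : AnalyticAt ℝ (fun y => G (η y)) z := AnalyticAt.comp hG hη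
  have h2 : ∀ e, dd e (wronskian η s) z = deriv f z.1 * e.1 -
      (dd e (dd e2 (dd e2 η)) z * G (η z) + dd e2 (dd e2 η) z * (deriv G (η z) * dd e η z)) := by
    intro e
    rw [dd_congr hW e, dd_sub (analyticAt_comp_fst hf) (hpp.fun_mul hGη), dd_mul hpp hGη,
      dd_comp_fst hf, dd_comp_real hG hη]
  have h3 := h.br1_ddp hz
  refine mul_right_cancel₀ h0 ?_
  rw [← h1]
  simp only [br1] at h3 ⊢
  rw [h2, h2]
  simp only [e1, e2] at h3 ⊢
  linear_combination (-G (η z)) * h3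

theorem dd_e2_ne_zero_of_ne (h : Good1 I η Q F) (hn : ∀ x ∈ I, dd e2 η (x, 0) = 0) {x p : ℝ}
    (hx : x ∈ I) (hp : p ≠ 0) : dd e2 η (x, p) ≠ 0 := by
  intro h0
  have h1 := h.left x hx p
  have h2 := h.left x hx 0
  rw [h0] at h1
  rw [hn x hx] at h2
  exact hp (h1.symm.trans h2)

/-- Every solution of the equation for `s`, if the force of `η` does not vanish identically. With `g'`
a primitive of the prescribed force `g` and `W` the Wronskian expression, `(g' - W) / ∂ₚ∂ₚη` is in
involution with `η`, hence of the form `G ∘ η`; this leaves a first-order linear equation for `s` in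
the momentum. -/
theorem exists_seesawA (h : Good1 I η Q F) (hF : ∃ x ∈ I, F x ≠ 0)
    (hn : ∀ x ∈ I, dd e2 η (x, 0) = 0) {s : ℝ × ℝ → ℝ} (hs : AnalyticOnNhd ℝ s (I ×ˢ univ))
    {g : ℝ → ℝ} (hg : ∀ x ∈ I, ∀ p, seesawForce η s (x, p) = g x) :
    ∃ (G V u : ℝ → ℝ) (w : ℝ × ℝ → ℝ), AnalyticOnNhd ℝ G (η '' (I ×ˢ univ)) ∧
      AnalyticOnNhd ℝ V I ∧ MeromorphicOn u I ∧ AnalyticOnNhd ℝ w (I ×ˢ univ) ∧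
      (∀ x ∈ I, AnalyticAt ℝ u x → ∀ p, w (x, p) = u x * dd e1 η (x, p)) ∧
      ∀ x ∈ I, ∀ p, s (x, p) = w (x, p) + V x * dd e2 η (x, p) + G (η (x, p)) -
        dd e2 η (x, p) * ∫ t in (0 : ℝ)..p, deriv G (η (x, t)) := by
  have hI := h.isOpen
  have hga : AnalyticOnNhd ℝ g I := by
    intro x hx
    refine (analyticAt_slice_fst (p := 0) (analyticAt_seesawForce (h.an _ ⟨hx, trivial⟩)
      (hs (x, 0) ⟨hx, trivial⟩))).congr ?_
    filter_upwards [hI.mem_nhds hx] with t ht using hg t ht 0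
  obtain ⟨g', hg', hgd⟩ := exists_primitive hI h.conn hga
  have hηp := analyticOnNhd_dd h.an e2
  have hηpp := analyticOnNhd_dd hηp e2
  have hpp0 : ∀ z ∈ I ×ˢ (univ : Set ℝ), dd e2 (dd e2 η) z ≠ 0 := fun z hz =>
    h.ddp_ne_zero hz.1 z.2
  have hnum : AnalyticOnNhd ℝ (fun z : ℝ × ℝ => g' z.1 - wronskian η s z) (I ×ˢ univ) := fun z hz =>
    (analyticAt_comp_fst (hg' _ hz.1)).sub (analyticAt_wronskian (h.an z hz) (hs z hz))
  obtain ⟨G, hG, hGk⟩ := h.exists_factor hF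
    (k := fun z => (g' z.1 - wronskian η s z) / dd e2 (dd e2 η) z)
    (fun z hz => (hnum z hz).div (hηpp z hz) (hpp0 z hz)) (by
      intro z hz
      have h1 := h.br1_wronskian hz (hs z hz)
      have h2 := h.br1_ddp hz
      have h3 := hg z.1 hz.1 z.2
      simp only [br1] at h1 h2 ⊢
      have hd : ∀ e, dd e (fun z => (g' z.1 - wronskian η s z) / dd e2 (dd e2 η) z) z =
          ((g z.1 * e.1 - dd e (wronskian η s) z) * dd e2 (dd e2 η) z -
            (g' z.1 - wronskian η s z) * dd e (dd e2 (dd e2 η)) z) / dd e2 (dd e2 η) z ^ 2 := by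
        intro e
        rw [dd_div (hnum z hz) (hηpp z hz) (hpp0 z hz), dd_sub (analyticAt_comp_fst (hg' _ hz.1))
          (analyticAt_wronskian (h.an z hz) (hs z hz)), dd_comp_fst (hg' _ hz.1), hgd _ hz.1]
      rw [hd, hd]
      have h0 := hpp0 z hz
      rw [h3] at h1
      simp only [e1, e2] at h1 h2 h0 ⊢
      field_simp
      linear_combination (-dd (0, 1) (dd (0, 1) η) z) * h1 -
        (g' z.1 - wronskian η s z) * h2)
  -- the integral term
  have hGη : AnalyticOnNhd ℝ (fun z => G (η z)) (I ×ˢ univ) := fun z hz =>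
    AnalyticAt.comp (hG _ ⟨z, hz, rfl⟩) (h.an z hz)
  have hG'η : AnalyticOnNhd ℝ (fun z => deriv G (η z)) (I ×ˢ univ) := fun z hz =>
    AnalyticAt.comp (hG _ ⟨z, hz, rfl⟩).deriv (h.an z hz)
  let Φ : ℝ × ℝ → ℝ := fun z => ∫ t in (0 : ℝ)..z.2, deriv G (η (z.1, t))
  have hΦ : AnalyticOnNhd ℝ Φ (I ×ˢ univ) := analyticOnNhd_integral_snd hI hG'η
  have hΦd : ∀ z ∈ I ×ˢ (univ : Set ℝ), dd e2 Φ z = deriv G (η z) := fun z hz =>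
    dd_e2_integral hI hG'η hz
  let S : ℝ × ℝ → ℝ := fun z => s z - G (η z) + dd e2 η z * Φ z
  have hS : AnalyticOnNhd ℝ S (I ×ˢ univ) := fun z hz =>
    ((hs z hz).sub (hGη z hz)).add ((hηp z hz).mul (hΦ z hz))
  have hSd : ∀ z ∈ I ×ˢ (univ : Set ℝ), dd e2 S z * dd e2 η z - S z * dd e2 (dd e2 η) z = g' z.1 := by
    intro z hz
    have h1 : dd e2 S z = dd e2 s z + dd e2 (dd e2 η) z * Φ z := by
      change dd e2 (fun z => s z - G (η z) + dd e2 η z * Φ z) z = _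
      rw [dd_add ((hs z hz).fun_sub (hGη z hz)) ((hηp z hz).fun_mul (hΦ z hz)),
        dd_sub (hs z hz) (hGη z hz), dd_mul (hηp z hz) (hΦ z hz), hΦd z hz,
        dd_comp_real (hG _ ⟨z, hz, rfl⟩) (h.an z hz)]
      ring
    have h2 := hGk z hz
    have h0 := hpp0 z hz
    rw [div_eq_iff h0] at h2
    rw [h1]
    simp only [wronskian] at h2
    simp only [S]
    linear_combination -h2
  let V : ℝ → ℝ := fun x => dd e2 S (x, 0) / dd e2 (dd e2 η) (x, 0)
  have hV : AnalyticOnNhd ℝ V I := fun x hx =>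
    (analyticAt_slice_fst (analyticAt_dd (hS (x, 0) ⟨hx, trivial⟩) e2)).div
      (analyticAt_slice_fst (hηpp (x, 0) ⟨hx, trivial⟩)) (hpp0 _ ⟨hx, trivial⟩)
  have hFa := h.analytic_force
  let w : ℝ × ℝ → ℝ := fun z => S z - V z.1 * dd e2 η z
  have hw : AnalyticOnNhd ℝ w (I ×ˢ univ) := fun z hz =>
    (hS z hz).sub ((analyticAt_comp_fst (hV _ hz.1)).mul (hηp z hz))
  have hηx := analyticOnNhd_dd h.an e1
  -- off the zeros of the force, `w` is a multiple of `∂ₓη`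
  have hwu : ∀ x ∈ I, F x ≠ 0 → ∀ p, w (x, p) = g' x / F x * dd e1 η (x, p) := by
    intro x hx hFx
    have hm : ∀ p : ℝ, (x, p) ∈ I ×ˢ (univ : Set ℝ) := fun p => ⟨hx, trivial⟩
    let δ : ℝ → ℝ := fun p => w (x, p) - g' x / F x * dd e1 η (x, p)
    let r : ℝ → ℝ := fun p => dd e2 η (x, p)
    have hr : ∀ p, HasDerivAt r (dd e2 (dd e2 η) (x, p)) p := fun p => hasDerivAt_snd (hηp _ (hm p))
    have hSp : ∀ p, HasDerivAt (fun p => S (x, p)) (dd e2 S (x, p)) p := fun p =>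
      hasDerivAt_snd (hS _ (hm p))
    have hxp : ∀ p, HasDerivAt (fun p => dd e1 η (x, p)) (dd e1 (dd e2 η) (x, p)) p := fun p => by
      rw [dd_comm (h.an _ (hm p))]
      exact hasDerivAt_snd (hηx _ (hm p))
    have hδ : ∀ p, HasDerivAt δ (dd e2 S (x, p) - V x * dd e2 (dd e2 η) (x, p) -
        g' x / F x * dd e1 (dd e2 η) (x, p)) p := fun p =>
      ((hSp p).sub ((hr p).const_mul (V x))).sub ((hxp p).const_mul _)
    have hδa : AnalyticOnNhd ℝ δ univ := fun p _ =>
      (analyticAt_slice (hw _ (hm p))).sub (analyticAt_const.mul (analyticAt_slice (hηx _ (hm p))))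
    have h1 := eq_mul_of_deriv_mul_eq hδa (fun p _ => analyticAt_slice (hηp _ (hm p))) (r := r) (by
      intro p
      rw [(hδ p).deriv, (hr p).deriv]
      have a1 := hSd _ (hm p)
      have a2 := h.force_eq (hm p)
      simp only at a1 a2
      simp only [δ, r, w]
      have a3 : g' x / F x * F x = g' x := div_mul_cancel₀ _ hFx
      linear_combination a1 - (g' x / F x) * a2 - a3) (p₀ := 1)
      (h.dd_e2_ne_zero_of_ne hn hx one_ne_zero)
    -- the factor vanishes, by comparing derivatives at zero momentum
    have h2 : δ = fun p => δ 1 / r 1 * r p := funext h1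
    have h3 := (hδ 0)
    rw [h2] at h3
    have h4 := h3.unique ((hr 0).const_mul _)
    have h5 : dd e1 (dd e2 η) (x, 0) = 0 := by
      rw [dd_e1_eq_deriv (hηp _ (hm 0))]
      have : (fun t => dd e2 η (t, 0)) =ᶠ[𝓝 x] fun _ => 0 := by
        filter_upwards [hI.mem_nhds hx] with t ht using hn t ht
      rw [this.deriv_eq, deriv_const]
    have h6 : V x * dd e2 (dd e2 η) (x, 0) = dd e2 S (x, 0) := div_mul_cancel₀ _ (hpp0 _ (hm 0))
    rw [h5, h6] at h4
    have h7 : δ 1 / r 1 = 0 := by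
      have : δ 1 / r 1 * dd e2 (dd e2 η) (x, 0) = 0 := by linarith
      exact (mul_eq_zero.1 this).resolve_right (hpp0 _ (hm 0))
    intro p
    have h8 := h1 p
    rw [h7, zero_mul] at h8
    exact sub_eq_zero.1 h8
  refine ⟨G, V, fun x => g' x / F x, w, hG, hV, fun x hx =>
    (hg' x hx).meromorphicAt.div (hFa x hx).meromorphicAt, hw, ?_, ?_⟩
  · intro x hx hu p
    by_cases hFx : F x ≠ 0
    · exact hwu x hx hFx p
    push Not at hFx
    -- the zeros of the force are isolated, so the relation extends by continuity
    obtain ⟨xF, hxF, hFne⟩ := hF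
    have hne : ∀ᶠ t in 𝓝[≠] x, F t ≠ 0 := by
      rcases (hFa x hx).eventually_eq_zero_or_eventually_ne_zero with h1 | h1
      · exact absurd (hFa.eqOn_zero_of_preconnected_of_eventuallyEq_zero h.conn.isPreconnected hx
          h1 hxF) hFne
      · exact h1
    have hev : ∀ᶠ t in 𝓝[≠] x, w (t, p) = g' t / F t * dd e1 η (t, p) := by
      filter_upwards [hne, nhdsWithin_le_nhds (hI.mem_nhds hx)] with t ht htI using hwu t htI ht p
    have hl : Tendsto (fun t => w (t, p)) (𝓝[≠] x) (𝓝 (w (x, p))) :=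
      (analyticAt_slice_fst (hw (x, p) ⟨hx, trivial⟩)).continuousAt.tendsto.mono_left
        nhdsWithin_le_nhds
    have hr : Tendsto (fun t => g' t / F t * dd e1 η (t, p)) (𝓝[≠] x)
        (𝓝 (g' x / F x * dd e1 η (x, p))) :=
      ((hu.continuousAt.mul (analyticAt_slice_fst
        (hηx (x, p) ⟨hx, trivial⟩)).continuousAt).tendsto).mono_left nhdsWithin_le_nhds
    exact tendsto_nhds_unique (hl.congr' hev) hr
  · intro x hx p
    simp only [w, S, Φ]
    ring

end Good1

/-- An antiderivative of `1 / r²` off the only zero of `r`. -/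
theorem exists_antideriv_inv_sq {r : ℝ → ℝ} (hr : AnalyticOnNhd ℝ r univ) {z₀ : ℝ}
    (h0 : ∀ p, p ≠ z₀ → r p ≠ 0) : ∃ R : ℝ → ℝ, ∀ q, q ≠ z₀ → HasDerivAt R (1 / r q ^ 2) q := by
  have key : ∀ J : Set ℝ, IsOpen J → IsConnected J → (∀ p ∈ J, p ≠ z₀) →
      ∃ R : ℝ → ℝ, ∀ q ∈ J, HasDerivAt R (1 / r q ^ 2) q := by
    intro J hJ hJc hJz
    obtain ⟨R, hR, hRd⟩ := exists_primitive hJ hJc (g := fun q => 1 / r q ^ 2) (fun q hq =>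
      analyticAt_const.div ((hr q trivial).pow 2) (pow_ne_zero 2 (h0 q (hJz q hq))))
    exact ⟨R, fun q hq => hRd q hq ▸ (hR q hq).differentiableAt.hasDerivAt⟩
  obtain ⟨R₁, hR₁⟩ := key (Ioi z₀) isOpen_Ioi isConnected_Ioi fun p hp => (ne_of_gt hp)
  obtain ⟨R₂, hR₂⟩ := key (Iio z₀) isOpen_Iio isConnected_Iio fun p hp => (ne_of_lt hp)
  refine ⟨fun q => if z₀ < q then R₁ q else R₂ q, fun q hq => ?_⟩
  rcases lt_or_gt_of_ne hq with h | h
  · refine (hR₂ q h).congr_of_eventuallyEq ?_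
    filter_upwards [isOpen_Iio.mem_nhds h] with t ht
    exact if_neg (not_lt.2 (le_of_lt ht))
  · refine (hR₁ q h).congr_of_eventuallyEq ?_
    filter_upwards [isOpen_Ioi.mem_nhds h] with t ht
    exact if_pos ht

namespace Good1

variable {I : Set ℝ} {η Q : ℝ × ℝ → ℝ} {F : ℝ → ℝ}

/-- Without force, a Hamiltonian whose velocity vanishes at zero momentum does not depend on the
position. -/
theorem dd_e1_eq_zero (h : Good1 I η Q F) (hF : ∀ x ∈ I, F x = 0)
    (hn : ∀ x ∈ I, dd e2 η (x, 0) = 0) : ∀ z ∈ I ×ˢ (univ : Set ℝ), dd e1 η z = 0 := by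
  rintro ⟨x, p⟩ ⟨hx, -⟩
  have hm : ∀ p : ℝ, (x, p) ∈ I ×ˢ (univ : Set ℝ) := fun p => ⟨hx, trivial⟩
  have hηx := analyticOnNhd_dd h.an e1
  have hηp := analyticOnNhd_dd h.an e2
  have hr : ∀ p, HasDerivAt (fun p => dd e2 η (x, p)) (dd e2 (dd e2 η) (x, p)) p := fun p =>
    hasDerivAt_snd (hηp _ (hm p))
  have hxp : ∀ p, HasDerivAt (fun p => dd e1 η (x, p)) (dd e1 (dd e2 η) (x, p)) p := fun p => by
    rw [dd_comm (h.an _ (hm p))]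
    exact hasDerivAt_snd (hηx _ (hm p))
  have h1 := eq_mul_of_deriv_mul_eq (δ := fun p => dd e1 η (x, p)) (r := fun p => dd e2 η (x, p))
    (fun p _ => analyticAt_slice (hηx _ (hm p))) (fun p _ => analyticAt_slice (hηp _ (hm p))) (by
      intro p
      rw [(hr p).deriv, (hxp p).deriv]
      have := h.force_eq (hm p)
      simp only [hF x hx] at this
      linarith) (p₀ := 1) (h.dd_e2_ne_zero_of_ne hn hx one_ne_zero)
  have h3 := hxp 0
  rw [funext h1] at h3
  have h4 := h3.unique ((hr 0).const_mul _)
  have h5 : dd e1 (dd e2 η) (x, 0) = 0 := by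
    rw [dd_e1_eq_deriv (hηp _ (hm 0))]
    have : (fun t => dd e2 η (t, 0)) =ᶠ[𝓝 x] fun _ => 0 := by
      filter_upwards [h.isOpen.mem_nhds hx] with t ht using hn t ht
    rw [this.deriv_eq, deriv_const]
  rw [h5] at h4
  have h6 := (mul_eq_zero.1 h4.symm).resolve_right (h.ddp_ne_zero hx 0)
  rw [h1 p, h6, zero_mul]

theorem dd_e2_eq_of_force_eq_zero (h : Good1 I η Q F) (hF : ∀ x ∈ I, F x = 0)
    (hn : ∀ x ∈ I, dd e2 η (x, 0) = 0) {x x' : ℝ} (hx : x ∈ I) (hx' : x' ∈ I) (p : ℝ) :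
    dd e2 η (x, p) = dd e2 η (x', p) := by
  have h1 := h.dd_e1_eq_zero hF hn
  have hηp := analyticOnNhd_dd h.an e2
  refine h.isOpen.is_const_of_deriv_eq_zero (f := fun t => dd e2 η (t, p)) h.conn.isPreconnected
    (fun t ht => (analyticAt_slice_fst (hηp (t, p) ⟨ht, trivial⟩)).differentiableWithinAt) ?_ hx hx'
  intro t ht
  have hz : (t, p) ∈ I ×ˢ (univ : Set ℝ) := ⟨ht, trivial⟩
  rw [← dd_e1_eq_deriv (hηp _ hz), dd_comm (h.an _ hz)]
  exact dd_eq_zero_of_eqOn_const h.strip_open h1 e2 _ hz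

/-- Every solution of the equation for `s`, if the force of `η` vanishes identically. -/
theorem exists_seesawB (h : Good1 I η Q F) (hF : ∀ x ∈ I, F x = 0)
    (hn : ∀ x ∈ I, dd e2 η (x, 0) = 0) {s : ℝ × ℝ → ℝ} (hs : AnalyticOnNhd ℝ s (I ×ˢ univ))
    {g : ℝ → ℝ} (hg : ∀ x ∈ I, ∀ p, seesawForce η s (x, p) = g x) :
    ∃ (r c d u R : ℝ → ℝ) (w : ℝ × ℝ → ℝ), AnalyticOnNhd ℝ r univ ∧ Function.Bijective r ∧
      (∀ q, deriv r q ≠ 0) ∧ AnalyticOnNhd ℝ c I ∧ AnalyticOnNhd ℝ d I ∧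
      AnalyticOnNhd ℝ u univ ∧ (∀ q, r q ≠ 0 → HasDerivAt R (1 / r q ^ 2) q) ∧
      AnalyticOnNhd ℝ w (I ×ˢ univ) ∧ (∀ x ∈ I, ∀ q, r q ≠ 0 → w (x, q) = d x * R q * r q) ∧
      (∀ x ∈ I, ∀ p, dd e2 η (x, p) = r p) ∧
      ∀ x ∈ I, ∀ p, s (x, p) = c x * r p + w (x, p) + u p := by
  obtain ⟨x₁, hx₁⟩ := h.conn.nonempty
  have hm₁ : ∀ p : ℝ, (x₁, p) ∈ I ×ˢ (univ : Set ℝ) := fun p => ⟨hx₁, trivial⟩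
  have hηp := analyticOnNhd_dd h.an e2
  have hηpp := analyticOnNhd_dd hηp e2
  have hη0 := h.dd_e1_eq_zero hF hn
  let r : ℝ → ℝ := fun p => dd e2 η (x₁, p)
  have hηr : ∀ x ∈ I, ∀ p, dd e2 η (x, p) = r p := fun x hx p =>
    h.dd_e2_eq_of_force_eq_zero hF hn hx hx₁ p
  have hr : AnalyticOnNhd ℝ r univ := fun p _ => analyticAt_slice (hηp _ (hm₁ p))
  have hrd : ∀ p, HasDerivAt r (dd e2 (dd e2 η) (x₁, p)) p := fun p => hasDerivAt_snd (hηp _ (hm₁ p))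
  have hr0 : r 0 = 0 := hn x₁ hx₁
  have hrne : ∀ p, p ≠ 0 → r p ≠ 0 := fun p hp => h.dd_e2_ne_zero_of_ne hn hx₁ hp
  have hrz : ∀ p, r p ≠ 0 → p ≠ 0 := by rintro p hp rfl; exact hp hr0
  have hrpp : ∀ x ∈ I, ∀ p, dd e2 (dd e2 η) (x, p) = deriv r p := by
    intro x hx p
    rw [dd_e2_eq_deriv (hηp _ ⟨hx, trivial⟩)]
    exact congrArg (fun f => deriv f p) (funext (hηr x hx))
  -- the increment of the Wronskian expression depends on the position only
  let ψ : ℝ × ℝ → ℝ := wronskian η s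
  have hψ : AnalyticOnNhd ℝ ψ (I ×ˢ univ) := fun z hz => analyticAt_wronskian (h.an z hz) (hs z hz)
  have hψ1 : ∀ z ∈ I ×ˢ (univ : Set ℝ), dd e1 ψ z = g z.1 := by
    intro z hz
    have hb : ∀ y ∈ I ×ˢ (univ : Set ℝ), dd e1 (dd e2 η) y = 0 := fun y hy => by
      rw [dd_comm (h.an y hy)]
      exact dd_eq_zero_of_eqOn_const h.strip_open hη0 e2 y hy
    have hc : dd e1 (dd e2 (dd e2 η)) z = 0 := by
      rw [dd_comm (hηp z hz)]
      exact dd_eq_zero_of_eqOn_const h.strip_open hb e2 z hz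
    have h1 := hg z.1 hz.1 z.2
    simp only [seesawForce, br1] at h1
    simp only [ψ]
    rw [dd_wronskian (h.an z hz) (hs z hz)]
    rw [hη0 z hz, hb z hz] at h1
    rw [hb z hz, hc]
    linarith
  have hψ2 : ∀ x ∈ I, ∀ p, dd e2 ψ (x, p) = dd e2 ψ (x₁, p) := by
    intro x hx p
    refine h.isOpen.is_const_of_deriv_eq_zero (f := fun t => dd e2 ψ (t, p)) h.conn.isPreconnected
      (fun t ht => (analyticAt_slice_fst
        (analyticAt_dd (hψ (t, p) ⟨ht, trivial⟩) _)).differentiableWithinAt) ?_ hx hx₁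
    intro t ht
    have hz : (t, p) ∈ I ×ˢ (univ : Set ℝ) := ⟨ht, trivial⟩
    rw [← dd_e1_eq_deriv (analyticAt_dd (hψ _ hz) _), dd_comm (hψ _ hz),
      dd_e2_eq_deriv (analyticAt_dd (hψ _ hz) _)]
    have : (fun q => dd e1 ψ (t, q)) = fun _ => g t := funext fun q => hψ1 (t, q) ⟨ht, trivial⟩
    rw [this]
    exact deriv_const _ _
  let d : ℝ → ℝ := fun x => ψ (x, 0) - ψ (x₁, 0)
  have hd : AnalyticOnNhd ℝ d I := fun x hx =>
    (analyticAt_slice_fst (hψ (x, 0) ⟨hx, trivial⟩)).sub analyticAt_const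
  have hψd : ∀ x ∈ I, ∀ p, ψ (x, p) - ψ (x₁, p) = d x := by
    intro x hx p
    have h1 : ∀ q, HasDerivAt (fun q => ψ (x, q) - ψ (x₁, q)) 0 q := fun q => by
      refine ((hasDerivAt_snd (hψ (x, q) ⟨hx, trivial⟩)).sub
        (hasDerivAt_snd (hψ _ (hm₁ q)))).congr_deriv ?_
      rw [hψ2 x hx, sub_self]
    exact is_const_of_deriv_eq_zero (fun q => (h1 q).differentiableAt) (fun q => (h1 q).deriv) p 0
  let S : ℝ → ℝ → ℝ := fun x p => s (x, p) - s (x₁, p)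
  have hSa : ∀ x ∈ I, AnalyticOnNhd ℝ (S x) univ := fun x hx p _ =>
    (analyticAt_slice (hs (x, p) ⟨hx, trivial⟩)).sub (analyticAt_slice (hs _ (hm₁ p)))
  have hSx : ∀ p, AnalyticOnNhd ℝ (fun x => S x p) I := fun p x hx =>
    (analyticAt_slice_fst (hs (x, p) ⟨hx, trivial⟩)).sub analyticAt_const
  have hSd : ∀ x ∈ I, ∀ p, deriv (S x) p * r p - S x p * deriv r p = d x := by
    intro x hx p
    have h1 : HasDerivAt (S x) (dd e2 s (x, p) - dd e2 s (x₁, p)) p :=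
      (hasDerivAt_snd (hs (x, p) ⟨hx, trivial⟩)).sub (hasDerivAt_snd (hs _ (hm₁ p)))
    rw [h1.deriv, ← hψd x hx p]
    simp only [ψ, wronskian, hηr x hx, hηr x₁ hx₁, hrpp x hx, hrpp x₁ hx₁, S]
    ring
  -- a particular solution, normalised to have Wronskian one
  obtain ⟨W, R, hW, hR, hWR⟩ : ∃ W R : ℝ → ℝ, AnalyticOnNhd ℝ W univ ∧
      (∀ q, r q ≠ 0 → HasDerivAt R (1 / r q ^ 2) q) ∧
      ((∀ x ∈ I, d x = 0) ∧ W = 0 ∨ (∀ q, deriv W q * r q - W q * deriv r q = 1) ∧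
        ∀ q, r q ≠ 0 → W q = R q * r q) := by
    by_cases hd0 : ∃ x ∈ I, d x ≠ 0
    · obtain ⟨x₂, hx₂, hdx⟩ := hd0
      have hWa : AnalyticOnNhd ℝ (fun p => S x₂ p / d x₂) univ := fun p _ =>
        (hSa x₂ hx₂ p trivial).div analyticAt_const hdx
      have hWd : ∀ q, deriv (fun p => S x₂ p / d x₂) q * r q - S x₂ q / d x₂ * deriv r q = 1 := by
        intro q
        rw [deriv_div_const]
        have := hSd x₂ hx₂ q
        field_simp
        linarith
      refine ⟨_, fun p => S x₂ p / d x₂ / r p, hWa, fun q hq => ?_, Or.inr ⟨hWd, fun q hq => ?_⟩⟩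
      · refine ((hWa q trivial).differentiableAt.hasDerivAt.div
          (hr q trivial).differentiableAt.hasDerivAt hq).congr_deriv ?_
        rw [hWd q]
      · exact (div_mul_cancel₀ _ hq).symm
    · push Not at hd0
      obtain ⟨R, hR⟩ := exists_antideriv_inv_sq hr hrne
      exact ⟨0, R, fun _ _ => analyticAt_const, fun q hq => hR q (hrz q hq), Or.inl ⟨hd0, rfl⟩⟩
  have hWd : ∀ x ∈ I, ∀ q, d x * (deriv W q * r q - W q * deriv r q) = d x := by
    intro x hx q
    rcases hWR with ⟨h0, rfl⟩ | ⟨h1, -⟩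
    · simp [h0 x hx]
    · rw [h1 q, mul_one]
  refine ⟨r, fun x => (S x 1 - d x * W 1) / r 1, d, fun p => s (x₁, p), R,
    fun z => d z.1 * W z.2, hr, ⟨?_, ?_⟩, ?_, ?_, hd, fun p _ => analyticAt_slice (hs _ (hm₁ p)), hR,
    ?_, ?_, hηr, ?_⟩
  · intro p q hpq
    have h1 := h.left x₁ hx₁ p
    have h2 := h.left x₁ hx₁ q
    rw [show dd e2 η (x₁, p) = dd e2 η (x₁, q) from hpq] at h1
    exact h1.symm.trans h2
  · exact fun v => ⟨Q (x₁, v), h.right x₁ hx₁ v⟩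
  · intro q
    rw [(hrd q).deriv]
    exact h.ddp_ne_zero hx₁ q
  · exact fun x hx => ((hSx 1 x hx).sub ((hd x hx).mul analyticAt_const)).div analyticAt_const
      (hrne 1 one_ne_zero)
  · exact fun z hz => (analyticAt_comp_fst (hd _ hz.1)).mul (analyticAt_comp_snd (hW _ trivial))
  · intro x hx q hq
    rcases hWR with ⟨h0, -⟩ | ⟨-, h1⟩
    · simp [h0 x hx]
    · simp only [h1 q hq, mul_assoc]
  · intro x hx p
    have h1 := eq_mul_of_deriv_mul_eq (δ := fun p => S x p - d x * W p) (r := r)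
      (fun p _ => (hSa x hx p trivial).sub (analyticAt_const.mul (hW p trivial))) hr (by
        intro p
        have h2 : HasDerivAt (fun p => S x p - d x * W p) (deriv (S x) p - d x * deriv W p) p :=
          (hSa x hx p trivial).differentiableAt.hasDerivAt.sub
            ((hW p trivial).differentiableAt.hasDerivAt.const_mul _)
        rw [h2.deriv]
        linear_combination hSd x hx p - hWd x hx p) (p₀ := 1) (hrne 1 one_ne_zero) p
    simp only [S] at h1 ⊢
    linear_combination h1

end Good1

/-! ### The force of a given Seesaw Hamiltonian -/

/-- A continuous function on a strip that is constant, up to one exceptional momentum, on the lines over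
a dense set of positions is constant on every line. -/
theorem eq_of_eventually_const {I : Set ℝ} {f : ℝ × ℝ → ℝ} (hf : AnalyticOnNhd ℝ f (I ×ˢ univ))
    (hI : IsOpen I)
    (h : ∀ x ∈ I, ∀ᶠ t in 𝓝[≠] x, ∃ p₀ c, ∀ p, p ≠ p₀ → f (t, p) = c) :
    ∀ x ∈ I, ∀ p, f (x, p) = f (x, 0) := by
  intro x hx p
  have hl : ∀ p, Tendsto (fun t => f (t, p)) (𝓝[≠] x) (𝓝 (f (x, p))) := fun p =>
    (analyticAt_slice_fst (hf (x, p) ⟨hx, trivial⟩)).continuousAt.tendsto.mono_left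
      nhdsWithin_le_nhds
  refine tendsto_nhds_unique ((hl p).congr' ?_) (hl 0)
  filter_upwards [h x hx, nhdsWithin_le_nhds (hI.mem_nhds hx)] with t ht htI
  obtain ⟨p₀, c, hc⟩ := ht
  have hcont : Continuous fun q => f (t, q) := continuous_iff_continuousAt.2 fun q =>
    (analyticAt_slice (hf (t, q) ⟨htI, trivial⟩)).continuousAt
  have := hcont.ext_on (dense_compl_singleton p₀) continuous_const (fun q hq => hc q hq)
  rw [congrFun this p, congrFun this 0]

namespace Good1

variable {I : Set ℝ} {η Q : ℝ × ℝ → ℝ} {F : ℝ → ℝ}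

theorem seesawForce_typeA (h : Good1 I η Q F) {G u : ℝ → ℝ} {w : ℝ × ℝ → ℝ}
    (hG : AnalyticOnNhd ℝ G (η '' (I ×ˢ univ))) (hu : MeromorphicOn u I)
    (hw : AnalyticOnNhd ℝ w (I ×ˢ univ))
    (hwu : ∀ x ∈ I, AnalyticAt ℝ u x → ∀ p, w (x, p) = u x * dd e1 η (x, p)) :
    ∃ s : ℝ × ℝ → ℝ, AnalyticOnNhd ℝ s (I ×ˢ univ) ∧
      (∀ x ∈ I, ∀ p, s (x, p) = w (x, p) + G (η (x, p)) -
        dd e2 η (x, p) * ∫ t in (0 : ℝ)..p, deriv G (η (x, t))) ∧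
      ∃ g : ℝ → ℝ, ∀ x ∈ I, ∀ p, seesawForce η s (x, p) = g x := by
  have hI := h.isOpen
  have hηp := analyticOnNhd_dd h.an e2
  have hηpp := analyticOnNhd_dd hηp e2
  have hηx := analyticOnNhd_dd h.an e1
  have hGη : AnalyticOnNhd ℝ (fun z => G (η z)) (I ×ˢ univ) := fun z hz =>
    AnalyticAt.comp (hG _ ⟨z, hz, rfl⟩) (h.an z hz)
  have hG'η : AnalyticOnNhd ℝ (fun z => deriv G (η z)) (I ×ˢ univ) := fun z hz =>
    AnalyticAt.comp (hG _ ⟨z, hz, rfl⟩).deriv (h.an z hz)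
  let Φ : ℝ × ℝ → ℝ := fun z => ∫ t in (0 : ℝ)..z.2, deriv G (η (z.1, t))
  have hΦ : AnalyticOnNhd ℝ Φ (I ×ˢ univ) := analyticOnNhd_integral_snd hI hG'η
  have hΦd : ∀ z ∈ I ×ˢ (univ : Set ℝ), dd e2 Φ z = deriv G (η z) := fun z hz =>
    dd_e2_integral hI hG'η hz
  let s : ℝ × ℝ → ℝ := fun z => w z + G (η z) - dd e2 η z * Φ z
  have hs : AnalyticOnNhd ℝ s (I ×ˢ univ) := fun z hz =>
    ((hw z hz).add (hGη z hz)).sub ((hηp z hz).mul (hΦ z hz))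
  have hsd : ∀ z ∈ I ×ˢ (univ : Set ℝ), dd e2 s z = dd e2 w z - dd e2 (dd e2 η) z * Φ z := by
    intro z hz
    change dd e2 (fun z => w z + G (η z) - dd e2 η z * Φ z) z = _
    rw [dd_sub ((hw z hz).fun_add (hGη z hz)) ((hηp z hz).fun_mul (hΦ z hz)),
      dd_add (hw z hz) (hGη z hz), dd_mul (hηp z hz) (hΦ z hz), hΦd z hz,
      dd_comp_real (hG _ ⟨z, hz, rfl⟩) (h.an z hz)]
    ring
  refine ⟨s, hs, fun x hx p => rfl, fun x => seesawForce η s (x, 0), ?_⟩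
  refine eq_of_eventually_const (fun z hz => analyticAt_seesawForce (h.an z hz) (hs z hz)) hI ?_
  intro x hx
  -- the regular points of `u` are dense
  filter_upwards [(hu x hx).eventually_analyticAt.and
    (nhdsWithin_le_nhds (hI.mem_nhds hx))] with t ⟨htu, htI⟩
  refine ⟨Q (t, 0), deriv (fun x => u x * F x) t, fun p hp => ?_⟩
  have hz : (t, p) ∈ I ×ˢ (univ : Set ℝ) := ⟨htI, trivial⟩
  refine h.seesawForce_eq_of_wronskian (f := fun x => u x * F x) hz (hs _ hz) (hG _ ⟨_, hz, rfl⟩)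
    (htu.mul (h.analytic_force t htI)) ?_ ?_
  · filter_upwards [h.strip_open.mem_nhds hz,
      continuousAt_fst.eventually htu.eventually_analyticAt] with y hy hyu
    have hw2 : dd e2 w y = u y.1 * dd e1 (dd e2 η) y := by
      have h1 := hasDerivAt_snd (hw (y.1, y.2) hy)
      rw [funext (hwu y.1 hy.1 hyu)] at h1
      rw [h1.unique ((hasDerivAt_snd (hηx (y.1, y.2) hy)).const_mul _), dd_comm (h.an y hy)]
    have hw0 : w y = u y.1 * dd e1 η y := hwu y.1 hy.1 hyu y.2
    simp only [wronskian, hsd y hy, hw2]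
    simp only [s, hw0]
    linear_combination (u y.1) * h.force_eq hy
  · intro h0
    apply hp
    rw [← h.left t htI p, h0]

theorem seesawForce_typeB (h : Good1 I η Q F) {r c d u R : ℝ → ℝ} {w : ℝ × ℝ → ℝ}
    (hη : ∀ x ∈ I, ∀ p, dd e2 η (x, p) = r p) (hη1 : ∀ z ∈ I ×ˢ (univ : Set ℝ), dd e1 η z = 0)
    (hr : AnalyticOnNhd ℝ r univ)
    (hc : AnalyticOnNhd ℝ c I) (hd : AnalyticOnNhd ℝ d I) (hu : AnalyticOnNhd ℝ u univ)
    (hR : ∀ q, r q ≠ 0 → HasDerivAt R (1 / r q ^ 2) q) (hw : AnalyticOnNhd ℝ w (I ×ˢ univ))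
    (hwR : ∀ x ∈ I, ∀ q, r q ≠ 0 → w (x, q) = d x * R q * r q) :
    ∃ s : ℝ × ℝ → ℝ, AnalyticOnNhd ℝ s (I ×ˢ univ) ∧
      (∀ x ∈ I, ∀ p, s (x, p) = c x * r p + w (x, p) + u p) ∧
      ∃ g : ℝ → ℝ, ∀ x ∈ I, ∀ p, seesawForce η s (x, p) = g x := by
  have hI := h.isOpen
  let t : ℝ × ℝ → ℝ := fun z => c z.1 * r z.2 + w z
  let t' : ℝ × ℝ → ℝ := fun z => u z.2
  have ht : AnalyticOnNhd ℝ t (I ×ˢ univ) := fun z hz =>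
    ((analyticAt_comp_fst (hc _ hz.1)).mul (analyticAt_comp_snd (hr _ trivial))).add (hw z hz)
  have ht' : AnalyticOnNhd ℝ t' (I ×ˢ univ) := fun z hz => analyticAt_comp_snd (hu _ trivial)
  have hs : AnalyticOnNhd ℝ (fun z => t z + t' z) (I ×ˢ univ) := fun z hz =>
    (ht z hz).add (ht' z hz)
  have hzero : ∀ z ∈ I ×ˢ (univ : Set ℝ), seesawForce η t' z = 0 := by
    intro z hz
    have h1 : ∀ y ∈ I ×ˢ (univ : Set ℝ), dd e1 t' y = 0 := fun y _ => by
      simp only [t']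
      rw [dd_comp_snd (hu _ trivial)]
      simp [e1]
    have h2 : dd e1 (dd e2 t') z = 0 := by
      rw [dd_comm (ht' z hz)]
      exact dd_eq_zero_of_eqOn_const h.strip_open h1 e2 z hz
    have h3 : dd e1 (dd e2 η) z = 0 := by
      rw [dd_comm (h.an z hz)]
      exact dd_eq_zero_of_eqOn_const h.strip_open hη1 e2 z hz
    simp [seesawForce, br1, h1 z hz, h2, h3, hη1 z hz]
  refine ⟨fun z => t z + t' z, hs, fun x hx p => rfl,
    fun x => seesawForce η (fun z => t z + t' z) (x, 0), ?_⟩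
  refine eq_of_eventually_const (fun z hz => analyticAt_seesawForce (h.an z hz) (hs z hz)) hI ?_
  intro x hx
  filter_upwards [nhdsWithin_le_nhds (hI.mem_nhds hx)] with y hyI
  refine ⟨Q (y, 0), deriv d y, fun p hp => ?_⟩
  have hz : (y, p) ∈ I ×ˢ (univ : Set ℝ) := ⟨hyI, trivial⟩
  have hr0 : r p ≠ 0 := by
    intro h0
    apply hp
    rw [← h.left y hyI p, hη y hyI, h0]
  rw [seesawForce_add (ht _ hz) (ht' _ hz), hzero _ hz, add_zero]
  refine h.seesawForce_eq_of_wronskian (G := fun _ => 0) (f := d) hz (ht _ hz) analyticAt_const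
    (hd y hyI) ?_ (by rw [hη y hyI]; exact hr0)
  have hrc : ContinuousAt (fun v : ℝ × ℝ => r v.2) (y, p) :=
    (analyticAt_comp_snd (z := (y, p)) (hr p trivial)).continuousAt
  filter_upwards [h.strip_open.mem_nhds hz, hrc.eventually_ne hr0] with v hv hvr
  have hηpp : dd e2 (dd e2 η) v = deriv r v.2 := by
    have := dd_e2_eq_deriv (x := v.1) (p := v.2) (analyticOnNhd_dd h.an e2 v hv)
    rw [funext (hη v.1 hv.1)] at this
    exact this
  have hrd : HasDerivAt r (deriv r v.2) v.2 := (hr _ trivial).differentiableAt.hasDerivAt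
  have hwv : (fun q => w (v.1, q)) =ᶠ[𝓝 v.2] fun q => d v.1 * R q * r q := by
    filter_upwards [(hr v.2 trivial).continuousAt.eventually_ne hvr] with q hq using
      hwR v.1 hv.1 q hq
  have hwd := (hasDerivAt_snd (x := v.1) (p := v.2) (hw v hv)).unique
    ((((hR _ hvr).const_mul (d v.1)).mul hrd).congr_of_eventuallyEq hwv)
  have htd := (hasDerivAt_snd (x := v.1) (p := v.2) (ht v hv)).unique
    ((hrd.const_mul (c v.1)).add (hasDerivAt_snd (x := v.1) (p := v.2) (hw v hv)))
  have hw0 : w v = d v.1 * R v.2 * r v.2 := hwR v.1 hv.1 v.2 hvr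
  have hηv : dd e2 η v = r v.2 := hη v.1 hv.1 v.2
  simp only [Prod.mk.eta] at htd hwd
  simp only [wronskian]
  rw [htd, hwd, hηpp, hηv]
  simp only [t, hw0]
  field_simp
  ring

end Good1

/-! ### Functions on phase space that depend on one position and one momentum -/

/-- The projection of phase space to the `i`-th position and the `j`-th momentum. -/
noncomputable def coord (i j : Fin 2) : Vec 2 × Vec 2 →L[ℝ] ℝ × ℝ :=
  ((ContinuousLinearMap.proj i).comp (ContinuousLinearMap.fst ℝ (Vec 2) (Vec 2))).prod
    ((ContinuousLinearMap.proj j).comp (ContinuousLinearMap.snd ℝ (Vec 2) (Vec 2)))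

theorem coord_apply (i j : Fin 2) (z : Vec 2 × Vec 2) : coord i j z = (z.1 i, z.2 j) := rfl

theorem coord_eX_self (i j : Fin 2) : coord i j (eX i) = e1 := by simp [coord_apply, eX, e1]

theorem coord_eP_self (i j : Fin 2) : coord i j (eP j) = e2 := by simp [coord_apply, eP, e2]

theorem coord_eX_of_ne {i j k : Fin 2} (h : i ≠ k) : coord i j (eX k) = 0 := by
  simp [coord_apply, eX, h]

theorem coord_eP_of_ne {i j k : Fin 2} (h : j ≠ k) : coord i j (eP k) = 0 := by
  simp [coord_apply, eP, h]

theorem dd_comp_coord {f : ℝ × ℝ → ℝ} {i j : Fin 2} {z : Vec 2 × Vec 2}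
    (hf : AnalyticAt ℝ f (coord i j z)) (e : Vec 2 × Vec 2) :
    dd e (fun y => f (coord i j y)) z = dd (coord i j e) f (coord i j z) := dd_comp_clm _ hf e

theorem analyticAt_comp_coord {f : ℝ × ℝ → ℝ} {i j : Fin 2} {z : Vec 2 × Vec 2}
    (hf : AnalyticAt ℝ f (coord i j z)) : AnalyticAt ℝ (fun y => f (coord i j y)) z :=
  hf.comp ((coord i j).analyticAt z)

theorem isOpen_phase {D : Set (Vec 2)} (hD : IsOpen D) : IsOpen (D ×ˢ (univ : Set (Vec 2))) :=
  hD.prod isOpen_univ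

theorem isPreconnected_phase {D : Set (Vec 2)} (hD : IsConnected D) :
    IsPreconnected (D ×ˢ (univ : Set (Vec 2))) := hD.isPreconnected.prod isPreconnected_univ

theorem isOpen_projection {D : Set (Vec 2)} (hD : IsOpen D) (i : Fin 2) :
    IsOpen ((fun x : Vec 2 => x i) '' D) := isOpenMap_eval (X := fun _ : Fin 2 => ℝ) i D hD

theorem isConnected_projection {D : Set (Vec 2)} (hD : IsConnected D) (i : Fin 2) :
    IsConnected ((fun x : Vec 2 => x i) '' D) := hD.image _ (continuous_apply i).continuousOn

/-- An analytic function on phase space whose derivatives vanish except with respect to one position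
and one momentum is an analytic function of these two. -/
theorem exists_eq_comp_coord {D : Set (Vec 2)} (hD : IsOpen D) (hDc : IsConnected D)
    {f : Vec 2 × Vec 2 → ℝ} (hf : AnalyticOnNhd ℝ f (D ×ˢ univ)) {i i' j j' : Fin 2} (hi : i ≠ i')
    (hj : j ≠ j') (hX : ∀ z ∈ D ×ˢ (univ : Set (Vec 2)), dd (eX i') f z = 0)
    (hP : ∀ z ∈ D ×ˢ (univ : Set (Vec 2)), dd (eP j') f z = 0) :
    ∃ g : ℝ × ℝ → ℝ, AnalyticOnNhd ℝ g (((fun x : Vec 2 => x i) '' D) ×ˢ univ) ∧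
      ∀ z ∈ D ×ˢ (univ : Set (Vec 2)), f z = g (coord i j z) := by
  have hdec : ∀ {k k' : Fin 2}, k ≠ k' → ∀ v : Vec 2,
      v = Pi.single k (v k) + v k' • (Pi.single k' 1 : Vec 2) := by
    intro k k' hk v
    funext l
    fin_cases k <;> fin_cases k' <;> fin_cases l <;> simp at hk ⊢
  -- the momentum `j'` may be put to zero
  have h1 : ∀ x ∈ D, ∀ p : Vec 2, f (x, p) = f (x, Pi.single j (p j)) := by
    intro x hx p
    have hline : ∀ t : ℝ, (x, Pi.single j (p j)) + t • eP j' =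
        (x, Pi.single j (p j) + t • (Pi.single j' 1 : Vec 2)) := fun t => by
      ext <;> simp [eP]
    have := eq_of_dd_eq_zero (f := f) (z := (x, Pi.single j (p j))) (e := eP j')
      (fun t => by rw [hline]; exact hf _ ⟨hx, trivial⟩)
      (fun t => by rw [hline]; exact hP _ ⟨hx, trivial⟩) (p j')
    rw [hline, ← hdec hj p] at this
    exact this
  obtain ⟨g, hg, hgk⟩ := exists_analytic_factor (X := Vec 2) (D := D) hDc
    (π := fun x => x i) (fun z _ => (continuous_apply i).continuousAt)
    (k := fun x q => f (x, Pi.single j q)) (by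
      intro x hx N hN
      have := (isOpenMap_eval (X := fun _ : Fin 2 => ℝ) i).image_mem_nhds hN
      exact ⟨_, mem_interior_iff_mem_nhds.2 this⟩) (by
      intro x₀ hx₀
      obtain ⟨ε, hε, hb⟩ := Metric.isOpen_iff.1 hD x₀ hx₀
      have hin : ∀ s t : ℝ, |s| < ε → |t| < ε →
          x₀ + s • (Pi.single i 1 : Vec 2) + t • (Pi.single i' 1 : Vec 2) ∈ D := by
        intro s t hs ht
        apply hb
        rw [mem_ball_iff_norm, pi_norm_lt_iff hε]
        intro l
        fin_cases i <;> fin_cases i' <;> fin_cases l <;> simp at hi ⊢ <;> assumption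
      refine ⟨Metric.ball (x₀ i) ε, Metric.isOpen_ball, (convex_ball _ _).isPreconnected,
        Metric.mem_ball_self hε,
        fun w => f (x₀ + (w.1 - x₀ i) • (Pi.single i 1 : Vec 2), Pi.single j w.2), ?_, ?_⟩
      · intro w hw
        have hmap : AnalyticAt ℝ (fun w : ℝ × ℝ =>
            ((x₀ + (w.1 - x₀ i) • (Pi.single i 1 : Vec 2), Pi.single j w.2) : Vec 2 × Vec 2)) w := by
          refine AnalyticAt.prod ?_ ?_
          · exact analyticAt_const.add ((analyticAt_fst.sub analyticAt_const).smul analyticAt_const)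
          · have : (fun w : ℝ × ℝ => (Pi.single j w.2 : Vec 2)) =
                fun w => w.2 • (Pi.single j 1 : Vec 2) := by
              funext w l
              simp [Pi.single_apply]
            rw [this]
            exact analyticAt_snd.smul analyticAt_const
        refine AnalyticAt.comp_of_eq (g := f) (hf (x₀ + (w.1 - x₀ i) • (Pi.single i 1 : Vec 2),
          Pi.single j w.2) ⟨?_, trivial⟩) hmap rfl
        have := hin (w.1 - x₀ i) 0 (by simpa [Real.dist_eq] using hw.1) (by simpa using hε)
        simpa using this
      · filter_upwards [Metric.ball_mem_nhds x₀ hε] with x hx q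
        have hcl : ∀ l, |x l - x₀ l| < ε := by
          intro l
          rw [mem_ball_iff_norm, pi_norm_lt_iff hε] at hx
          exact hx l
        have hxe : x = x₀ + (x i - x₀ i) • (Pi.single i 1 : Vec 2) +
            (x i' - x₀ i') • (Pi.single i' 1 : Vec 2) := by
          funext l
          fin_cases i <;> fin_cases i' <;> fin_cases l <;> simp at hi ⊢
        set z₀ : Vec 2 × Vec 2 := (x₀ + (x i - x₀ i) • (Pi.single i 1 : Vec 2), Pi.single j q)
          with hz₀
        have hline : ∀ t : ℝ, z₀ + t • eX i' = (x₀ + (x i - x₀ i) • (Pi.single i 1 : Vec 2) +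
            t • (Pi.single i' 1 : Vec 2), Pi.single j q) := fun t => by
          ext <;> simp [eX, z₀]
        have hmem : ∀ t ∈ Metric.ball (0 : ℝ) ε, z₀ + t • eX i' ∈ D ×ˢ (univ : Set (Vec 2)) := by
          intro t ht
          rw [hline]
          exact ⟨hin _ _ (hcl i) (by simpa using ht), trivial⟩
        have hder : ∀ t ∈ Metric.ball (0 : ℝ) ε, HasDerivAt (fun t => f (z₀ + t • eX i')) 0 t :=
          fun t ht => (hasDerivAt_line (hf _ (hmem t ht))).congr_deriv (hX _ (hmem t ht))
        have hc := Metric.isOpen_ball.is_const_of_deriv_eq_zero (f := fun t => f (z₀ + t • eX i'))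
          (convex_ball (0 : ℝ) ε).isPreconnected
          (fun v hv => (hder v hv).differentiableAt.differentiableWithinAt)
          (fun v hv => (hder v hv).deriv) (x := x i' - x₀ i') (y := 0)
          (by simpa using hcl i') (Metric.mem_ball_self hε)
        simp only [hline, ← hxe, zero_smul, add_zero] at hc
        exact hc)
  refine ⟨g, hg, ?_⟩
  rintro ⟨x, p⟩ ⟨hx, -⟩
  rw [h1 x hx p, hgk x hx]
  rfl

/-! ### Seesaw Hamiltonians -/

/-- The function `y α + p_x β + γ` on phase space, with `α`, `β`, `γ` evaluated at `(x, p_y)`. -/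
noncomputable def seesaw (α β γ : ℝ × ℝ → ℝ) : Vec 2 × Vec 2 → ℝ :=
  fun z => z.1 1 * α (coord 0 1 z) + z.2 0 * β (coord 0 1 z) + γ (coord 0 1 z)

section Seesaw

variable {α β γ : ℝ × ℝ → ℝ} {z : Vec 2 × Vec 2}

theorem analyticAt_fst_apply (i : Fin 2) (z : Vec 2 × Vec 2) :
    AnalyticAt ℝ (fun z : Vec 2 × Vec 2 => z.1 i) z :=
  ((ContinuousLinearMap.proj (R := ℝ) (φ := fun _ : Fin 2 => ℝ) i).comp
    (ContinuousLinearMap.fst ℝ (Vec 2) (Vec 2))).analyticAt z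

theorem analyticAt_snd_apply (i : Fin 2) (z : Vec 2 × Vec 2) :
    AnalyticAt ℝ (fun z : Vec 2 × Vec 2 => z.2 i) z :=
  ((ContinuousLinearMap.proj (R := ℝ) (φ := fun _ : Fin 2 => ℝ) i).comp
    (ContinuousLinearMap.snd ℝ (Vec 2) (Vec 2))).analyticAt z

theorem dd_fst_apply (i : Fin 2) (e z : Vec 2 × Vec 2) :
    dd e (fun z : Vec 2 × Vec 2 => z.1 i) z = e.1 i :=
  dd_clm ((ContinuousLinearMap.proj (R := ℝ) (φ := fun _ : Fin 2 => ℝ) i).comp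
    (ContinuousLinearMap.fst ℝ (Vec 2) (Vec 2))) e z

theorem dd_snd_apply (i : Fin 2) (e z : Vec 2 × Vec 2) :
    dd e (fun z : Vec 2 × Vec 2 => z.2 i) z = e.2 i :=
  dd_clm ((ContinuousLinearMap.proj (R := ℝ) (φ := fun _ : Fin 2 => ℝ) i).comp
    (ContinuousLinearMap.snd ℝ (Vec 2) (Vec 2))) e z

theorem analyticAt_seesaw (hα : AnalyticAt ℝ α (coord 0 1 z)) (hβ : AnalyticAt ℝ β (coord 0 1 z))
    (hγ : AnalyticAt ℝ γ (coord 0 1 z)) : AnalyticAt ℝ (seesaw α β γ) z :=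
  (((analyticAt_fst_apply 1 z).mul (analyticAt_comp_coord hα)).add
    ((analyticAt_snd_apply 0 z).mul (analyticAt_comp_coord hβ))).add (analyticAt_comp_coord hγ)

theorem dd_seesaw (hα : AnalyticAt ℝ α (coord 0 1 z)) (hβ : AnalyticAt ℝ β (coord 0 1 z))
    (hγ : AnalyticAt ℝ γ (coord 0 1 z)) (e : Vec 2 × Vec 2) : dd e (seesaw α β γ) z =
      e.1 1 * α (coord 0 1 z) + e.2 0 * β (coord 0 1 z) +
      seesaw (dd (coord 0 1 e) α) (dd (coord 0 1 e) β) (dd (coord 0 1 e) γ) z := by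
  have hy := analyticAt_fst_apply 1 z
  have hp := analyticAt_snd_apply 0 z
  have h1 := analyticAt_comp_coord hα
  have h2 := analyticAt_comp_coord hβ
  have h3 := analyticAt_comp_coord hγ
  change dd e (fun z => z.1 1 * α (coord 0 1 z) + z.2 0 * β (coord 0 1 z) + γ (coord 0 1 z)) z = _
  rw [dd_add ((hy.fun_mul h1).fun_add (hp.fun_mul h2)) h3,
    dd_add (hy.fun_mul h1) (hp.fun_mul h2), dd_mul hy h1, dd_mul hp h2, dd_comp_coord hα,
    dd_comp_coord hβ, dd_comp_coord hγ, dd_fst_apply, dd_snd_apply]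
  simp only [seesaw]
  ring

theorem dd_eX0_seesaw (hα : AnalyticAt ℝ α (coord 0 1 z)) (hβ : AnalyticAt ℝ β (coord 0 1 z))
    (hγ : AnalyticAt ℝ γ (coord 0 1 z)) :
    dd (eX 0) (seesaw α β γ) z = seesaw (dd e1 α) (dd e1 β) (dd e1 γ) z := by
  rw [dd_seesaw hα hβ hγ, coord_eX_self]
  simp [eX]

theorem dd_eP1_seesaw (hα : AnalyticAt ℝ α (coord 0 1 z)) (hβ : AnalyticAt ℝ β (coord 0 1 z))
    (hγ : AnalyticAt ℝ γ (coord 0 1 z)) :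
    dd (eP 1) (seesaw α β γ) z = seesaw (dd e2 α) (dd e2 β) (dd e2 γ) z := by
  rw [dd_seesaw hα hβ hγ, coord_eP_self]
  simp [eP]

theorem dd_eX1_seesaw (hα : AnalyticAt ℝ α (coord 0 1 z)) (hβ : AnalyticAt ℝ β (coord 0 1 z))
    (hγ : AnalyticAt ℝ γ (coord 0 1 z)) : dd (eX 1) (seesaw α β γ) z = α (coord 0 1 z) := by
  rw [dd_seesaw hα hβ hγ, coord_eX_of_ne (by decide)]
  simp [eX, seesaw, dd_zero_dir]

theorem dd_eP0_seesaw (hα : AnalyticAt ℝ α (coord 0 1 z)) (hβ : AnalyticAt ℝ β (coord 0 1 z))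
    (hγ : AnalyticAt ℝ γ (coord 0 1 z)) : dd (eP 0) (seesaw α β γ) z = β (coord 0 1 z) := by
  rw [dd_seesaw hα hβ hγ, coord_eP_of_ne (by decide)]
  simp [eP, seesaw, dd_zero_dir]

end Seesaw

section SeesawHamiltonian

variable {I : Set ℝ} {η Q : ℝ × ℝ → ℝ} {F : ℝ → ℝ} {s : ℝ × ℝ → ℝ} {D : Set (Vec 2)}
  {h : Vec 2 × Vec 2 → ℝ}

theorem Good1.dd_force (hη : Good1 I η Q F) {z : ℝ × ℝ} (hz : z ∈ I ×ˢ (univ : Set ℝ)) (e : ℝ × ℝ) :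
    br1 (dd e (dd e2 η)) η z + br1 (dd e2 η) (dd e η) z = deriv F z.1 * e.1 := by
  rw [← dd_br1 (analyticAt_dd (hη.an z hz) _) (hη.an z hz),
    dd_congr_on hη.strip_open (g := fun w => F w.1) (fun w hw => hη.force w.1 hw.1 w.2) e hz,
    dd_comp_fst (hη.analytic_force _ hz.1)]

theorem vel_seesaw (hD : IsOpen D) (hη : Good1 I η Q F) (hs : AnalyticOnNhd ℝ s (I ×ˢ univ))
    (hDI : ∀ x ∈ D, x 0 ∈ I) (hh : EqOn h (seesaw (dd e1 η) (dd e2 η) s) (D ×ˢ univ)) :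
    EqOn (dd (eP 0) h) (seesaw (fun _ => 0) (fun _ => 0) (dd e2 η)) (D ×ˢ univ) ∧
    EqOn (dd (eP 1) h) (seesaw (dd e2 (dd e1 η)) (dd e2 (dd e2 η)) (dd e2 s)) (D ×ˢ univ) ∧
    EqOn (dd (eX 0) h) (seesaw (dd e1 (dd e1 η)) (dd e1 (dd e2 η)) (dd e1 s)) (D ×ˢ univ) ∧
    EqOn (dd (eX 1) h) (fun z => dd e1 η (coord 0 1 z)) (D ×ˢ univ) := by
  have hm : ∀ z ∈ D ×ˢ (univ : Set (Vec 2)), coord 0 1 z ∈ I ×ˢ (univ : Set ℝ) := fun z hz =>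
    ⟨hDI _ hz.1, trivial⟩
  have hηx := analyticOnNhd_dd hη.an e1
  have hηp := analyticOnNhd_dd hη.an e2
  refine ⟨fun z hz => ?_, fun z hz => ?_, fun z hz => ?_, fun z hz => ?_⟩ <;>
    rw [dd_congr_on (isOpen_phase hD) hh _ hz]
  · rw [dd_eP0_seesaw (hηx _ (hm z hz)) (hηp _ (hm z hz)) (hs _ (hm z hz))]
    simp [seesaw]
  · exact dd_eP1_seesaw (hηx _ (hm z hz)) (hηp _ (hm z hz)) (hs _ (hm z hz))
  · exact dd_eX0_seesaw (hηx _ (hm z hz)) (hηp _ (hm z hz)) (hs _ (hm z hz))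
  · exact dd_eX1_seesaw (hηx _ (hm z hz)) (hηp _ (hm z hz)) (hs _ (hm z hz))

/-- The force of a Seesaw Hamiltonian. -/
theorem frc_seesaw (hD : IsOpen D) (hη : Good1 I η Q F) (hs : AnalyticOnNhd ℝ s (I ×ˢ univ))
    (hDI : ∀ x ∈ D, x 0 ∈ I) (hh : EqOn h (seesaw (dd e1 η) (dd e2 η) s) (D ×ˢ univ))
    {z : Vec 2 × Vec 2} (hz : z ∈ D ×ˢ (univ : Set (Vec 2))) :
    frc h 0 z = F (z.1 0) ∧
      frc h 1 z = z.1 1 * deriv F (z.1 0) + seesawForce η s (coord 0 1 z) := by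
  have hUo := isOpen_phase hD
  obtain ⟨hP0, hP1, hX0, hX1⟩ := vel_seesaw hD hη hs hDI hh
  have hw : coord 0 1 z ∈ I ×ˢ (univ : Set ℝ) := ⟨hDI _ hz.1, trivial⟩
  have hη0 := hη.an _ hw
  have hηx := analyticAt_dd hη0 e1
  have hηp := analyticAt_dd hη0 e2
  have hc := fun c : ℝ => analyticAt_const (𝕜 := ℝ) (v := c) (x := coord 0 1 z)
  constructor
  · simp only [frc, br, Fin.sum_univ_two]
    rw [dd_congr_on hUo hP0 _ hz, dd_congr_on hUo hP0 _ hz, dd_congr_on hUo hP0 _ hz,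
      dd_congr_on hUo hP0 _ hz, hP0 hz, hP1 hz, hX0 hz, hX1 hz, dd_eX0_seesaw (hc 0) (hc 0) hηp,
      dd_eX1_seesaw (hc 0) (hc 0) hηp, dd_eP0_seesaw (hc 0) (hc 0) hηp,
      dd_eP1_seesaw (hc 0) (hc 0) hηp]
    have := hη.force_eq hw
    simp only [seesaw, dd_const]
    simp only [coord_apply] at this ⊢
    linear_combination this
  · have a1 := analyticAt_dd hηx e2
    have a2 := analyticAt_dd hηp e2
    have a3 := analyticAt_dd (hs _ hw) e2
    simp only [frc, br, Fin.sum_univ_two]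
    rw [dd_congr_on hUo hP1 _ hz, dd_congr_on hUo hP1 _ hz, dd_congr_on hUo hP1 _ hz,
      dd_congr_on hUo hP1 _ hz, hP0 hz, hP1 hz, hX0 hz, hX1 hz, dd_eX0_seesaw a1 a2 a3,
      dd_eX1_seesaw a1 a2 a3, dd_eP0_seesaw a1 a2 a3, dd_eP1_seesaw a1 a2 a3]
    have b1 := hη.dd_force hw e1
    have b2 := hη.dd_force hw e2
    simp only [br1, seesaw, seesawForce] at b1 b2 ⊢
    rw [dd_comm_inner hη0 e1 e1 e2, dd_comm_inner hη0 e2 e1 e2] at b1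
    rw [dd_comm hη0 e2 e1] at b1 ⊢
    simp only [e1, e2, mul_one, mul_zero, coord_apply] at b1 b2 ⊢
    linear_combination (z.1 1) * b1 + (z.2 0) * b2

theorem reg_seesaw (hD : IsOpen D) (hη : Good1 I η Q F) (hs : AnalyticOnNhd ℝ s (I ×ˢ univ))
    (hDI : ∀ x ∈ D, x 0 ∈ I) (hh : EqOn h (seesaw (dd e1 η) (dd e2 η) s) (D ×ˢ univ)) :
    ∃ P, Reg D h P := by
  obtain ⟨hP0, hP1, -, -⟩ := vel_seesaw hD hη hs hDI hh
  have hUo := isOpen_phase hD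
  have hm : ∀ z ∈ D ×ˢ (univ : Set (Vec 2)), coord 0 1 z ∈ I ×ˢ (univ : Set ℝ) := fun z hz =>
    ⟨hDI _ hz.1, trivial⟩
  have hηx := analyticOnNhd_dd hη.an e1
  have hηp := analyticOnNhd_dd hη.an e2
  have hηpp := analyticOnNhd_dd hηp e2
  have hvel : ∀ z ∈ D ×ˢ (univ : Set (Vec 2)), vel h z = ![dd e2 η (coord 0 1 z),
      z.1 1 * dd e2 (dd e1 η) (coord 0 1 z) + z.2 0 * dd e2 (dd e2 η) (coord 0 1 z) +
        dd e2 s (coord 0 1 z)] := by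
    intro z hz
    funext i
    fin_cases i
    · refine (hP0 hz).trans ?_
      simp [seesaw]
    · exact hP1 hz
  let q : Vec 2 × Vec 2 → ℝ × ℝ := fun z => (z.1 0, Q (z.1 0, z.2 0))
  let P : Vec 2 × Vec 2 → Vec 2 := fun z =>
    ![(z.2 1 - z.1 1 * dd e2 (dd e1 η) (q z) - dd e2 s (q z)) / dd e2 (dd e2 η) (q z), (q z).2]
  have hqm : ∀ z ∈ D ×ˢ (univ : Set (Vec 2)), q z ∈ I ×ˢ (univ : Set ℝ) := fun z hz =>
    ⟨hDI _ hz.1, trivial⟩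
  have hq : AnalyticOnNhd ℝ q (D ×ˢ univ) := by
    intro z hz
    have hQ := hη.anQ (coord 0 0 z) ⟨hDI _ hz.1, trivial⟩
    exact (analyticAt_fst_apply 0 z).prod (analyticAt_comp_coord hQ)
  have hcomp : ∀ {f : ℝ × ℝ → ℝ}, AnalyticOnNhd ℝ f (I ×ˢ univ) →
      AnalyticOnNhd ℝ (fun z => f (q z)) (D ×ˢ univ) := fun hf z hz =>
    AnalyticAt.comp (hf _ (hqm z hz)) (hq z hz)
  refine ⟨P, ?_, ?_, ?_, ?_⟩
  · intro z hz
    exact (analyticAt_seesaw (hηx _ (hm z hz)) (hηp _ (hm z hz)) (hs _ (hm z hz))).congr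
      (hh.symm.eventuallyEq_of_mem (hUo.mem_nhds hz))
  · intro z hz
    rw [analyticAt_pi_iff]
    intro i
    fin_cases i
    · exact (((analyticAt_snd_apply 1 z).sub ((analyticAt_fst_apply 1 z).mul
        (hcomp (analyticOnNhd_dd hηx e2) z hz))).sub (hcomp (analyticOnNhd_dd hs e2) z hz)).div
        (hcomp hηpp z hz) (hη.ddp_ne_zero (hqm z hz).1 _)
    · exact AnalyticAt.comp (g := Prod.snd) analyticAt_snd (hq z hz)
  · intro x hx p
    have h0 := hη.ddp_ne_zero (hDI x hx) (p 1)
    rw [hvel _ ⟨hx, trivial⟩]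
    simp only [P, q, coord_apply]
    funext i
    fin_cases i <;> simp [hη.left _ (hDI x hx)]
    field_simp
    ring
  · intro x hx v
    have h0 := hη.ddp_ne_zero (hDI x hx) (Q (x 0, v 0))
    rw [hvel _ ⟨hx, trivial⟩]
    simp only [P, q, coord_apply]
    funext i
    fin_cases i <;> simp [hη.right _ (hDI x hx)]
    field_simp
    ring

theorem velInd_seesaw (hD : IsOpen D) (hη : Good1 I η Q F) (hs : AnalyticOnNhd ℝ s (I ×ˢ univ))
    (hDI : ∀ x ∈ D, x 0 ∈ I) (hh : EqOn h (seesaw (dd e1 η) (dd e2 η) s) (D ×ˢ univ)) {g : ℝ → ℝ}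
    (hg : ∀ x ∈ I, ∀ p, seesawForce η s (x, p) = g x) : VelInd D h := by
  refine ⟨fun x => ![F (x 0), x 1 * deriv F (x 0) + g (x 0)], fun x hx p i => ?_⟩
  obtain ⟨h1, h2⟩ := frc_seesaw hD hη hs hDI hh (z := (x, p)) ⟨hx, trivial⟩
  fin_cases i
  · exact h1
  · refine h2.trans ?_
    simp [coord_apply, hg _ (hDI x hx)]

end SeesawHamiltonian

/-! ### The listed forms generate velocity-independent forces -/

section ListedForms

variable {D : Set (Vec 2)} {h : Vec 2 × Vec 2 → ℝ}

theorem dd_separable {α β : ℝ × ℝ → ℝ} {z : Vec 2 × Vec 2} (hα : AnalyticAt ℝ α (coord 0 0 z))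
    (hβ : AnalyticAt ℝ β (coord 1 1 z)) (e : Vec 2 × Vec 2) :
    dd e (fun z => α (coord 0 0 z) + β (coord 1 1 z)) z =
      dd (coord 0 0 e) α (coord 0 0 z) + dd (coord 1 1 e) β (coord 1 1 z) := by
  rw [dd_add (analyticAt_comp_coord hα) (analyticAt_comp_coord hβ), dd_comp_coord hα,
    dd_comp_coord hβ]

theorem reg_separable (hD : IsOpen D) {I₁ I₂ : Set ℝ} {α β Q₁ Q₂ : ℝ × ℝ → ℝ} {F₁ F₂ : ℝ → ℝ}
    (hα : Good1 I₁ α Q₁ F₁) (hβ : Good1 I₂ β Q₂ F₂) (hDI : ∀ x ∈ D, x 0 ∈ I₁ ∧ x 1 ∈ I₂)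
    (hh : EqOn h (fun z => α (coord 0 0 z) + β (coord 1 1 z)) (D ×ˢ univ)) :
    (∃ P, Reg D h P) ∧ VelInd D h := by
  have hUo := isOpen_phase hD
  have hα0 : ∀ z ∈ D ×ˢ (univ : Set (Vec 2)), AnalyticAt ℝ α (coord 0 0 z) := fun z hz =>
    hα.an _ ⟨(hDI _ hz.1).1, trivial⟩
  have hβ0 : ∀ z ∈ D ×ˢ (univ : Set (Vec 2)), AnalyticAt ℝ β (coord 1 1 z) := fun z hz =>
    hβ.an _ ⟨(hDI _ hz.1).2, trivial⟩
  have hd : ∀ e, EqOn (dd e h) (fun z => dd (coord 0 0 e) α (coord 0 0 z) +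
      dd (coord 1 1 e) β (coord 1 1 z)) (D ×ˢ univ) := fun e z hz => by
    rw [dd_congr_on hUo hh e hz, dd_separable (hα0 z hz) (hβ0 z hz)]
  have hX0 : coord 1 1 (eX 0) = 0 := coord_eX_of_ne (by decide)
  have hX1 : coord 0 0 (eX 1) = 0 := coord_eX_of_ne (by decide)
  have hP0 : coord 1 1 (eP 0) = 0 := coord_eP_of_ne (by decide)
  have hP1 : coord 0 0 (eP 1) = 0 := coord_eP_of_ne (by decide)
  have hvel : ∀ z ∈ D ×ˢ (univ : Set (Vec 2)),
      vel h z = ![dd e2 α (coord 0 0 z), dd e2 β (coord 1 1 z)] := by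
    intro z hz
    funext i
    fin_cases i <;> refine (hd _ hz).trans ?_
    · simp [hP0, coord_eP_self, dd_zero_dir]
    · simp [hP1, coord_eP_self, dd_zero_dir]
  have hdd : ∀ a, ∀ z ∈ D ×ˢ (univ : Set (Vec 2)), ∀ e, dd e (dd a h) z =
      dd (coord 0 0 e) (dd (coord 0 0 a) α) (coord 0 0 z) +
        dd (coord 1 1 e) (dd (coord 1 1 a) β) (coord 1 1 z) := fun a z hz e => by
    rw [dd_congr_on hUo (hd a) e hz,
      dd_separable (analyticAt_dd (hα0 z hz) _) (analyticAt_dd (hβ0 z hz) _)]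
  have hz0 : ∀ (e : ℝ × ℝ) (f : ℝ × ℝ → ℝ) (w : ℝ × ℝ), dd e (dd 0 f) w = 0 := fun e f w => by
    have : dd (0 : ℝ × ℝ) f = fun _ => 0 := funext fun w => dd_zero_dir f w
    rw [this, dd_const]
  refine ⟨⟨fun z => ![Q₁ (coord 0 0 z), Q₂ (coord 1 1 z)], ?_, ?_, ?_, ?_⟩,
    fun x => ![F₁ (x 0), F₂ (x 1)], ?_⟩
  · exact fun z hz => ((analyticAt_comp_coord (hα0 z hz)).add
      (analyticAt_comp_coord (hβ0 z hz))).congr (hh.symm.eventuallyEq_of_mem (hUo.mem_nhds hz))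
  · intro z hz
    rw [analyticAt_pi_iff]
    intro i
    fin_cases i
    · exact analyticAt_comp_coord (hα.anQ _ ⟨(hDI _ hz.1).1, trivial⟩)
    · exact analyticAt_comp_coord (hβ.anQ _ ⟨(hDI _ hz.1).2, trivial⟩)
  · intro x hx p
    rw [hvel _ ⟨hx, trivial⟩]
    funext i
    fin_cases i
    · exact hα.left _ (hDI x hx).1 _
    · exact hβ.left _ (hDI x hx).2 _
  · intro x hx v
    rw [hvel _ ⟨hx, trivial⟩]
    funext i
    fin_cases i
    · exact hα.right _ (hDI x hx).1 _
    · exact hβ.right _ (hDI x hx).2 _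
  · intro x hx p i
    have hz : ((x, p) : Vec 2 × Vec 2) ∈ D ×ˢ (univ : Set (Vec 2)) := ⟨hx, trivial⟩
    have f1 := hα.force_eq (z := coord 0 0 (x, p)) ⟨(hDI x hx).1, trivial⟩
    have f2 := hβ.force_eq (z := coord 1 1 (x, p)) ⟨(hDI x hx).2, trivial⟩
    simp only [frc, br, Fin.sum_univ_two]
    rw [hd _ hz, hd _ hz, hd _ hz, hd _ hz, hdd _ _ hz, hdd _ _ hz, hdd _ _ hz, hdd _ _ hz]
    fin_cases i
    · simp only [Fin.zero_eta, hX0, hX1, hP0, hP1, coord_eX_self, coord_eP_self, dd_zero_dir, hz0]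
      refine Eq.trans ?_ f1
      ring
    · simp only [Fin.mk_one, hX0, hX1, hP0, hP1, coord_eX_self, coord_eP_self, dd_zero_dir, hz0]
      refine Eq.trans ?_ f2
      ring

theorem reg_quadratic (hD : IsOpen D) {M : Matrix (Fin 2) (Fin 2) ℝ} (hM : M.IsSymm)
    (hdet : IsUnit M.det) {U : Vec 2 → ℝ} (hU : AnalyticOnNhd ℝ U D)
    (hh : EqOn h (fun z => (1 / 2) * ∑ i, ∑ j, M i j * z.2 i * z.2 j + U z.1) (D ×ˢ univ)) :
    (∃ P, Reg D h P) ∧ VelInd D h := by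
  have hUo := isOpen_phase hD
  have hs : M 1 0 = M 0 1 := hM.apply 0 1
  have hp := fun i z => analyticAt_snd_apply i z
  have hU' : ∀ z ∈ D ×ˢ (univ : Set (Vec 2)), AnalyticAt ℝ (fun z : Vec 2 × Vec 2 => U z.1) z :=
    fun z hz => AnalyticAt.comp (hU _ hz.1) analyticAt_fst
  have hUd : ∀ z ∈ D ×ˢ (univ : Set (Vec 2)), ∀ e,
      dd e (fun z : Vec 2 × Vec 2 => U z.1) z = dd e.1 U z.1 := fun z hz e =>
    dd_comp_clm (ContinuousLinearMap.fst ℝ (Vec 2) (Vec 2)) (hU _ hz.1) e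
  let q : Vec 2 × Vec 2 → ℝ := fun z =>
    (1 / 2 * M 0 0) * (z.2 0 * z.2 0) + M 0 1 * (z.2 0 * z.2 1) + (1 / 2 * M 1 1) * (z.2 1 * z.2 1)
  have hq : ∀ z, AnalyticAt ℝ q z := fun z =>
    ((analyticAt_const.mul ((hp 0 z).mul (hp 0 z))).add
      (analyticAt_const.mul ((hp 0 z).mul (hp 1 z)))).add
      (analyticAt_const.mul ((hp 1 z).mul (hp 1 z)))
  have hqd : ∀ z e, dd e q z = M 0 0 * (e.2 0 * z.2 0) + M 0 1 * (e.2 0 * z.2 1 + z.2 0 * e.2 1) +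
      M 1 1 * (e.2 1 * z.2 1) := by
    intro z e
    have h1 := fun i j => (hp i z).fun_mul (hp j z)
    have h2 := fun (c : ℝ) i j => (analyticAt_const (𝕜 := ℝ) (v := c)).fun_mul (h1 i j)
    change dd e (fun z => (1 / 2 * M 0 0) * (z.2 0 * z.2 0) + M 0 1 * (z.2 0 * z.2 1) +
      (1 / 2 * M 1 1) * (z.2 1 * z.2 1)) z = _
    rw [dd_add ((h2 _ 0 0).fun_add (h2 _ 0 1)) (h2 _ 1 1), dd_add (h2 _ 0 0) (h2 _ 0 1),
      dd_const_mul _ (h1 0 0), dd_const_mul _ (h1 0 1), dd_const_mul _ (h1 1 1),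
      dd_mul (hp 0 z) (hp 0 z), dd_mul (hp 0 z) (hp 1 z), dd_mul (hp 1 z) (hp 1 z)]
    simp only [dd_snd_apply]
    ring
  have hh' : EqOn h (fun z => q z + U z.1) (D ×ˢ univ) := by
    intro z hz
    rw [hh hz]
    simp only [Fin.sum_univ_two, q, hs]
    ring
  have hd : ∀ z ∈ D ×ˢ (univ : Set (Vec 2)), ∀ e, dd e h z = dd e q z + dd e.1 U z.1 :=
    fun z hz e => by rw [dd_congr_on hUo hh' e hz, dd_add (hq z) (hU' z hz), hUd z hz]
  have hdP : ∀ i, EqOn (dd (eP i) h) (fun z => M i 0 * z.2 0 + M i 1 * z.2 1) (D ×ˢ univ) := by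
    intro i z hz
    rw [hd z hz, hqd]
    fin_cases i
    · simp [eP, dd_zero_dir]
    · simp [eP, dd_zero_dir, hs]
  have hdX : ∀ i, EqOn (dd (eX i) h) (fun z => dd (Pi.single i 1) U z.1) (D ×ˢ univ) := by
    intro i z hz
    rw [hd z hz, hqd]
    simp [eX]
  have hvel : ∀ z ∈ D ×ˢ (univ : Set (Vec 2)), vel h z = M *ᵥ z.2 := by
    intro z hz
    funext i
    refine (hdP i hz).trans ?_
    simp [Matrix.mulVec, dotProduct, Fin.sum_univ_two]
  have hdd : ∀ i e, ∀ z ∈ D ×ˢ (univ : Set (Vec 2)),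
      dd e (dd (eP i) h) z = M i 0 * e.2 0 + M i 1 * e.2 1 := by
    intro i e z hz
    rw [dd_congr_on hUo (hdP i) e hz, dd_add (analyticAt_const.fun_mul (hp 0 z))
      (analyticAt_const.fun_mul (hp 1 z)), dd_const_mul _ (hp 0 z), dd_const_mul _ (hp 1 z),
      dd_snd_apply, dd_snd_apply]
  refine ⟨⟨fun z => M⁻¹ *ᵥ z.2, ?_, ?_, ?_, ?_⟩,
    fun x i => -(M i 0 * dd (Pi.single 0 1) U x + M i 1 * dd (Pi.single 1 1) U x), ?_⟩
  · exact fun z hz => ((hq z).add (hU' z hz)).congr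
      (hh'.symm.eventuallyEq_of_mem (hUo.mem_nhds hz))
  · intro z hz
    exact ((LinearMap.toContinuousLinearMap (Matrix.mulVecLin M⁻¹)).comp
      (ContinuousLinearMap.snd ℝ (Vec 2) (Vec 2))).analyticAt z
  · intro x hx p
    rw [hvel _ ⟨hx, trivial⟩, Matrix.mulVec_mulVec, Matrix.nonsing_inv_mul _ hdet,
      Matrix.one_mulVec]
  · intro x hx v
    rw [hvel _ ⟨hx, trivial⟩, Matrix.mulVec_mulVec, Matrix.mul_nonsing_inv _ hdet,
      Matrix.one_mulVec]
  · intro x hx p i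
    have hz : ((x, p) : Vec 2 × Vec 2) ∈ D ×ˢ (univ : Set (Vec 2)) := ⟨hx, trivial⟩
    simp only [frc, br, Fin.sum_univ_two, hdd _ _ _ hz]
    rw [hdX 0 hz, hdX 1 hz]
    simp [eX, eP]
    ring

/-- The one-dimensional Hamiltonian with velocity `r(p)` and no force. -/
theorem exists_good1_of_bijective {I : Set ℝ} (hI : IsOpen I) (hIc : IsConnected I) {r : ℝ → ℝ}
    (hr : AnalyticOnNhd ℝ r univ) (hb : Function.Bijective r) (hd : ∀ q, deriv r q ≠ 0) :
    ∃ η Q : ℝ × ℝ → ℝ, Good1 I η Q (fun _ => 0) ∧ (∀ x ∈ I, ∀ p, dd e2 η (x, p) = r p) ∧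
      ∀ z ∈ I ×ˢ (univ : Set ℝ), dd e1 η z = 0 := by
  have hra : AnalyticOnNhd ℝ (fun z : ℝ × ℝ => r z.2) (I ×ˢ univ) := fun z _ =>
    analyticAt_comp_snd (hr _ trivial)
  obtain ⟨η, hη, hηd⟩ := exists_potential hI hIc (a := fun _ => 0) (b := fun z => r z.2)
    (fun _ _ => analyticAt_const) hra (fun z _ => by
      rw [dd_const, dd_comp_snd (hr _ trivial)]
      simp [e1])
  let ρ := (Equiv.ofBijective r hb).symm
  have h1 : ∀ p, ρ (r p) = p := (Equiv.ofBijective r hb).symm_apply_apply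
  have h2 : ∀ v, r (ρ v) = v := (Equiv.ofBijective r hb).apply_symm_apply
  have hρ : ∀ v, AnalyticAt ℝ ρ v := by
    intro v
    have h3 : AnalyticAt ℝ (ρ ∘ r) (ρ v) := by
      have : ρ ∘ r = id := funext h1
      rw [this]
      exact analyticAt_id
    rw [← h2 v]
    exact (analyticAt_comp_iff_of_deriv_ne_zero (hr _ trivial) (hd _)).1 h3
  have hS : IsOpen (I ×ˢ (univ : Set ℝ)) := hI.prod isOpen_univ
  have hx0 : ∀ z ∈ I ×ˢ (univ : Set ℝ), dd e1 η z = 0 := fun z hz => (hηd z hz).1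
  refine ⟨η, fun z => ρ z.2, ⟨hI, hIc, hη, fun z _ => analyticAt_comp_snd (hρ _), ?_, ?_, ?_⟩,
    fun x hx p => (hηd (x, p) ⟨hx, trivial⟩).2, hx0⟩
  · intro x hx p
    rw [(hηd (x, p) ⟨hx, trivial⟩).2]
    exact h1 p
  · intro x hx v
    rw [(hηd (x, _) ⟨hx, trivial⟩).2]
    exact h2 v
  · intro x hx p
    have hz : (x, p) ∈ I ×ˢ (univ : Set ℝ) := ⟨hx, trivial⟩
    have h4 : dd e1 (dd e2 η) (x, p) = 0 := by
      rw [dd_comm (hη _ hz)]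
      exact dd_eq_zero_of_eqOn_const hS hx0 e2 _ hz
    simp [br1, h4, hx0 _ hz]

theorem IsListedForm.regular {H : PhaseFun 2} (hD : IsOpen D) (hH : IsListedForm D H) :
    IsRegular D H ∧ VelocityIndependent D H := by
  suffices (∃ P, Reg D (unc H) P) ∧ VelInd D (unc H) from
    ⟨isRegular_iff.2 this.1, (velocityIndependent_iff this.1.choose_spec.an).2 this.2⟩
  rcases hH with ⟨M, U, hM, hdet, hU, hH⟩ | ⟨I₁, I₂, H₁, H₂, hH₁, hH₂, hDI, hH⟩ |
    ⟨I, η, G, u, w, hη, -, hG, hu, hw, hwu, hDI, hH⟩ |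
    ⟨I, r, c, d, u, R, w, hI, hIc, hr, hrb, hrd, hc, hd, hu, hR, hw, hwR, hDI, hH⟩
  · exact reg_quadratic hD hM hdet hU fun z hz => hH z.1 hz.1 z.2
  · obtain ⟨Q₁, F₁, h1⟩ := isGood1D_iff.1 hH₁
    obtain ⟨Q₂, F₂, h2⟩ := isGood1D_iff.1 hH₂
    exact reg_separable hD h1 h2 hDI fun z hz => hH z.1 hz.1 z.2
  · obtain ⟨Q, F, h1⟩ := isGood1D_iff.1 hη
    have hrange : (fun w : ℝ × ℝ => η w.1 w.2) '' (I ×ˢ univ) ⊆ {e | ∃ s ∈ I, ∃ q, e = η s q} := by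
      rintro _ ⟨z, hz, rfl⟩
      exact ⟨z.1, hz.1, z.2, rfl⟩
    have hm : ∀ {x}, x ∈ I → ∀ p : ℝ, (x, p) ∈ I ×ˢ (univ : Set ℝ) := fun hx p => ⟨hx, trivial⟩
    obtain ⟨s, hs, hse, g, hg⟩ := h1.seesawForce_typeA (hG.mono hrange) hu
      (w := fun z => w z.1 z.2) hw (fun x hx hux p => by
        rw [dd_e1_eq_deriv (h1.an _ (hm hx p))]
        exact hwu x hx hux p)
    have hh : EqOn (unc H) (seesaw (dd e1 fun w : ℝ × ℝ => η w.1 w.2)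
        (dd e2 fun w : ℝ × ℝ => η w.1 w.2) s) (D ×ˢ univ) := by
      intro z hz
      have hx := hDI z.1 hz.1
      have := hse _ hx (z.2 1)
      simp only [seesaw, coord_apply, unc]
      rw [hH z.1 hz.1 z.2, this, dd_e1_eq_deriv (h1.an _ (hm hx _)),
        dd_e2_eq_deriv (h1.an _ (hm hx _))]
      ring
    exact ⟨reg_seesaw hD h1 hs hDI hh, velInd_seesaw hD h1 hs hDI hh hg⟩
  · obtain ⟨η, Q, h1, hη2, hη1⟩ := exists_good1_of_bijective hI hIc hr hrb hrd
    obtain ⟨s, hs, hse, g, hg⟩ := h1.seesawForce_typeB hη2 hη1 hr hc hd hu hR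
      (w := fun z => w z.1 z.2) hw hwR
    have hh : EqOn (unc H) (seesaw (dd e1 η) (dd e2 η) s) (D ×ˢ univ) := by
      intro z hz
      have hx := hDI z.1 hz.1
      simp only [seesaw, coord_apply, unc]
      rw [hH z.1 hz.1 z.2, hse _ hx, hη2 _ hx, hη1 (z.1 0, z.2 1) ⟨hx, trivial⟩]
      ring
    exact ⟨reg_seesaw hD h1 hs hDI hh, velInd_seesaw hD h1 hs hDI hh hg⟩

end ListedForms

/-! ### Identities for Hamiltonians with velocity-independent force -/

/-- The matrix `∂v/∂p` of second derivatives in the momenta. -/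
noncomputable def hess {n : ℕ} (h : Vec n × Vec n → ℝ) (i j : Fin n) : Vec n × Vec n → ℝ :=
  dd (eP j) (dd (eP i) h)

/-- The Jacobian `∂F/∂x` of the force. -/
noncomputable def forceJac {n : ℕ} (h : Vec n × Vec n → ℝ) (i j : Fin n) : Vec n × Vec n → ℝ :=
  dd (eX j) (frc h i)

section Identities

variable {n : ℕ} {D : Set (Vec n)} {h : Vec n × Vec n → ℝ}

theorem analyticAt_hess {z : Vec n × Vec n} (hh : AnalyticAt ℝ h z) (i j : Fin n) :
    AnalyticAt ℝ (hess h i j) z := analyticAt_dd (analyticAt_dd hh _) _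

theorem analyticAt_forceJac {z : Vec n × Vec n} (hh : AnalyticAt ℝ h z) (i j : Fin n) :
    AnalyticAt ℝ (forceJac h i j) z := analyticAt_dd (analyticAt_frc hh _) _

theorem hess_symm {z : Vec n × Vec n} (hh : AnalyticAt ℝ h z) (i j : Fin n) :
    hess h i j z = hess h j i z := dd_comm hh _ _

theorem dd_eP_eq_zero_of_position {f : Vec n × Vec n → ℝ} {g : Vec n → ℝ}
    (hf : AnalyticOnNhd ℝ f (D ×ˢ univ)) (hg : ∀ x ∈ D, ∀ p, f (x, p) = g x) (j : Fin n) :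
    ∀ z ∈ D ×ˢ (univ : Set (Vec n)), dd (eP j) f z = 0 := by
  rintro ⟨x, p⟩ ⟨hx, -⟩
  have h1 := hasDerivAt_line (f := f) (z := (x, p)) (e := eP j) (t := 0)
    (by simpa using hf _ ⟨hx, trivial⟩)
  have h2 : (fun s : ℝ => f ((x, p) + s • eP j)) = fun _ => g x := by
    funext s
    rw [← hg x hx (p + s • Pi.single j 1)]
    congr 1
    ext <;> simp [eP]
  rw [h2] at h1
  simpa using h1.unique (hasDerivAt_const _ _)

theorem VelInd.dd_frc (hv : VelInd D h) (hh : AnalyticOnNhd ℝ h (D ×ˢ univ)) (i j : Fin n) :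
    ∀ z ∈ D ×ˢ (univ : Set (Vec n)), dd (eP j) (frc h i) z = 0 := by
  obtain ⟨F, hF⟩ := hv
  exact dd_eP_eq_zero_of_position (fun z hz => analyticAt_frc (hh z hz) i)
    (g := fun x => F x i) (fun x hx p => hF x hx p i) j

theorem br_antisymm (f g : Vec n × Vec n → ℝ) (z : Vec n × Vec n) : br f g z = -br g f z := by
  simp only [br, ← Finset.sum_neg_distrib]
  exact Finset.sum_congr rfl fun _ _ => by ring

/-- The momentum derivatives of the force split into a symmetric and an antisymmetric part, which
therefore vanish separately. -/
theorem VelInd.br_eq_zero (hv : VelInd D h) (hh : AnalyticOnNhd ℝ h (D ×ˢ univ)) (i j : Fin n)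
    {z : Vec n × Vec n} (hz : z ∈ D ×ˢ (univ : Set (Vec n))) :
    br (hess h i j) h z = 0 ∧ br (dd (eP i) h) (dd (eP j) h) z = 0 := by
  have key := fun i j => (hv.dd_frc hh i j z hz).symm.trans
    (dd_br (analyticAt_dd (hh z hz) _) (hh z hz) (eP j))
  have h1 := key i j
  have h2 := key j i
  have h3 : br (dd (eP i) (dd (eP j) h)) h z = br (dd (eP j) (dd (eP i) h)) h z :=
    br_congr ((hh z hz).eventually_analyticAt.mono fun y hy => dd_comm hy _ _) .rfl
  rw [h3, br_antisymm (dd (eP j) h)] at h2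
  constructor
  · simp only [hess]
    linarith
  · linarith

end Identities

section TwoDim

variable {D : Set (Vec 2)} {h : Vec 2 × Vec 2 → ℝ} {P : Vec 2 × Vec 2 → Vec 2}

theorem dir_eq_sum (e : Vec 2 × Vec 2) :
    e = e.1 0 • eX 0 + e.1 1 • eX 1 + e.2 0 • eP 0 + e.2 1 • eP 1 := by
  ext i <;> fin_cases i <;> simp [eX, eP]

theorem dd_eq_sum (e : Vec 2 × Vec 2) (f : Vec 2 × Vec 2 → ℝ) (z : Vec 2 × Vec 2) :
    dd e f z = e.1 0 * dd (eX 0) f z + e.1 1 * dd (eX 1) f z + e.2 0 * dd (eP 0) f z +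
      e.2 1 * dd (eP 1) f z := by
  conv_lhs => rw [dir_eq_sum e]
  simp only [dd_add_dir, dd_smul_dir]

theorem br_two (f g : Vec 2 × Vec 2 → ℝ) (z : Vec 2 × Vec 2) : br f g z =
    (dd (eX 0) f z * dd (eP 0) g z - dd (eX 0) g z * dd (eP 0) f z) +
    (dd (eX 1) f z * dd (eP 1) g z - dd (eX 1) g z * dd (eP 1) f z) := by
  simp only [br, Fin.sum_univ_two]

theorem jacobi {f g k : Vec 2 × Vec 2 → ℝ} {z : Vec 2 × Vec 2} (hf : AnalyticAt ℝ f z)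
    (hg : AnalyticAt ℝ g z) (hk : AnalyticAt ℝ k z) :
    br (br f g) k z = br f (br g k) z + br (br f k) g z := by
  rw [br_two (br f g), br_two f (br g k), br_two (br f k)]
  simp only [dd_br hf hg, dd_br hg hk, dd_br hf hk]
  simp only [br_two]
  have c : ∀ {l : Vec 2 × Vec 2 → ℝ}, AnalyticAt ℝ l z →
      dd (eX 1) (dd (eX 0) l) z = dd (eX 0) (dd (eX 1) l) z ∧
      dd (eP 1) (dd (eP 0) l) z = dd (eP 0) (dd (eP 1) l) z ∧
      ∀ i j, dd (eP i) (dd (eX j) l) z = dd (eX j) (dd (eP i) l) z := fun hl =>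
    ⟨dd_comm hl _ _, dd_comm hl _ _, fun _ _ => dd_comm hl _ _⟩
  simp only [(c hf).1, (c hf).2.1, (c hf).2.2, (c hg).1, (c hg).2.1, (c hg).2.2, (c hk).1,
    (c hk).2.1, (c hk).2.2]
  ring

/-- The Helmholtz-type condition: the product of the Jacobian of the force and `∂v/∂p` is
symmetric. This is the Jacobi identity for the commuting velocities and the Hamiltonian. -/
theorem VelInd.forceJac_hess (hv : VelInd D h) (hD : IsOpen D)
    (hh : AnalyticOnNhd ℝ h (D ×ˢ univ)) {z : Vec 2 × Vec 2}
    (hz : z ∈ D ×ˢ (univ : Set (Vec 2))) :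
    -forceJac h 1 0 z * hess h 0 0 z + (forceJac h 0 0 z - forceJac h 1 1 z) * hess h 0 1 z +
      forceJac h 0 1 z * hess h 1 1 z = 0 := by
  have h1 := jacobi (analyticAt_dd (hh z hz) (eP 0)) (analyticAt_dd (hh z hz) (eP 1)) (hh z hz)
  have h2 : br (br (dd (eP 0) h) (dd (eP 1) h)) h z = 0 := by
    have hc : br (dd (eP 0) h) (dd (eP 1) h) =ᶠ[𝓝 z] fun _ => 0 := by
      filter_upwards [(isOpen_phase hD).mem_nhds hz] with y hy using (hv.br_eq_zero hh 0 1 hy).2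
    rw [br_congr hc .rfl]
    simp [br, dd_const]
  change _ = br _ (frc h 1) z + br (frc h 0) _ z at h1
  rw [h2, br_two, br_two] at h1
  simp only [hv.dd_frc hh _ _ z hz] at h1
  have := hess_symm (hh z hz) 0 1
  simp only [forceJac, hess] at this ⊢
  linear_combination (-1 : ℝ) * h1 + dd (eX 0) (frc h 0) z * this

/-- The inverse of the map from momenta to velocities is differentiable, so that `∂v/∂p` has no
kernel. -/
theorem Reg.eq_zero_of_hess (hr : Reg D h P) {z : Vec 2 × Vec 2}
    (hz : z ∈ D ×ˢ (univ : Set (Vec 2))) {q : Vec 2}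
    (hq : ∀ i, q 0 * hess h i 0 z + q 1 * hess h i 1 z = 0) : q = 0 := by
  obtain ⟨x, p⟩ := z
  have hvd : ∀ i, HasDerivAt (fun t : ℝ => dd (eP i) h ((x, p) + t • ((0, q) : Vec 2 × Vec 2))) 0 0 := by
    intro i
    refine (hasDerivAt_line (by simpa using analyticAt_dd (hr.an _ hz) _)).congr_deriv ?_
    rw [dd_eq_sum]
    simpa [hess] using hq i
  have hvel : HasDerivAt (fun t : ℝ => (x, vel h ((x, p) + t • ((0, q) : Vec 2 × Vec 2))))
      ((0, 0) : Vec 2 × Vec 2) 0 :=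
    (hasDerivAt_const _ _).prodMk (hasDerivAt_pi.2 hvd)
  have hP := hr.anP (x, vel h (x, p)) ⟨hz.1, trivial⟩
  have h1 := HasFDerivAt.comp_hasDerivAt_of_eq (0 : ℝ) hP.differentiableAt.hasFDerivAt hvel
    (by simp)
  have h2 : (P ∘ fun t : ℝ => (x, vel h ((x, p) + t • ((0, q) : Vec 2 × Vec 2)))) =
      fun t : ℝ => p + t • q := by
    funext t
    have := hr.left x hz.1 (p + t • q)
    simpa using this
  rw [h2] at h1
  have h3 : HasDerivAt (fun t : ℝ => p + t • q) q 0 := by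
    simpa using ((hasDerivAt_id (0 : ℝ)).smul_const q).const_add p
  exact (h3.unique h1).trans (map_zero _)

theorem Reg.det_ne_zero (hr : Reg D h P) {z : Vec 2 × Vec 2}
    (hz : z ∈ D ×ˢ (univ : Set (Vec 2))) :
    hess h 0 0 z * hess h 1 1 z - hess h 0 1 z ^ 2 ≠ 0 := by
  intro h0
  have hs := hess_symm (hr.an z hz) 1 0
  have k1 := hr.eq_zero_of_hess hz (q := ![hess h 1 1 z, -hess h 0 1 z]) (by
    intro i
    fin_cases i <;> simp <;> [linear_combination h0; (rw [hs]; ring)])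
  have k2 := hr.eq_zero_of_hess hz (q := ![-hess h 0 1 z, hess h 0 0 z]) (by
    intro i
    fin_cases i <;> simp <;> [ring; (rw [hs]; linear_combination h0)])
  have a1 : hess h 1 1 z = 0 := by simpa using congrFun k1 0
  have a2 : hess h 0 1 z = 0 := by simpa using congrFun k1 1
  have a3 : hess h 0 0 z = 0 := by simpa using congrFun k2 1
  have := hr.eq_zero_of_hess hz (q := ![1, 0]) (by
    intro i
    fin_cases i <;> simp <;> [exact a3; rw [hs, a2]])
  simpa using congrFun this 0

/-- A function all of whose partial derivatives vanish is constant. -/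
theorem const_of_dd_eq_zero (hD : IsOpen D) (hDc : IsConnected D) {f : Vec 2 × Vec 2 → ℝ}
    (hf : AnalyticOnNhd ℝ f (D ×ˢ univ))
    (hX : ∀ i, ∀ z ∈ D ×ˢ (univ : Set (Vec 2)), dd (eX i) f z = 0)
    (hP : ∀ i, ∀ z ∈ D ×ˢ (univ : Set (Vec 2)), dd (eP i) f z = 0) :
    ∀ z ∈ D ×ˢ (univ : Set (Vec 2)), ∀ y ∈ D ×ˢ (univ : Set (Vec 2)), f z = f y := by
  intro z hz y hy
  refine (isOpen_phase hD).is_const_of_fderiv_eq_zero (isPreconnected_phase hDc)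
    (fun w hw => (hf w hw).differentiableAt.differentiableWithinAt) (fun w hw => ?_) hz hy
  refine ContinuousLinearMap.ext fun e => ?_
  change dd e f w = 0
  rw [dd_eq_sum, hX _ w hw, hX _ w hw, hP _ w hw, hP _ w hw]
  ring

theorem eq_of_dd_eP_eq_zero {f : Vec 2 × Vec 2 → ℝ} (hf : AnalyticOnNhd ℝ f (D ×ˢ univ))
    (hP : ∀ i, ∀ z ∈ D ×ˢ (univ : Set (Vec 2)), dd (eP i) f z = 0) {x : Vec 2} (hx : x ∈ D)
    (p : Vec 2) : f (x, p) = f (x, 0) := by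
  have hl : ∀ t : ℝ, ((x, 0) + t • ((0, p) : Vec 2 × Vec 2)) ∈ D ×ˢ (univ : Set (Vec 2)) :=
    fun t => ⟨by simpa using hx, trivial⟩
  have := eq_of_dd_eq_zero (f := f) (z := (x, 0)) (e := (0, p)) (fun t => hf _ (hl t)) (fun t => by
    rw [dd_eq_sum, hP _ _ (hl t), hP _ _ (hl t)]
    simp) 1
  simpa using this

/-- The standing assumptions, with the velocity normalised to vanish at zero momentum. -/
structure NormalHam (D : Set (Vec 2)) (h : Vec 2 × Vec 2 → ℝ) (P : Vec 2 × Vec 2 → Vec 2) : Prop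
    extends Reg D h P where
  isOpen : IsOpen D
  conn : IsConnected D
  velInd : VelInd D h
  normal : ∀ x ∈ D, ∀ i, dd (eP i) h (x, 0) = 0
  aniso : ¬ ∃ (a : ℝ) (b : Vec 2), ∀ x ∈ D, ∀ p i, frc h i (x, p) = a * x i + b i

end TwoDim

/-! ### The alternative for the Jacobian of the force -/

/-- The independent entries of `∂v/∂p`. -/
noncomputable def hessVec (h : Vec 2 × Vec 2 → ℝ) : Fin 3 → Vec 2 × Vec 2 → ℝ :=
  ![hess h 0 0, hess h 0 1, hess h 1 1]

/-- The entries of the traceless part of the Jacobian of the force, arranged so as to be orthogonal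
to `hessVec`. -/
noncomputable def jacVec (h : Vec 2 × Vec 2 → ℝ) : Fin 3 → Vec 2 × Vec 2 → ℝ :=
  ![fun z => -forceJac h 1 0 z, fun z => forceJac h 0 0 z - forceJac h 1 1 z, forceJac h 0 1]

/-- The derivative of `jacVec` along the motion. -/
noncomputable def jacVecDot (h : Vec 2 × Vec 2 → ℝ) (i : Fin 3) (z : Vec 2 × Vec 2) : ℝ :=
  dd (eX 0) (jacVec h i) z * dd (eP 0) h z + dd (eX 1) (jacVec h i) z * dd (eP 1) h z

section Algebra

open Matrix

theorem crossProduct_mul_eq {a b w : Fin 3 → ℝ} (ha : a 0 * w 0 + a 1 * w 1 + a 2 * w 2 = 0)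
    (hb : b 0 * w 0 + b 1 * w 1 + b 2 * w 2 = 0) (i j : Fin 3) :
    (a ⨯₃ b) i * w j = (a ⨯₃ b) j * w i := by
  rw [cross_apply]
  fin_cases i <;> fin_cases j <;> simp
  · linear_combination b 2 * ha - a 2 * hb
  · linear_combination a 1 * hb - b 1 * ha
  · linear_combination a 2 * hb - b 2 * ha
  · linear_combination b 0 * ha - a 0 * hb
  · linear_combination b 1 * ha - a 1 * hb
  · linear_combination a 0 * hb - b 0 * ha

/-- Two vectors of space orthogonal to two others: one of the pairs is dependent. -/
theorem crossProduct_mul_eq_zero {a b w u : Fin 3 → ℝ}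
    (haw : a 0 * w 0 + a 1 * w 1 + a 2 * w 2 = 0) (hbw : b 0 * w 0 + b 1 * w 1 + b 2 * w 2 = 0)
    (hau : a 0 * u 0 + a 1 * u 1 + a 2 * u 2 = 0) (hbu : b 0 * u 0 + b 1 * u 1 + b 2 * u 2 = 0)
    (i k l : Fin 3) : (a ⨯₃ b) i * (w k * u l - w l * u k) = 0 := by
  have h1 := crossProduct_mul_eq haw hbw
  have h2 := crossProduct_mul_eq hau hbu
  linear_combination u l * h1 i k + w i * h2 k l - u k * h1 i l

end Algebra

section Alternative

variable {D : Set (Vec 2)} {h : Vec 2 × Vec 2 → ℝ} {P : Vec 2 × Vec 2 → Vec 2}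

theorem analyticAt_hessVec {z : Vec 2 × Vec 2} (hh : AnalyticAt ℝ h z) (i : Fin 3) :
    AnalyticAt ℝ (hessVec h i) z := by
  fin_cases i <;> exact analyticAt_hess hh _ _

theorem analyticAt_jacVec {z : Vec 2 × Vec 2} (hh : AnalyticAt ℝ h z) (i : Fin 3) :
    AnalyticAt ℝ (jacVec h i) z := by
  fin_cases i
  · exact (analyticAt_forceJac hh _ _).neg
  · exact (analyticAt_forceJac hh _ _).sub (analyticAt_forceJac hh _ _)
  · exact analyticAt_forceJac hh _ _

theorem analyticAt_jacVecDot {z : Vec 2 × Vec 2} (hh : AnalyticAt ℝ h z) (i : Fin 3) :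
    AnalyticAt ℝ (jacVecDot h i) z :=
  ((analyticAt_dd (analyticAt_jacVec hh i) _).mul (analyticAt_dd hh _)).add
    ((analyticAt_dd (analyticAt_jacVec hh i) _).mul (analyticAt_dd hh _))

theorem analyticAt_zero_momentum {f : Vec 2 × Vec 2 → ℝ} {z : Vec 2 × Vec 2}
    (hf : AnalyticAt ℝ f (z.1, 0)) : AnalyticAt ℝ (fun y : Vec 2 × Vec 2 => f (y.1, 0)) z :=
  AnalyticAt.comp (f := fun y : Vec 2 × Vec 2 => ((y.1, 0) : Vec 2 × Vec 2)) hf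
    (analyticAt_fst.prod analyticAt_const)

theorem VelInd.dd_forceJac (hv : VelInd D h) (hD : IsOpen D) (hh : AnalyticOnNhd ℝ h (D ×ˢ univ))
    (i j k : Fin 2) : ∀ z ∈ D ×ˢ (univ : Set (Vec 2)), dd (eP k) (forceJac h i j) z = 0 := by
  intro z hz
  rw [forceJac, dd_comm (analyticAt_frc (hh z hz) i)]
  exact dd_eq_zero_of_eqOn_const (isOpen_phase hD) (hv.dd_frc hh i k) _ z hz

theorem VelInd.dd_jacVec (hv : VelInd D h) (hD : IsOpen D) (hh : AnalyticOnNhd ℝ h (D ×ˢ univ))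
    (i : Fin 3) (k : Fin 2) : ∀ z ∈ D ×ˢ (univ : Set (Vec 2)), dd (eP k) (jacVec h i) z = 0 := by
  intro z hz
  have a := fun i j => analyticAt_forceJac (hh z hz) i j
  have b := fun i j => hv.dd_forceJac hD hh i j k z hz
  fin_cases i
  · change dd (eP k) (fun z => -forceJac h 1 0 z) z = 0
    rw [dd_neg, b, neg_zero]
  · change dd (eP k) (fun z => forceJac h 0 0 z - forceJac h 1 1 z) z = 0
    rw [dd_sub (a _ _) (a _ _), b, b, sub_zero]
  · exact b _ _

theorem dd_dot {a w : Fin 3 → Vec 2 × Vec 2 → ℝ} {z : Vec 2 × Vec 2}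
    (ha : ∀ i, AnalyticAt ℝ (a i) z) (hw : ∀ i, AnalyticAt ℝ (w i) z) (e : Vec 2 × Vec 2) :
    dd e (fun y => a 0 y * w 0 y + a 1 y * w 1 y + a 2 y * w 2 y) z =
      (dd e (a 0) z * w 0 z + a 0 z * dd e (w 0) z) +
      (dd e (a 1) z * w 1 z + a 1 z * dd e (w 1) z) +
      (dd e (a 2) z * w 2 z + a 2 z * dd e (w 2) z) := by
  rw [dd_add (((ha 0).fun_mul (hw 0)).fun_add ((ha 1).fun_mul (hw 1))) ((ha 2).fun_mul (hw 2)),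
    dd_add ((ha 0).fun_mul (hw 0)) ((ha 1).fun_mul (hw 1)), dd_mul (ha 0) (hw 0),
    dd_mul (ha 1) (hw 1), dd_mul (ha 2) (hw 2)]

theorem VelInd.hessVec_jacVec (hv : VelInd D h) (hD : IsOpen D)
    (hh : AnalyticOnNhd ℝ h (D ×ˢ univ)) : ∀ z ∈ D ×ˢ (univ : Set (Vec 2)),
    hessVec h 0 z * jacVec h 0 z + hessVec h 1 z * jacVec h 1 z + hessVec h 2 z * jacVec h 2 z =
      0 := by
  intro z hz
  have := hv.forceJac_hess hD hh hz
  simp only [hessVec, jacVec, Matrix.cons_val]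
  linear_combination this

/-- Differentiation of the orthogonality of `hessVec` and `jacVec` along the motion, which preserves
`hessVec`. -/
theorem VelInd.hessVec_jacVecDot (hv : VelInd D h) (hD : IsOpen D)
    (hh : AnalyticOnNhd ℝ h (D ×ˢ univ)) : ∀ z ∈ D ×ˢ (univ : Set (Vec 2)),
    hessVec h 0 z * jacVecDot h 0 z + hessVec h 1 z * jacVecDot h 1 z +
      hessVec h 2 z * jacVecDot h 2 z = 0 := by
  intro z hz
  have key : ∀ e, _ = (0 : ℝ) := fun e => (dd_dot (fun i => analyticAt_hessVec (hh z hz) i)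
    (fun i => analyticAt_jacVec (hh z hz) i) e).symm.trans
    (dd_eq_zero_of_eqOn_const (isOpen_phase hD) (hv.hessVec_jacVec hD hh) e z hz)
  have hA : ∀ i, br (hessVec h i) h z = 0 := by
    intro i
    fin_cases i <;> exact (hv.br_eq_zero hh _ _ hz).1
  simp only [br_two] at hA
  have kX := fun k => key (eX k)
  have kP := fun k => key (eP k)
  simp only [hv.dd_jacVec hD hh _ _ z hz] at kP
  simp only [jacVecDot]
  linear_combination dd (eP 0) h z * kX 0 + dd (eP 1) h z * kX 1 -
    dd (eX 0) h z * kP 0 - dd (eX 1) h z * kP 1 - jacVec h 0 z * hA 0 - jacVec h 1 z * hA 1 -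
    jacVec h 2 z * hA 2

theorem NormalHam.jacVec_eq (H : NormalHam D h P) (i : Fin 3) {x : Vec 2} (hx : x ∈ D) (p : Vec 2) :
    jacVec h i (x, p) = jacVec h i (x, 0) :=
  eq_of_dd_eP_eq_zero (fun z hz => analyticAt_jacVec (H.an z hz) i)
    (fun k => H.velInd.dd_jacVec H.isOpen H.an i k) hx p

theorem NormalHam.dd_jacVec_eq (H : NormalHam D h P) (i : Fin 3) (k : Fin 2) {x : Vec 2}
    (hx : x ∈ D) (p : Vec 2) : dd (eX k) (jacVec h i) (x, p) = dd (eX k) (jacVec h i) (x, 0) := by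
  refine eq_of_dd_eP_eq_zero (fun z hz => analyticAt_dd (analyticAt_jacVec (H.an z hz) i) _)
    (fun l z hz => ?_) hx p
  rw [dd_comm (analyticAt_jacVec (H.an z hz) i)]
  exact dd_eq_zero_of_eqOn_const (isOpen_phase H.isOpen)
    (H.velInd.dd_jacVec H.isOpen H.an i l) _ z hz

/-- At zero momentum the velocity vanishes, so that the first order of the derivative of the
orthogonality along the motion yields the orthogonality of `hessVec` to each partial derivative of
`jacVec`. -/
theorem NormalHam.hessVec_dd_jacVec (H : NormalHam D h P) {x : Vec 2} (hx : x ∈ D) (k : Fin 2) :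
    hessVec h 0 (x, 0) * dd (eX k) (jacVec h 0) (x, 0) +
      hessVec h 1 (x, 0) * dd (eX k) (jacVec h 1) (x, 0) +
      hessVec h 2 (x, 0) * dd (eX k) (jacVec h 2) (x, 0) = 0 := by
  have hz : (x, (0 : Vec 2)) ∈ D ×ˢ (univ : Set (Vec 2)) := ⟨hx, trivial⟩
  have hh := H.an _ hz
  have hD := H.isOpen
  have hw := fun i => analyticAt_jacVec hh i
  have hv0 := H.normal x hx
  have hwt0 : ∀ i, jacVecDot h i (x, 0) = 0 := fun i => by simp [jacVecDot, hv0]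
  have hwt : ∀ i j, dd (eP j) (jacVecDot h i) (x, 0) =
      dd (eX 0) (jacVec h i) (x, 0) * hess h 0 j (x, 0) +
        dd (eX 1) (jacVec h i) (x, 0) * hess h 1 j (x, 0) := by
    intro i j
    have c := fun k => analyticAt_dd (hw i) (eX k)
    have v := fun k => analyticAt_dd hh (eP k)
    change dd (eP j) (fun z => dd (eX 0) (jacVec h i) z * dd (eP 0) h z +
      dd (eX 1) (jacVec h i) z * dd (eP 1) h z) (x, 0) = _
    rw [dd_add ((c 0).fun_mul (v 0)) ((c 1).fun_mul (v 1)), dd_mul (c 0) (v 0), dd_mul (c 1) (v 1),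
      hv0, hv0]
    simp only [hess]
    ring
  have key : ∀ j, _ = (0 : ℝ) := fun j => (dd_dot (fun i => analyticAt_hessVec hh i)
    (fun i => analyticAt_jacVecDot hh i) (eP j)).symm.trans
    (dd_eq_zero_of_eqOn_const (isOpen_phase hD) (H.velInd.hessVec_jacVecDot hD H.an) (eP j) _ hz)
  simp only [hwt0, hwt] at key
  have := H.toReg.eq_zero_of_hess hz (q := fun k =>
    hessVec h 0 (x, 0) * dd (eX k) (jacVec h 0) (x, 0) +
      hessVec h 1 (x, 0) * dd (eX k) (jacVec h 1) (x, 0) +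
      hessVec h 2 (x, 0) * dd (eX k) (jacVec h 2) (x, 0)) (by
    intro i
    rw [hess_symm hh i 0, hess_symm hh i 1]
    linear_combination key i)
  exact congrFun this k

/-- A force on a connected domain whose Jacobian is everywhere a scalar matrix is isotropic: the scalar
is then constant. -/
theorem NormalHam.exists_jacVec_ne_zero (H : NormalHam D h P) :
    ∃ z ∈ D ×ˢ (univ : Set (Vec 2)), ∃ j, jacVec h j z ≠ 0 := by
  by_contra! hw
  have hUo := isOpen_phase H.isOpen
  have hJ01 : ∀ z ∈ D ×ˢ (univ : Set (Vec 2)), forceJac h 0 1 z = 0 := fun z hz => hw z hz 2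
  have hJ10 : ∀ z ∈ D ×ˢ (univ : Set (Vec 2)), forceJac h 1 0 z = 0 := fun z hz =>
    neg_eq_zero.1 (hw z hz 0)
  have hJ : ∀ z ∈ D ×ˢ (univ : Set (Vec 2)), forceJac h 0 0 z = forceJac h 1 1 z := fun z hz =>
    sub_eq_zero.1 (hw z hz 1)
  obtain ⟨x₀, hx₀⟩ := H.conn.nonempty
  have hz₀ : (x₀, (0 : Vec 2)) ∈ D ×ˢ (univ : Set (Vec 2)) := ⟨hx₀, trivial⟩
  have hconst := const_of_dd_eq_zero H.isOpen H.conn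
    (fun z hz => analyticAt_forceJac (H.an z hz) 0 0) (fun i z hz => by
      fin_cases i
      · change dd (eX 0) (forceJac h 0 0) z = 0
        rw [dd_congr_on hUo hJ _ hz, forceJac, dd_comm (analyticAt_frc (H.an z hz) 1)]
        exact dd_eq_zero_of_eqOn_const hUo hJ10 _ z hz
      · change dd (eX 1) (forceJac h 0 0) z = 0
        rw [forceJac, dd_comm (analyticAt_frc (H.an z hz) 0)]
        exact dd_eq_zero_of_eqOn_const hUo hJ01 _ z hz)
    (H.velInd.dd_forceJac H.isOpen H.an 0 0)
  set a := forceJac h 0 0 (x₀, 0)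
  have hlin : ∀ i, ∀ z ∈ D ×ˢ (univ : Set (Vec 2)),
      frc h i z - a * z.1 i = frc h i (x₀, 0) - a * x₀ i := by
    intro i z hz
    have hd : ∀ e, ∀ z ∈ D ×ˢ (univ : Set (Vec 2)),
        dd e (fun z : Vec 2 × Vec 2 => frc h i z - a * z.1 i) z = dd e (frc h i) z - a * e.1 i := by
      intro e z hz
      rw [dd_sub (analyticAt_frc (H.an z hz) i)
        (analyticAt_const.fun_mul (analyticAt_fst_apply i z)),
        dd_const_mul a (analyticAt_fst_apply i z), dd_fst_apply]
    refine const_of_dd_eq_zero H.isOpen H.conn (f := fun z => frc h i z - a * z.1 i)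
      (fun z hz => (analyticAt_frc (H.an z hz) i).sub
        (analyticAt_const.mul (analyticAt_fst_apply i z))) ?_ ?_ z hz _ hz₀
    · intro k z hz
      rw [hd _ z hz]
      have h0 := hconst z hz _ hz₀
      have h1 := hJ z hz
      have h2 := hJ01 z hz
      have h3 := hJ10 z hz
      simp only [forceJac] at h0 h1 h2 h3
      fin_cases i <;> fin_cases k <;> simp [eX, -map_sub] at h0 h1 h2 h3 ⊢
      · exact sub_eq_zero.2 h0
      · exact h2
      · exact h3
      · rw [← h1]
        exact sub_eq_zero.2 h0
    · intro k z hz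
      rw [hd _ z hz, H.velInd.dd_frc H.an i k z hz]
      simp [eP]
  exact H.aniso ⟨a, fun i => frc h i (x₀, 0) - a * x₀ i, fun x hx p i => by
    have := hlin i (x, p) ⟨hx, trivial⟩
    simp only at this
    linarith⟩

/-- Either `hessVec` is at each position proportional to its value at zero momentum, or it is
orthogonal to a constant vector, to which `jacVec` is proportional. -/
theorem NormalHam.alternative (H : NormalHam D h P) :
    (∀ z ∈ D ×ˢ (univ : Set (Vec 2)), ∀ i j,
      hessVec h i z * hessVec h j (z.1, 0) = hessVec h j z * hessVec h i (z.1, 0)) ∨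
    ∃ k : Fin 3 → ℝ, k ≠ 0 ∧
      (∀ z ∈ D ×ˢ (univ : Set (Vec 2)),
        k 0 * hessVec h 0 z + k 1 * hessVec h 1 z + k 2 * hessVec h 2 z = 0) ∧
      ∀ z ∈ D ×ˢ (univ : Set (Vec 2)), ∀ i j, jacVec h i z * k j = jacVec h j z * k i := by
  have hUo := isOpen_phase H.isOpen
  have hUc := isPreconnected_phase H.conn
  have ha : ∀ i, AnalyticOnNhd ℝ (hessVec h i) (D ×ˢ univ) := fun i z hz =>
    analyticAt_hessVec (H.an z hz) i
  have ha0 : ∀ i, AnalyticOnNhd ℝ (fun z => hessVec h i (z.1, 0)) (D ×ˢ univ) := fun i z hz =>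
    analyticAt_zero_momentum (ha i _ ⟨hz.1, trivial⟩)
  have hw : ∀ i, AnalyticOnNhd ℝ (jacVec h i) (D ×ˢ univ) := fun i z hz =>
    analyticAt_jacVec (H.an z hz) i
  have hwt : ∀ i, AnalyticOnNhd ℝ (jacVecDot h i) (D ×ˢ univ) := fun i z hz =>
    analyticAt_jacVecDot (H.an z hz) i
  have hprod : ∀ i k l, ∀ z ∈ D ×ˢ (univ : Set (Vec 2)),
      (crossProduct (fun i => hessVec h i z) (fun i => hessVec h i (z.1, 0))) i *
        (jacVec h k z * jacVecDot h l z - jacVec h l z * jacVecDot h k z) = 0 := by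
    rintro i k l ⟨x, p⟩ ⟨hx, -⟩
    refine crossProduct_mul_eq_zero (w := fun i => jacVec h i (x, p))
      (u := fun i => jacVecDot h i (x, p)) ?_ ?_ ?_ ?_ i k l
    · exact H.velInd.hessVec_jacVec H.isOpen H.an _ ⟨hx, trivial⟩
    · simp only [H.jacVec_eq _ hx p]
      exact H.velInd.hessVec_jacVec H.isOpen H.an _ ⟨hx, trivial⟩
    · exact H.velInd.hessVec_jacVecDot H.isOpen H.an _ ⟨hx, trivial⟩
    · simp only [jacVecDot, H.dd_jacVec_eq _ _ hx p]
      linear_combination dd (eP 0) h (x, p) * H.hessVec_dd_jacVec hx 0 +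
        dd (eP 1) h (x, p) * H.hessVec_dd_jacVec hx 1
  by_cases hQ : ∀ i, ∀ z ∈ D ×ˢ (univ : Set (Vec 2)),
      (crossProduct (fun i => hessVec h i z) (fun i => hessVec h i (z.1, 0))) i = 0
  · left
    intro z hz i j
    have h0 := hQ 0 z hz
    have h1 := hQ 1 z hz
    have h2 := hQ 2 z hz
    simp only [cross_apply, Matrix.cons_val] at h0 h1 h2
    fin_cases i <;> fin_cases j <;> simp <;> linarith
  right
  push Not at hQ
  obtain ⟨i, hi⟩ := hQ
  obtain ⟨z₀, hz₀, j, hj⟩ := H.exists_jacVec_ne_zero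
  have hdot : ∀ k l, ∀ z ∈ D ×ˢ (univ : Set (Vec 2)),
      jacVec h k z * jacVecDot h l z - jacVec h l z * jacVecDot h k z = 0 := by
    intro k l
    obtain ⟨z, hz, hne⟩ := hi
    have hc : AnalyticOnNhd ℝ (fun z : Vec 2 × Vec 2 =>
        (crossProduct (fun i => hessVec h i z) (fun i => hessVec h i (z.1, 0))) i) (D ×ˢ univ) := by
      intro y hy
      simp only [cross_apply]
      fin_cases i <;> exact ((ha _ y hy).mul (ha0 _ y hy)).sub ((ha _ y hy).mul (ha0 _ y hy))
    exact (eqOn_zero_of_mul_eq_zero hUo hUc hc (fun y hy => ((hw k y hy).mul (hwt l y hy)).sub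
      ((hw l y hy).mul (hwt k y hy))) (hprod i k l)).resolve_left fun h0 => hne (h0 z hz)
  -- the velocity takes all values, which separates the two partial derivatives
  have hpar : ∀ m k l, ∀ z ∈ D ×ˢ (univ : Set (Vec 2)),
      jacVec h k z * dd (eX m) (jacVec h l) z = jacVec h l z * dd (eX m) (jacVec h k) z := by
    rintro m k l ⟨x, p⟩ ⟨hx, -⟩
    have h1 := H.right x hx (Pi.single m 1)
    have h2 := hdot k l (x, P (x, Pi.single m 1)) ⟨hx, trivial⟩
    have hv : ∀ i, dd (eP i) h (x, P (x, Pi.single m 1)) = (Pi.single m 1 : Vec 2) i := fun i =>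
      congrFun h1 i
    simp only [jacVecDot, H.jacVec_eq _ hx (P _), H.dd_jacVec_eq _ _ hx (P _), hv] at h2
    rw [H.jacVec_eq _ hx p, H.jacVec_eq _ hx p, H.dd_jacVec_eq _ _ hx p, H.dd_jacVec_eq _ _ hx p]
    fin_cases m <;> simp at h2 ⊢ <;> linarith
  have hpropj : ∀ i, ∀ z ∈ D ×ˢ (univ : Set (Vec 2)),
      jacVec h i z * jacVec h j z₀ = jacVec h j z * jacVec h i z₀ := by
    intro i
    have hnear := ((hw j z₀ hz₀).continuousAt.eventually_ne hj).and (hUo.mem_nhds hz₀)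
    obtain ⟨ε, hε, hb⟩ := Metric.eventually_nhds_iff_ball.1 hnear
    have hconst : ∀ z ∈ Metric.ball z₀ ε,
        jacVec h i z / jacVec h j z = jacVec h i z₀ / jacVec h j z₀ := by
      intro z hz
      refine Metric.isOpen_ball.is_const_of_fderiv_eq_zero
        (f := fun z => jacVec h i z / jacVec h j z) (𝕜 := ℝ)
        (convex_ball _ _).isPreconnected ?_ ?_ hz (Metric.mem_ball_self hε)
      · intro w hw'
        exact ((hw i w (hb w hw').2).div (hw j w (hb w hw').2)
          (hb w hw').1).differentiableAt.differentiableWithinAt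
      · intro w hw'
        obtain ⟨hne, hwU⟩ := hb w hw'
        refine ContinuousLinearMap.ext fun e => ?_
        change dd e (fun z => jacVec h i z / jacVec h j z) w = 0
        have hX := fun m => hpar m i j w hwU
        have hP := fun i k => H.velInd.dd_jacVec H.isOpen H.an i k w hwU
        rw [dd_div (hw i w hwU) (hw j w hwU) hne, dd_eq_sum e, dd_eq_sum e, hP, hP, hP, hP]
        rw [div_eq_zero_iff]
        left
        linear_combination (-e.1 0) * hX 0 - e.1 1 * hX 1
    refine ((hw i).mul analyticOnNhd_const).eqOn_of_preconnected_of_eventuallyEq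
      ((hw j).mul analyticOnNhd_const) hUc hz₀ ?_
    filter_upwards [Metric.ball_mem_nhds z₀ hε] with z hz
    have := hconst z hz
    rw [div_eq_div_iff (hb z hz).1 hj] at this
    change jacVec h i z * jacVec h j z₀ = jacVec h j z * jacVec h i z₀
    linarith
  refine ⟨fun i => jacVec h i z₀, fun h0 => hj (congrFun h0 j), ?_, ?_⟩
  · refine (eqOn_zero_of_mul_eq_zero hUo hUc (hw j) (g := fun z => jacVec h 0 z₀ * hessVec h 0 z +
      jacVec h 1 z₀ * hessVec h 1 z + jacVec h 2 z₀ * hessVec h 2 z)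
      (fun y hy => ((analyticAt_const.mul (ha 0 y hy)).add (analyticAt_const.mul (ha 1 y hy))).add
        (analyticAt_const.mul (ha 2 y hy))) fun z hz => ?_).resolve_left fun h0 => hj (h0 z₀ hz₀)
    have h1 := H.velInd.hessVec_jacVec H.isOpen H.an z hz
    linear_combination jacVec h j z₀ * h1 - hessVec h 0 z * hpropj 0 z hz -
      hessVec h 1 z * hpropj 1 z hz - hessVec h 2 z * hpropj 2 z hz
  · intro z hz i l
    refine mul_left_cancel₀ hj ?_
    linear_combination jacVec h l z₀ * hpropj i z hz - jacVec h i z₀ * hpropj l z hz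

end Alternative

/-! ### Quadratic Hamiltonians -/

section Quadratic

variable {D : Set (Vec 2)} {H : PhaseFun 2} {h : Vec 2 × Vec 2 → ℝ} {P : Vec 2 × Vec 2 → Vec 2}

theorem dd_eP_zero_momentum {f : Vec 2 × Vec 2 → ℝ} {z : Vec 2 × Vec 2}
    (hf : AnalyticAt ℝ f (z.1, 0)) (k : Fin 2) :
    dd (eP k) (fun y : Vec 2 × Vec 2 => f (y.1, 0)) z = 0 := by
  have := dd_comp_clm (f := f)
    ((ContinuousLinearMap.fst ℝ (Vec 2) (Vec 2)).prod (0 : Vec 2 × Vec 2 →L[ℝ] Vec 2)) hf (eP k)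
  exact this.trans (map_zero (fderiv ℝ f (z.1, 0)))

/-- If `∂v/∂p` does not depend on the momentum then it does not depend on the position either: it is
conserved, and the velocity takes all directions. -/
theorem NormalHam.hess_eq_const (H : NormalHam D h P)
    (hc : ∀ i j k, ∀ z ∈ D ×ˢ (univ : Set (Vec 2)), dd (eP k) (hess h i j) z = 0) (i j : Fin 2) :
    ∀ z ∈ D ×ˢ (univ : Set (Vec 2)), ∀ y ∈ D ×ˢ (univ : Set (Vec 2)),
      hess h i j z = hess h i j y := by
  have hUo := isOpen_phase H.isOpen
  have hsum : ∀ z ∈ D ×ˢ (univ : Set (Vec 2)), dd (eX 0) (hess h i j) z * dd (eP 0) h z +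
      dd (eX 1) (hess h i j) z * dd (eP 1) h z = 0 := by
    intro z hz
    have := (H.velInd.br_eq_zero H.an i j hz).1
    rw [br_two, hc, hc] at this
    · linear_combination this
    all_goals exact hz
  refine const_of_dd_eq_zero H.isOpen H.conn (fun z hz => analyticAt_hess (H.an z hz) i j)
    (fun k z hz => ?_) (hc i j)
  have hA := analyticAt_hess (H.an z hz) i j
  have v := fun k => analyticAt_dd (H.an z hz) (eP k)
  have hP : ∀ l k, dd (eP l) (dd (eX k) (hess h i j)) z = 0 := fun l k => by
    rw [dd_comm hA]
    exact dd_eq_zero_of_eqOn_const hUo (hc i j l) _ z hz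
  have key := fun l => dd_eq_zero_of_eqOn_const hUo hsum (eP l) z hz
  have := H.toReg.eq_zero_of_hess hz (q := fun k => dd (eX k) (hess h i j) z) fun l => by
    have := key l
    rw [dd_add ((analyticAt_dd hA _).fun_mul (v 0)) ((analyticAt_dd hA _).fun_mul (v 1)),
      dd_mul (analyticAt_dd hA _) (v 0), dd_mul (analyticAt_dd hA _) (v 1), hP, hP] at this
    rw [hess_symm (H.an z hz) l 0, hess_symm (H.an z hz) l 1]
    simp only [hess] at this ⊢
    linear_combination this
  exact congrFun this k

theorem NormalHam.isAnisotropicQuadratic (hH : NormalHam D (unc H) P)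
    (hc : ∀ i j k, ∀ z ∈ D ×ˢ (univ : Set (Vec 2)), dd (eP k) (hess (unc H) i j) z = 0) :
    IsAnisotropicQuadratic D H := by
  obtain ⟨x₀, hx₀⟩ := hH.conn.nonempty
  have hz₀ : (x₀, (0 : Vec 2)) ∈ D ×ˢ (univ : Set (Vec 2)) := ⟨hx₀, trivial⟩
  set M : Matrix (Fin 2) (Fin 2) ℝ := fun i j => hess (unc H) i j (x₀, 0) with hM
  have hMs : M 1 0 = M 0 1 := hess_symm (hH.an _ hz₀) 1 0
  have hA : ∀ i j, ∀ z ∈ D ×ˢ (univ : Set (Vec 2)), hess (unc H) i j z = M i j := fun i j z hz =>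
    hH.hess_eq_const hc i j z hz _ hz₀
  have hpp : ∀ i z, AnalyticAt ℝ (fun z : Vec 2 × Vec 2 => M i 0 * z.2 0 + M i 1 * z.2 1) z :=
    fun i z => (analyticAt_const.mul (analyticAt_snd_apply 0 z)).add
      (analyticAt_const.mul (analyticAt_snd_apply 1 z))
  have hv : ∀ i, ∀ x ∈ D, ∀ p : Vec 2, dd (eP i) (unc H) (x, p) = M i 0 * p 0 + M i 1 * p 1 := by
    intro i x hx p
    have := eq_of_dd_eP_eq_zero (D := D)
      (f := fun z => dd (eP i) (unc H) z - (M i 0 * z.2 0 + M i 1 * z.2 1))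
      (fun z hz => (analyticAt_dd (hH.an z hz) _).sub (hpp i z)) (fun k z hz => by
        rw [dd_sub (analyticAt_dd (hH.an z hz) _) (hpp i z),
          dd_add (analyticAt_const.fun_mul (analyticAt_snd_apply 0 z))
            (analyticAt_const.fun_mul (analyticAt_snd_apply 1 z)),
          dd_const_mul _ (analyticAt_snd_apply 0 z), dd_const_mul _ (analyticAt_snd_apply 1 z),
          dd_snd_apply, dd_snd_apply]
        have := hA i k z hz
        simp only [hess] at this
        rw [this]
        fin_cases k <;> simp [eP]) hx p
    simp only [hH.normal x hx, Pi.zero_apply, mul_zero, add_zero, sub_zero] at this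
    linarith
  have hq : ∀ z : Vec 2 × Vec 2, AnalyticAt ℝ (fun z : Vec 2 × Vec 2 =>
      M 0 0 * (z.2 0 * z.2 0) + 2 * M 0 1 * (z.2 0 * z.2 1) + M 1 1 * (z.2 1 * z.2 1)) z := fun z =>
    ((analyticAt_const.mul ((analyticAt_snd_apply 0 z).mul (analyticAt_snd_apply 0 z))).add
      (analyticAt_const.mul ((analyticAt_snd_apply 0 z).mul (analyticAt_snd_apply 1 z)))).add
      (analyticAt_const.mul ((analyticAt_snd_apply 1 z).mul (analyticAt_snd_apply 1 z)))
  refine ⟨M, fun x => H x 0, ?_, ?_, ?_, fun x hx p => ?_⟩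
  · ext i j
    exact hess_symm (hH.an _ hz₀) j i
  · rw [isUnit_iff_ne_zero, Matrix.det_fin_two, hMs]
    have := hH.toReg.det_ne_zero hz₀
    simpa [hM, sq] using this
  · intro x hx
    exact AnalyticAt.comp (g := unc H) (f := fun x => (x, 0)) (hH.an (x, 0) ⟨hx, trivial⟩)
      (analyticAt_id.prod analyticAt_const)
  · have := eq_of_dd_eP_eq_zero (D := D) (f := fun z => unc H z - (1 / 2) *
        (M 0 0 * (z.2 0 * z.2 0) + 2 * M 0 1 * (z.2 0 * z.2 1) + M 1 1 * (z.2 1 * z.2 1)))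
      (fun z hz => (hH.an z hz).sub (analyticAt_const.mul (hq z))) (fun k z hz => by
        have s := fun i => analyticAt_snd_apply i z
        have s2 := fun i j => (s i).fun_mul (s j)
        rw [dd_sub (hH.an z hz) (analyticAt_const.fun_mul (hq z)), dd_const_mul _ (hq z),
          dd_add ((analyticAt_const.fun_mul (s2 0 0)).fun_add (analyticAt_const.fun_mul (s2 0 1)))
            (analyticAt_const.fun_mul (s2 1 1)),
          dd_add (analyticAt_const.fun_mul (s2 0 0)) (analyticAt_const.fun_mul (s2 0 1)),
          dd_const_mul _ (s2 0 0), dd_const_mul _ (s2 0 1), dd_const_mul _ (s2 1 1),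
          dd_mul (s 0) (s 0), dd_mul (s 0) (s 1), dd_mul (s 1) (s 1)]
        simp only [dd_snd_apply]
        have := hv k z.1 hz.1 z.2
        simp only [Prod.mk.eta] at this
        rw [this]
        fin_cases k <;> simp [eP, hMs] <;> ring) hx p
    simp only [unc, Pi.zero_apply, mul_zero, add_zero, sub_zero] at this
    simp only [Fin.sum_univ_two, hMs]
    linear_combination this

/-- If `∂v/∂p` is at each position proportional to its value at zero momentum then, the third
derivatives being symmetric, it does not depend on the momentum. -/
theorem NormalHam.dd_hess_eq_zero (H : NormalHam D h P)
    (hp : ∀ z ∈ D ×ˢ (univ : Set (Vec 2)), ∀ i j,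
      hessVec h i z * hessVec h j (z.1, 0) = hessVec h j z * hessVec h i (z.1, 0)) (i j k : Fin 2) :
    ∀ z ∈ D ×ˢ (univ : Set (Vec 2)), dd (eP k) (hess h i j) z = 0 := by
  intro z hz
  have hz0 : (z.1, (0 : Vec 2)) ∈ D ×ˢ (univ : Set (Vec 2)) := ⟨hz.1, trivial⟩
  have hh := H.an z hz
  have a := fun i => analyticAt_hessVec hh i
  have a0 := fun i => analyticAt_hessVec (H.an _ hz0) i
  have b := fun i => analyticAt_zero_momentum (a0 i)
  have key : ∀ k i j, dd (eP k) (hessVec h i) z * hessVec h j (z.1, 0) =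
      dd (eP k) (hessVec h j) z * hessVec h i (z.1, 0) := by
    intro k i j
    have := dd_congr_on (isOpen_phase H.isOpen) (f := fun z : Vec 2 × Vec 2 =>
      hessVec h i z * hessVec h j (z.1, 0)) (fun z hz => hp z hz i j) (eP k) hz
    rw [dd_mul (a i) (b j), dd_mul (a j) (b i), dd_eP_zero_momentum (a0 _),
      dd_eP_zero_momentum (a0 _)] at this
    linarith
  have hdet := H.toReg.det_ne_zero hz0
  have c1 : dd (eP 0) (hess h 0 1) z = dd (eP 1) (hess h 0 0) z :=
    dd_comm (analyticAt_dd hh _) _ _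
  have c2 : dd (eP 0) (hess h 1 1) z = dd (eP 1) (hess h 0 1) z :=
    (dd_comm (analyticAt_dd hh _) _ _).trans (dd_comm_inner hh _ _ _)
  have k01 := fun k => key k 0 1
  have k02 := fun k => key k 0 2
  have k12 := fun k => key k 1 2
  simp only [hessVec, Matrix.cons_val] at k01 k02 k12
  have t1 : dd (eP 1) (hess h 0 0) z = 0 := by
    refine (mul_eq_zero.1 ?_).resolve_right hdet
    have e1 := k12 0
    have e2 := k01 1
    rw [c1, c2] at e1
    linear_combination hess h 0 0 (z.1, 0) * e1 - hess h 0 1 (z.1, 0) * e2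
  have t2 : dd (eP 1) (hess h 0 1) z = 0 := by
    refine (mul_eq_zero.1 ?_).resolve_right hdet
    have e1 := k12 1
    have e2 := k02 1
    have e3 := k12 0
    rw [c1, c2] at e3
    linear_combination hess h 0 0 (z.1, 0) * e1 - hess h 0 1 (z.1, 0) * e2 +
      hess h 0 1 (z.1, 0) * e3
  have t0 : dd (eP 0) (hess h 0 0) z = 0 := by
    refine (mul_eq_zero.1 ?_).resolve_right hdet
    have e1 := k01 0
    have e2 := k02 0
    rw [c1, t1] at e1
    rw [c2, t2] at e2
    linear_combination hess h 0 0 (z.1, 0) * e2 - hess h 0 1 (z.1, 0) * e1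
  have t3 : dd (eP 1) (hess h 1 1) z = 0 := by
    refine (mul_eq_zero.1 ?_).resolve_right hdet
    have e1 := k12 1
    have e2 := k02 1
    rw [t2] at e1
    rw [t1] at e2
    linear_combination -hess h 1 1 (z.1, 0) * e2 + hess h 0 1 (z.1, 0) * e1
  have hs : dd (eP k) (hess h 1 0) z = dd (eP k) (hess h 0 1) z :=
    dd_congr (hh.eventually_analyticAt.mono fun y hy => hess_symm hy 1 0) _
  fin_cases i <;> fin_cases j <;> fin_cases k <;> simp [-Fin.isValue] at hs ⊢ <;>
    simp only [hs, c1, c2, t0, t1, t2, t3]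

theorem NormalHam.isAnisotropicQuadratic_of_parallel (hH : NormalHam D (unc H) P)
    (hp : ∀ z ∈ D ×ˢ (univ : Set (Vec 2)), ∀ i j, hessVec (unc H) i z * hessVec (unc H) j (z.1, 0) =
      hessVec (unc H) j z * hessVec (unc H) i (z.1, 0)) : IsAnisotropicQuadratic D H :=
  hH.isAnisotropicQuadratic (hH.dd_hess_eq_zero hp)

end Quadratic

/-! ### Hamiltonians that are harmonic in the momenta -/

/-- An entire function with a continuous left inverse and a simple zero at the origin is linear:
`z / φ z` is entire without zeros, and of linear growth since `φ` is proper. -/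
theorem entire_eq_mul {φ ψ : ℂ → ℂ} (hφ : Differentiable ℂ φ) (hψ : Continuous ψ)
    (hl : ∀ z, ψ (φ z) = z) (h0 : φ 0 = 0) (hd : deriv φ 0 ≠ 0) : ∃ c, ∀ z, φ z = c * z := by
  have hds : ∀ {f : ℂ → ℂ}, Differentiable ℂ f → Differentiable ℂ (dslope f 0) := fun hf =>
    differentiableOn_univ.1 ((Complex.differentiableOn_dslope univ_mem).2 hf.differentiableOn)
  have hval : ∀ (f : ℂ → ℂ) z, f z = f 0 + dslope f 0 z * z := fun f z => by
    have := sub_smul_dslope f 0 z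
    simp only [sub_zero, smul_eq_mul] at this
    linear_combination -this
  have hφv : ∀ z, φ z = dslope φ 0 z * z := fun z => by rw [hval φ z, h0, zero_add]
  have hg0 : ∀ z, dslope φ 0 z ≠ 0 := by
    intro z hz
    rcases eq_or_ne z 0 with rfl | hne
    · exact hd (by rwa [dslope_same] at hz)
    · have h1 : φ z = 0 := by rw [hφv, hz, zero_mul]
      have h2 := hl z
      rw [h1, ← h0, hl] at h2
      exact hne h2.symm
  set χ : ℂ → ℂ := fun z => (dslope φ 0 z)⁻¹ with hχ
  have hχd : Differentiable ℂ χ := fun z => (hds hφ z).inv (hg0 z)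
  obtain ⟨R, hR⟩ := ((isCompact_closedBall (0 : ℂ) 1).image hψ).isBounded.exists_norm_le
  have hgrow : ∀ z, R < ‖z‖ → ‖χ z‖ ≤ ‖z‖ := by
    intro z hz
    have h1 : 1 < ‖φ z‖ := by
      by_contra! h
      exact absurd (hR z ⟨φ z, by simpa using h, hl z⟩) (not_le.2 hz)
    have h2 : ‖φ z‖ * ‖χ z‖ = ‖z‖ := by
      rw [← norm_mul, hφv z, hχ]
      congr 1
      field_simp [hg0 z]
    nlinarith [norm_nonneg (χ z)]
  obtain ⟨C, hC⟩ := ((isCompact_closedBall (0 : ℂ) (max R 1)).image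
    (hds hχd).continuous).isBounded.exists_norm_le
  have hbdd : Bornology.IsBounded (range (dslope χ 0)) := by
    refine isBounded_iff_forall_norm_le.2 ⟨max C (1 + ‖χ 0‖), ?_⟩
    rintro _ ⟨z, rfl⟩
    rcases le_or_gt ‖z‖ (max R 1) with hz | hz
    · exact (hC _ ⟨z, by simpa using hz, rfl⟩).trans (le_max_left _ _)
    · refine le_trans ?_ (le_max_right _ _)
      obtain ⟨hzR, hz1⟩ := max_lt_iff.1 hz
      have h1 : ‖dslope χ 0 z‖ * ‖z‖ ≤ ‖z‖ + ‖χ 0‖ := by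
        rw [← norm_mul]
        have : dslope χ 0 z * z = χ z - χ 0 := by rw [hval χ z]; ring
        rw [this]
        exact (norm_sub_le _ _).trans (add_le_add_left (hgrow z hzR) _)
      by_contra! h2
      nlinarith [norm_nonneg (χ 0)]
  have hk : ∀ z, χ z = χ 0 + dslope χ 0 0 * z := fun z => by
    rw [hval χ z, (hds hχd).apply_eq_apply_of_bounded hbdd z 0]
  have hk0 : dslope χ 0 0 = 0 := by
    by_contra hne
    have := hk (-χ 0 / dslope χ 0 0)
    rw [mul_div_cancel₀ _ hne, add_neg_cancel] at this
    exact inv_ne_zero (hg0 _) this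
  refine ⟨dslope φ 0 0, fun z => ?_⟩
  have := hk z
  rw [hk0, zero_mul, add_zero] at this
  rw [hφv z, inv_injective this]

section Elliptic

variable {D : Set (Vec 2)} {H : PhaseFun 2} {h : Vec 2 × Vec 2 → ℝ} {P : Vec 2 × Vec 2 → Vec 2}

/-- If the Hamiltonian is harmonic in the momenta then `v₁ - i v₂` is an entire injective function
of `p₁ + i p₂`, hence linear. -/
theorem NormalHam.exists_velocity_linear (H : NormalHam D h P)
    (hA : ∀ z ∈ D ×ˢ (univ : Set (Vec 2)), hess h 0 0 z + hess h 1 1 z = 0) {x : Vec 2}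
    (hx : x ∈ D) : ∃ a b : ℝ, ∀ p : Vec 2, dd (eP 0) h (x, p) = a * p 0 - b * p 1 ∧
      dd (eP 1) h (x, p) = -(b * p 0 + a * p 1) := by
  let m : ℂ → Vec 2 × Vec 2 := fun z => (x, ![z.re, z.im])
  let φ : ℂ → ℂ := fun z => dd (eP 0) h (m z) - dd (eP 1) h (m z) * Complex.I
  let ψ : ℂ → ℂ := fun z => P (x, ![z.re, -z.im]) 0 + P (x, ![z.re, -z.im]) 1 * Complex.I
  have hmU : ∀ z, m z ∈ D ×ˢ (univ : Set (Vec 2)) := fun z => ⟨hx, trivial⟩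
  have hm : ∀ z, HasFDerivAt m
      ((0 : ℂ →L[ℝ] Vec 2).prod (ContinuousLinearMap.pi ![Complex.reCLM, Complex.imCLM])) z := by
    intro z
    refine (hasFDerivAt_const x z).prodMk (hasFDerivAt_pi.2 fun i => ?_)
    fin_cases i
    · exact Complex.reCLM.hasFDerivAt
    · exact Complex.imCLM.hasFDerivAt
  have hv : ∀ i z, HasFDerivAt (fun z => dd (eP i) h (m z)) _ z := fun i z =>
    HasFDerivAt.comp z (analyticAt_dd (H.an _ (hmU z)) (eP i)).differentiableAt.hasFDerivAt (hm z)
  have hφd : ∀ z, HasFDerivAt φ _ z := fun z =>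
    (Complex.ofRealCLM.hasFDerivAt.comp z (hv 0 z)).sub
      ((Complex.ofRealCLM.hasFDerivAt.comp z (hv 1 z)).mul_const Complex.I)
  have hc1 : ((0 : ℂ →L[ℝ] Vec 2).prod (ContinuousLinearMap.pi ![Complex.reCLM, Complex.imCLM])) 1 =
      eP 0 := by
    ext i <;> fin_cases i <;> simp [eP]
  have hcI : ((0 : ℂ →L[ℝ] Vec 2).prod (ContinuousLinearMap.pi ![Complex.reCLM, Complex.imCLM]))
      Complex.I = eP 1 := by
    ext i <;> fin_cases i <;> simp [eP]
  have hφ1 : ∀ z, fderiv ℝ φ z 1 = hess h 0 0 (m z) - hess h 1 0 (m z) * Complex.I := by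
    intro z
    rw [(hφd z).fderiv]
    simp [hc1, hess, dd]
    ring
  have hφI : ∀ z, fderiv ℝ φ z Complex.I = hess h 0 1 (m z) - hess h 1 1 (m z) * Complex.I := by
    intro z
    rw [(hφd z).fderiv]
    simp [hcI, hess, dd]
    ring
  have hφC : Differentiable ℂ φ := by
    intro z
    refine differentiableAt_complex_iff_differentiableAt_real.2 ⟨(hφd z).differentiableAt, ?_⟩
    have h1 := hA _ (hmU z)
    have h2 := hess_symm (H.an _ (hmU z)) 1 0
    have h3 : hess h 1 1 (m z) = -hess h 0 0 (m z) := by linarith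
    rw [hφ1, hφI, h2, h3, smul_eq_mul]
    push_cast
    linear_combination (hess h 0 1 (m z) : ℂ) * Complex.I_sq
  have hψ : Continuous ψ := by
    have h1 : Continuous fun z : ℂ => ((x, ![z.re, -z.im]) : Vec 2 × Vec 2) := by
      refine continuous_const.prodMk (continuous_pi fun i => ?_)
      fin_cases i
      · exact Complex.continuous_re
      · exact Complex.continuous_im.neg
    have h2 : Continuous fun z : ℂ => P (x, ![z.re, -z.im]) :=
      H.anP.continuousOn.comp_continuous h1 fun z => ⟨hx, trivial⟩
    have h3 : ∀ i, Continuous fun z : ℂ => ((P (x, ![z.re, -z.im]) i : ℝ) : ℂ) := fun i =>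
      Complex.continuous_ofReal.comp ((continuous_apply i).comp h2)
    exact (h3 0).add ((h3 1).mul continuous_const)
  have hl : ∀ z, ψ (φ z) = z := by
    intro z
    have h1 : ![(φ z).re, -(φ z).im] = vel h (m z) := by
      funext i
      fin_cases i <;> simp [φ, vel]
    simp only [ψ]
    rw [h1, H.left x hx]
    simp
  have hφ0 : φ 0 = 0 := by
    have : m 0 = (x, 0) := by
      ext i <;> fin_cases i <;> simp [m]
    simp [φ, this, H.normal x hx]
  have hd : deriv φ 0 ≠ 0 := by
    have h1 := (hφC 0).hasDerivAt.complexToReal_fderiv.fderiv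
    have h2 := hφ1 0
    rw [h1] at h2
    simp at h2
    intro h0
    rw [h0] at h2
    have hre := congrArg Complex.re h2
    have him := congrArg Complex.im h2
    simp at hre him
    refine H.toReg.det_ne_zero (hmU 0) ?_
    rw [← hess_symm (H.an _ (hmU 0)) 1 0, ← hre, him]
    simp
  obtain ⟨c, hc⟩ := entire_eq_mul hφC hψ hl hφ0 hd
  refine ⟨c.re, c.im, fun p => ?_⟩
  have h1 := hc (p 0 + p 1 * Complex.I)
  have h2 : m (p 0 + p 1 * Complex.I) = (x, p) := by
    ext i <;> fin_cases i <;> simp [m]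
  have hre := congrArg Complex.re h1
  have him := congrArg Complex.im h1
  simp [φ, h2] at hre him
  constructor <;> linarith

/-- A Hamiltonian that is harmonic in the momenta is quadratic in them, by the linearity of the
velocity. -/
theorem NormalHam.isAnisotropicQuadratic_of_harmonic (hH : NormalHam D (unc H) P)
    (hA : ∀ z ∈ D ×ˢ (univ : Set (Vec 2)), hess (unc H) 0 0 z + hess (unc H) 1 1 z = 0) :
    IsAnisotropicQuadratic D H := by
  have hconst : ∀ x ∈ D, ∀ p i j, hess (unc H) i j (x, p) = hess (unc H) i j (x, 0) := by
    intro x hx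
    obtain ⟨a, b, hab⟩ := hH.exists_velocity_linear hA hx
    have hlin : ∀ i j, ∃ c : ℝ, ∀ p, hess (unc H) i j (x, p) = c := by
      intro i j
      refine ⟨dd (eP i) (unc H) (x, Pi.single j 1), fun p => ?_⟩
      have h1 := hasDerivAt_line (f := dd (eP i) (unc H)) (z := (x, p)) (e := eP j) (t := 0)
        (by simpa using analyticAt_dd (hH.an (x, p) ⟨hx, trivial⟩) _)
      have h2 : (fun s : ℝ => dd (eP i) (unc H) ((x, p) + s • eP j)) = fun s =>
          dd (eP i) (unc H) (x, p) + s * dd (eP i) (unc H) (x, Pi.single j 1) := by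
        funext s
        have : (x, p) + s • eP j = (x, p + s • (Pi.single j 1 : Vec 2)) := by ext <;> simp [eP]
        rw [this]
        fin_cases i <;> simp [hab] <;> ring
      rw [h2] at h1
      have h3 : HasDerivAt (fun s : ℝ => dd (eP i) (unc H) (x, p) +
          s * dd (eP i) (unc H) (x, Pi.single j 1)) (dd (eP i) (unc H) (x, Pi.single j 1)) 0 := by
        simpa using ((hasDerivAt_id (0 : ℝ)).mul_const
          (dd (eP i) (unc H) (x, Pi.single j 1))).const_add (dd (eP i) (unc H) (x, p))
      simpa [hess] using h1.unique h3
    intro p i j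
    obtain ⟨c, hc⟩ := hlin i j
    rw [hc, hc]
  refine hH.isAnisotropicQuadratic_of_parallel ?_
  rintro ⟨x, p⟩ ⟨hx, -⟩ i j
  have : ∀ i, hessVec (unc H) i (x, p) = hessVec (unc H) i (x, 0) := fun i => by
    fin_cases i <;> exact hconst x hx p _ _
  rw [this, this, mul_comm]

end Elliptic

/-! ### Canonical transformations -/

/-- The inverse of the transformation of type 2 by `V`, followed by the transformation of type 1 by
the matrix `N` with inverse `M`. -/
def pull (N M : Matrix (Fin 2) (Fin 2) ℝ) (V : Vec 2 → Vec 2) (z : Vec 2 × Vec 2) : Vec 2 × Vec 2 :=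
  (M *ᵥ z.1, Nᵀ *ᵥ z.2 - V (M *ᵥ z.1))

/-- The domain of the transformed Hamiltonian. -/
def newDom (N : Matrix (Fin 2) (Fin 2) ℝ) (D : Set (Vec 2)) : Set (Vec 2) :=
  (fun x => N *ᵥ x + 0) '' D

/-- The transformed Hamiltonian. -/
def newHam (N M : Matrix (Fin 2) (Fin 2) ℝ) (V : Vec 2 → Vec 2) (H : PhaseFun 2) : PhaseFun 2 :=
  fun x p => H (M *ᵥ x) (Nᵀ *ᵥ p - V (M *ᵥ x))

/-- A vector field has no curl. -/
def CurlFree (D : Set (Vec 2)) (V : Vec 2 → Vec 2) : Prop :=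
  ∀ x ∈ D, ∀ i j, fderiv ℝ V x (Pi.single i 1) j = fderiv ℝ V x (Pi.single j 1) i

section Pull

variable {N M : Matrix (Fin 2) (Fin 2) ℝ} {V : Vec 2 → Vec 2} {D : Set (Vec 2)} {H : PhaseFun 2}
  {h f g : Vec 2 × Vec 2 → ℝ} {P : Vec 2 × Vec 2 → Vec 2} {z : Vec 2 × Vec 2}

theorem mulVec_mulVec_cancel {A B : Matrix (Fin 2) (Fin 2) ℝ} (h : A * B = 1) (x : Vec 2) :
    A *ᵥ (B *ᵥ x) = x := by rw [Matrix.mulVec_mulVec, h, Matrix.one_mulVec]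

theorem transpose_mul_eq_one {A B : Matrix (Fin 2) (Fin 2) ℝ} (h : A * B = 1) : Bᵀ * Aᵀ = 1 := by
  rw [← Matrix.transpose_mul, h, Matrix.transpose_one]

theorem mem_newDom (hMN : M * N = 1) {x : Vec 2} : x ∈ newDom N D ↔ M *ᵥ x ∈ D := by
  constructor
  · rintro ⟨y, hy, rfl⟩
    simpa only [add_zero, mulVec_mulVec_cancel hMN] using hy
  · intro hx
    exact ⟨_, hx, by simp only [add_zero, mulVec_mulVec_cancel (mul_eq_one_comm.1 hMN)]⟩

theorem permissible_newHam (hMN : M * N = 1) (hV : AnalyticOnNhd ℝ V D) (hc : CurlFree D V) :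
    Permissible (D, H) (newDom N D, newHam N M V H) := by
  have hNM := mul_eq_one_comm.1 hMN
  have hinv : (Nᵀ)⁻¹ = Mᵀ := Matrix.inv_eq_right_inv (transpose_mul_eq_one hMN)
  refine (Relation.ReflTransGen.single (b := (D, fun x p => H x (p - V x)))
    (Or.inr ⟨V, hV, hc, rfl, fun x _ p => ?_⟩)).tail
    (Or.inl ⟨N, 0, Matrix.isUnit_det_of_left_inverse hMN, rfl, fun x _ p => ?_⟩)
  · simp only [newHam, hinv, add_zero, mulVec_mulVec_cancel hMN,
      mulVec_mulVec_cancel (transpose_mul_eq_one hMN)]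
  · simp only [add_sub_cancel_right]

theorem hasFDerivAt_mulVec (A : Matrix (Fin 2) (Fin 2) ℝ) (x : Vec 2) :
    HasFDerivAt (fun x => A *ᵥ x) A.mulVecLin.toContinuousLinearMap x :=
  A.mulVecLin.toContinuousLinearMap.hasFDerivAt

theorem analyticAt_mulVec (A : Matrix (Fin 2) (Fin 2) ℝ) (x : Vec 2) :
    AnalyticAt ℝ (fun x => A *ᵥ x) x := A.mulVecLin.toContinuousLinearMap.analyticAt x

theorem analyticAt_pull (hV : AnalyticAt ℝ V (M *ᵥ z.1)) : AnalyticAt ℝ (pull N M V) z := by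
  have h1 : AnalyticAt ℝ (fun z : Vec 2 × Vec 2 => M *ᵥ z.1) z :=
    AnalyticAt.comp (analyticAt_mulVec M z.1) analyticAt_fst
  have h2 : AnalyticAt ℝ (fun z : Vec 2 × Vec 2 => Nᵀ *ᵥ z.2) z :=
    AnalyticAt.comp (analyticAt_mulVec Nᵀ z.2) analyticAt_snd
  exact h1.prod (h2.sub (AnalyticAt.comp (f := fun z : Vec 2 × Vec 2 => M *ᵥ z.1) hV h1))

theorem fderiv_pull (hV : AnalyticAt ℝ V (M *ᵥ z.1)) (e : Vec 2 × Vec 2) :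
    fderiv ℝ (pull N M V) z e =
      (M *ᵥ e.1, Nᵀ *ᵥ e.2 - fderiv ℝ V (M *ᵥ z.1) (M *ᵥ e.1)) := by
  have h1 : HasFDerivAt (fun z : Vec 2 × Vec 2 => M *ᵥ z.1) _ z :=
    (hasFDerivAt_mulVec M z.1).comp z hasFDerivAt_fst
  have h2 : HasFDerivAt (fun z : Vec 2 × Vec 2 => Nᵀ *ᵥ z.2) _ z :=
    (hasFDerivAt_mulVec Nᵀ z.2).comp z hasFDerivAt_snd
  have h3 : HasFDerivAt (fun z : Vec 2 × Vec 2 => V (M *ᵥ z.1)) _ z :=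
    hV.differentiableAt.hasFDerivAt.comp (f := fun z : Vec 2 × Vec 2 => M *ᵥ z.1) z h1
  have h4 : HasFDerivAt (pull N M V) _ z := h1.prodMk (h2.sub h3)
  rw [h4.fderiv]
  rfl

theorem dd_eP_comp_pull (hV : AnalyticAt ℝ V (M *ᵥ z.1)) (hf : AnalyticAt ℝ f (pull N M V z))
    (j : Fin 2) : dd (eP j) (fun y => f (pull N M V y)) z =
      N j 0 * dd (eP 0) f (pull N M V z) + N j 1 * dd (eP 1) f (pull N M V z) := by
  rw [dd_comp hf (analyticAt_pull hV).differentiableAt, fderiv_pull hV, dd_eq_sum]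
  simp [eP]

theorem dd_eX_comp_pull (hV : AnalyticAt ℝ V (M *ᵥ z.1)) (hf : AnalyticAt ℝ f (pull N M V z))
    (k : Fin 2) : dd (eX k) (fun y => f (pull N M V y)) z =
      M 0 k * (dd (eX 0) f (pull N M V z) -
        (fderiv ℝ V (M *ᵥ z.1) (Pi.single 0 1) 0 * dd (eP 0) f (pull N M V z) +
          fderiv ℝ V (M *ᵥ z.1) (Pi.single 0 1) 1 * dd (eP 1) f (pull N M V z))) +
      M 1 k * (dd (eX 1) f (pull N M V z) -
        (fderiv ℝ V (M *ᵥ z.1) (Pi.single 1 1) 0 * dd (eP 0) f (pull N M V z) +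
          fderiv ℝ V (M *ᵥ z.1) (Pi.single 1 1) 1 * dd (eP 1) f (pull N M V z))) := by
  have hcol : M *ᵥ (Pi.single k 1 : Vec 2) =
      M 0 k • (Pi.single 0 1 : Vec 2) + M 1 k • (Pi.single 1 1 : Vec 2) := by
    funext i
    fin_cases i <;> simp
  rw [dd_comp hf (analyticAt_pull hV).differentiableAt, fderiv_pull hV, dd_eq_sum]
  simp only [eX, hcol, map_add, map_smul]
  simp
  ring

/-- The transformation preserves the Poisson bracket. -/
theorem br_comp_pull (hMN : M * N = 1) (hV : AnalyticAt ℝ V (M *ᵥ z.1))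
    (hc : fderiv ℝ V (M *ᵥ z.1) (Pi.single 0 1) 1 = fderiv ℝ V (M *ᵥ z.1) (Pi.single 1 1) 0)
    (hf : AnalyticAt ℝ f (pull N M V z)) (hg : AnalyticAt ℝ g (pull N M V z)) :
    br (fun y => f (pull N M V y)) (fun y => g (pull N M V y)) z = br f g (pull N M V z) := by
  have d : ∀ i j, M i 0 * N 0 j + M i 1 * N 1 j = (1 : Matrix (Fin 2) (Fin 2) ℝ) i j := by
    intro i j
    rw [← hMN, Matrix.mul_apply, Fin.sum_univ_two]
  have d00 := d 0 0
  have d01 := d 0 1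
  have d10 := d 1 0
  have d11 := d 1 1
  simp only [Matrix.one_apply, Fin.isValue, if_true, zero_ne_one, one_ne_zero, if_false] at d00 d01 d10 d11
  rw [br_two, br_two]
  simp only [dd_eP_comp_pull hV hf, dd_eP_comp_pull hV hg, dd_eX_comp_pull hV hf,
    dd_eX_comp_pull hV hg]
  generalize pull N M V z = w at *
  generalize fderiv ℝ V (M *ᵥ z.1) = W at *
  rw [hc]
  set a0 := dd (eX 0) f w - (W (Pi.single 0 1) 0 * dd (eP 0) f w +
    W (Pi.single 1 1) 0 * dd (eP 1) f w) with ha0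
  set a1 := dd (eX 1) f w - (W (Pi.single 1 1) 0 * dd (eP 0) f w +
    W (Pi.single 1 1) 1 * dd (eP 1) f w) with ha1
  set b0 := dd (eX 0) g w - (W (Pi.single 0 1) 0 * dd (eP 0) g w +
    W (Pi.single 1 1) 0 * dd (eP 1) g w) with hb0
  set b1 := dd (eX 1) g w - (W (Pi.single 1 1) 0 * dd (eP 0) g w +
    W (Pi.single 1 1) 1 * dd (eP 1) g w) with hb1
  linear_combination (a0 * dd (eP 0) g w - b0 * dd (eP 0) f w) * d00 +
    (a0 * dd (eP 1) g w - b0 * dd (eP 1) f w) * d01 +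
    (a1 * dd (eP 0) g w - b1 * dd (eP 0) f w) * d10 +
    (a1 * dd (eP 1) g w - b1 * dd (eP 1) f w) * d11 +
    dd (eP 0) g w * ha0 - dd (eP 0) f w * hb0 + dd (eP 1) g w * ha1 - dd (eP 1) f w * hb1

theorem isOpen_newDom (hMN : M * N = 1) (hD : IsOpen D) : IsOpen (newDom N D) := by
  have : newDom N D = (fun x => M *ᵥ x) ⁻¹' D := ext fun x => mem_newDom hMN
  rw [this]
  exact hD.preimage M.mulVecLin.toContinuousLinearMap.continuous

theorem isConnected_newDom (hD : IsConnected D) : IsConnected (newDom N D) :=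
  hD.image _ ((N.mulVecLin.toContinuousLinearMap.continuous.add continuous_const).continuousOn)

theorem pull_mem (hMN : M * N = 1) (hz : z ∈ newDom N D ×ˢ (univ : Set (Vec 2))) :
    pull N M V z ∈ D ×ˢ (univ : Set (Vec 2)) := ⟨(mem_newDom hMN).1 hz.1, trivial⟩

theorem vel_pull (hMN : M * N = 1) (hV : AnalyticOnNhd ℝ V D)
    (hh : AnalyticOnNhd ℝ h (D ×ˢ univ)) (j : Fin 2) :
    EqOn (dd (eP j) fun y => h (pull N M V y))
      (fun y => N j 0 * dd (eP 0) h (pull N M V y) + N j 1 * dd (eP 1) h (pull N M V y))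
      (newDom N D ×ˢ univ) := fun _ hz =>
  dd_eP_comp_pull (hV _ ((mem_newDom hMN).1 hz.1)) (hh _ (pull_mem hMN hz)) j

theorem hess_pull (hMN : M * N = 1) (hD : IsOpen D) (hV : AnalyticOnNhd ℝ V D)
    (hh : AnalyticOnNhd ℝ h (D ×ˢ univ)) (i j : Fin 2)
    (hz : z ∈ newDom N D ×ˢ (univ : Set (Vec 2))) :
    hess (fun y => h (pull N M V y)) i j z =
      N i 0 * (N j 0 * hess h 0 0 (pull N M V z) + N j 1 * hess h 0 1 (pull N M V z)) +
      N i 1 * (N j 0 * hess h 0 1 (pull N M V z) + N j 1 * hess h 1 1 (pull N M V z)) := by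
  have hw := hh _ (pull_mem (V := V) hMN hz)
  have v := fun k => analyticAt_dd hw (eP k)
  rw [hess, dd_congr_on (isOpen_phase (isOpen_newDom hMN hD)) (vel_pull hMN hV hh i) _ hz,
    dd_eP_comp_pull (f := fun w => N i 0 * dd (eP 0) h w + N i 1 * dd (eP 1) h w)
      (hV _ ((mem_newDom hMN).1 hz.1))
      ((analyticAt_const.mul (v 0)).add (analyticAt_const.mul (v 1)))]
  simp only [dd_add (analyticAt_const.fun_mul (v 0)) (analyticAt_const.fun_mul (v 1)),
    dd_const_mul _ (v 0), dd_const_mul _ (v 1)]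
  have := hess_symm hw 1 0
  simp only [hess] at this ⊢
  linear_combination N i 1 * N j 0 * this

theorem frc_pull (hMN : M * N = 1) (hD : IsOpen D) (hV : AnalyticOnNhd ℝ V D) (hc : CurlFree D V)
    (hh : AnalyticOnNhd ℝ h (D ×ˢ univ)) (i : Fin 2)
    (hz : z ∈ newDom N D ×ˢ (univ : Set (Vec 2))) :
    frc (fun y => h (pull N M V y)) i z =
      N i 0 * frc h 0 (pull N M V z) + N i 1 * frc h 1 (pull N M V z) := by
  have hx := (mem_newDom hMN).1 hz.1
  have hw := hh _ (pull_mem (V := V) hMN hz)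
  have v := fun k => analyticAt_dd hw (eP k)
  have hUo := isOpen_phase (isOpen_newDom hMN hD)
  rw [frc, br_congr ((vel_pull hMN hV hh i).eventuallyEq_of_mem (hUo.mem_nhds hz)) .rfl,
    br_comp_pull (f := fun w => N i 0 * dd (eP 0) h w + N i 1 * dd (eP 1) h w) hMN (hV _ hx)
      (hc _ hx 0 1) ((analyticAt_const.mul (v 0)).add (analyticAt_const.mul (v 1))) hw]
  simp only [frc, br_two, dd_add (analyticAt_const.fun_mul (v 0)) (analyticAt_const.fun_mul (v 1)),
    dd_const_mul _ (v 0), dd_const_mul _ (v 1)]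
  ring

theorem reg_pull (hMN : M * N = 1) (hV : AnalyticOnNhd ℝ V D) (hr : Reg D h P) :
    Reg (newDom N D) (fun y => h (pull N M V y))
      (fun z => Mᵀ *ᵥ (P (M *ᵥ z.1, M *ᵥ z.2) + V (M *ᵥ z.1))) := by
  have hNM := mul_eq_one_comm.1 hMN
  have hvel : ∀ z ∈ newDom N D ×ˢ (univ : Set (Vec 2)),
      vel (fun y => h (pull N M V y)) z = N *ᵥ vel h (pull N M V z) := by
    intro z hz
    funext i
    refine (vel_pull hMN hV hr.an i hz).trans ?_
    simp [Matrix.mulVec, dotProduct, Fin.sum_univ_two, vel]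
  have hMM : AnalyticOnNhd ℝ (fun z : Vec 2 × Vec 2 => ((M *ᵥ z.1, M *ᵥ z.2) : Vec 2 × Vec 2))
      univ := fun z _ => (AnalyticAt.comp (analyticAt_mulVec M z.1) analyticAt_fst).prod
        (AnalyticAt.comp (analyticAt_mulVec M z.2) analyticAt_snd)
  refine ⟨fun z hz => ?_, fun z hz => ?_, fun x hx p => ?_, fun x hx v => ?_⟩
  · exact AnalyticAt.comp (hr.an _ (pull_mem hMN hz))
      (analyticAt_pull (hV _ ((mem_newDom hMN).1 hz.1)))
  · have hx := (mem_newDom hMN).1 hz.1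
    have h1 : AnalyticAt ℝ (fun z : Vec 2 × Vec 2 => P (M *ᵥ z.1, M *ᵥ z.2)) z :=
      AnalyticAt.comp (f := fun z : Vec 2 × Vec 2 => ((M *ᵥ z.1, M *ᵥ z.2) : Vec 2 × Vec 2))
        (hr.anP (M *ᵥ z.1, M *ᵥ z.2) ⟨hx, trivial⟩) (hMM z trivial)
    have h2 : AnalyticAt ℝ (fun z : Vec 2 × Vec 2 => V (M *ᵥ z.1)) z :=
      AnalyticAt.comp (f := fun z : Vec 2 × Vec 2 => M *ᵥ z.1) (hV _ hx)
        (AnalyticAt.comp (analyticAt_mulVec M z.1) analyticAt_fst)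
    exact AnalyticAt.comp (g := fun x => Mᵀ *ᵥ x) (analyticAt_mulVec Mᵀ _) (h1.add h2)
  · rw [hvel _ ⟨hx, trivial⟩]
    simp only [mulVec_mulVec_cancel hMN]
    have := hr.left _ ((mem_newDom hMN).1 hx) (Nᵀ *ᵥ p - V (M *ᵥ x))
    simp only [pull]
    rw [this, sub_add_cancel, mulVec_mulVec_cancel (transpose_mul_eq_one hNM)]
  · rw [hvel _ ⟨hx, trivial⟩]
    simp only [pull, mulVec_mulVec_cancel (transpose_mul_eq_one hMN), add_sub_cancel_right]
    rw [hr.right _ ((mem_newDom hMN).1 hx), mulVec_mulVec_cancel hNM]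

theorem velInd_pull (hMN : M * N = 1) (hD : IsOpen D) (hV : AnalyticOnNhd ℝ V D)
    (hc : CurlFree D V) (hh : AnalyticOnNhd ℝ h (D ×ˢ univ)) (hv : VelInd D h) :
    VelInd (newDom N D) fun y => h (pull N M V y) := by
  obtain ⟨F, hF⟩ := hv
  refine ⟨fun x i => N i 0 * F (M *ᵥ x) 0 + N i 1 * F (M *ᵥ x) 1, fun x hx p i => ?_⟩
  rw [frc_pull hMN hD hV hc hh i ⟨hx, trivial⟩]
  have hx' := (mem_newDom hMN).1 hx
  simp only [pull, hF _ hx']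

theorem aniso_pull (hMN : M * N = 1) (hD : IsOpen D) (hV : AnalyticOnNhd ℝ V D)
    (hc : CurlFree D V) (hh : AnalyticOnNhd ℝ h (D ×ˢ univ))
    (ha : ¬ ∃ (a : ℝ) (b : Vec 2), ∀ x ∈ D, ∀ p i, frc h i (x, p) = a * x i + b i) :
    ¬ ∃ (a : ℝ) (b : Vec 2), ∀ x ∈ newDom N D, ∀ p i,
      frc (fun y => h (pull N M V y)) i (x, p) = a * x i + b i := by
  rintro ⟨a, b, hab⟩
  refine ha ⟨a, M *ᵥ b, fun x hx p i => ?_⟩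
  have hx' : N *ᵥ x ∈ newDom N D := (mem_newDom hMN).2 (by rwa [mulVec_mulVec_cancel hMN])
  have hpull : pull N M V (N *ᵥ x, Mᵀ *ᵥ (p + V x)) = (x, p) := by
    simp only [pull, mulVec_mulVec_cancel hMN, mulVec_mulVec_cancel (transpose_mul_eq_one hMN),
      add_sub_cancel_right]
  have key : ∀ j, N j 0 * frc h 0 (x, p) + N j 1 * frc h 1 (x, p) = a * (N *ᵥ x) j + b j := by
    intro j
    rw [← hab _ hx' (Mᵀ *ᵥ (p + V x)) j, frc_pull hMN hD hV hc hh j ⟨hx', trivial⟩, hpull]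
  have h1 : N *ᵥ (fun k => frc h k (x, p)) = a • (N *ᵥ x) + b := by
    funext j
    rw [Pi.add_apply, Pi.smul_apply, smul_eq_mul, ← key j]
    simp only [Matrix.mulVec, dotProduct, Fin.sum_univ_two]
  have h2 := congrArg (fun v => (M *ᵥ v) i) h1
  simpa only [Matrix.mulVec_add, Matrix.mulVec_smul, mulVec_mulVec_cancel hMN, Pi.add_apply,
    Pi.smul_apply, smul_eq_mul] using h2

end Pull

/-! ### Normalisation -/

section Normalisation

variable {N M : Matrix (Fin 2) (Fin 2) ℝ} {D : Set (Vec 2)} {H : PhaseFun 2}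
  {h : Vec 2 × Vec 2 → ℝ} {P : Vec 2 × Vec 2 → Vec 2}

/-- The momentum field on which the velocity vanishes has no curl, as the velocities commute. -/
theorem curlFree_zero_velocity (hD : IsOpen D) (hr : Reg D h P) (hv : VelInd D h) :
    CurlFree D fun x => -P (x, 0) := by
  intro x hx
  have hG : AnalyticAt ℝ (fun x => P (x, 0)) x :=
    AnalyticAt.comp (f := fun x : Vec 2 => ((x, 0) : Vec 2 × Vec 2)) (hr.anP (x, 0) ⟨hx, trivial⟩)
      (analyticAt_id.prod analyticAt_const)
  set G' := fderiv ℝ (fun x => P (x, 0)) x with hG'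
  have hz : (x, P (x, 0)) ∈ D ×ˢ (univ : Set (Vec 2)) := ⟨hx, trivial⟩
  have hB : ∀ i k, dd (eX k) (dd (eP i) h) (x, P (x, 0)) =
      -(G' (Pi.single k 1) 0 * hess h i 0 (x, P (x, 0)) +
        G' (Pi.single k 1) 1 * hess h i 1 (x, P (x, 0))) := by
    intro i k
    have hφ : HasFDerivAt (fun x : Vec 2 => ((x, P (x, 0)) : Vec 2 × Vec 2)) _ x :=
      (hasFDerivAt_id x).prodMk hG.differentiableAt.hasFDerivAt
    have h1 := dd_comp (f := dd (eP i) h) (φ := fun x : Vec 2 => ((x, P (x, 0)) : Vec 2 × Vec 2))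
      (analyticAt_dd (hr.an _ hz) _) hφ.differentiableAt
      (Pi.single k 1)
    rw [dd_eq_zero_of_eqOn_const hD (f := fun x : Vec 2 => dd (eP i) h (x, P (x, 0)))
      (fun y hy => congrFun (hr.right y hy 0) i) _ x hx, hφ.fderiv, dd_eq_sum] at h1
    simp only [hess]
    fin_cases k <;> simp at h1 ⊢ <;> linarith
  have hbr := (hv.br_eq_zero hr.an 0 1 hz).2
  rw [br_two] at hbr
  simp only [hB] at hbr
  have hs := hess_symm (hr.an _ hz) 1 0
  have h01 : G' (Pi.single 0 1) 1 = G' (Pi.single 1 1) 0 := by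
    refine sub_eq_zero.1 ((mul_eq_zero.1 ?_).resolve_right (hr.det_ne_zero hz))
    simp only [hess] at hbr hs ⊢
    rw [hs] at hbr
    linear_combination hbr
  have hfd : fderiv ℝ (fun x => -P (x, 0)) x = -G' := fderiv_fun_neg
  intro i j
  rw [hfd]
  fin_cases i <;> fin_cases j <;> simp [-Fin.isValue, h01]

theorem analyticOnNhd_zero_velocity (hr : Reg D h P) : AnalyticOnNhd ℝ (fun x => -P (x, 0)) D :=
  fun x hx => (AnalyticAt.comp (f := fun x : Vec 2 => ((x, 0) : Vec 2 × Vec 2))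
    (hr.anP (x, 0) ⟨hx, trivial⟩) (analyticAt_id.prod analyticAt_const)).neg

/-- Shifting the momentum by the field on which the velocity vanishes is a permissible transformation,
and normalises the Hamiltonian. -/
theorem normalHam_gauge (hD : IsOpen D) (hDc : IsConnected D) (hr : Reg D h P) (hv : VelInd D h)
    (ha : ¬ ∃ (a : ℝ) (b : Vec 2), ∀ x ∈ D, ∀ p i, frc h i (x, p) = a * x i + b i) :
    ∃ P', NormalHam (newDom 1 D) (fun y => h (pull 1 1 (fun x => -P (x, 0)) y)) P' := by
  have hV := analyticOnNhd_zero_velocity hr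
  have hc := curlFree_zero_velocity hD hr hv
  have h1 : (1 : Matrix (Fin 2) (Fin 2) ℝ) * 1 = 1 := one_mul 1
  refine ⟨_, reg_pull h1 hV hr, isOpen_newDom h1 hD, isConnected_newDom hDc,
    velInd_pull h1 hD hV hc hr.an hv, fun x hx i => ?_, aniso_pull h1 hD hV hc hr.an ha⟩
  refine (vel_pull h1 hV hr.an i ⟨hx, trivial⟩).trans ?_
  have hp : pull 1 1 (fun x => -P (x, 0)) (x, 0) = (x, P (x, 0)) := by
    simp only [pull, Matrix.one_mulVec, Matrix.mulVec_zero, sub_neg_eq_add, zero_add]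
  have hx' : x ∈ D := by simpa only [Matrix.one_mulVec] using (mem_newDom h1).1 hx
  have hv0 : ∀ k, dd (eP k) h (x, P (x, 0)) = 0 := fun k => congrFun (hr.right x hx' 0) k
  simp only [hp, hv0, mul_zero, add_zero]

theorem NormalHam.linear (H : NormalHam D h P) (hMN : M * N = 1) :
    ∃ P', NormalHam (newDom N D) (fun y => h (pull N M 0 y)) P' := by
  have hV : AnalyticOnNhd ℝ (0 : Vec 2 → Vec 2) D := analyticOnNhd_const
  have hc : CurlFree D (0 : Vec 2 → Vec 2) := by
    intro x _ i j
    have : fderiv ℝ (0 : Vec 2 → Vec 2) x = 0 := by simp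
    rw [this]
    rfl
  refine ⟨_, reg_pull hMN hV H.toReg, isOpen_newDom hMN H.isOpen, isConnected_newDom H.conn,
    velInd_pull hMN H.isOpen hV hc H.an H.velInd, fun x hx i => ?_,
    aniso_pull hMN H.isOpen hV hc H.an H.aniso⟩
  refine (vel_pull hMN hV H.an i ⟨hx, trivial⟩).trans ?_
  have hp : pull N M 0 (x, 0) = (M *ᵥ x, 0) := by
    simp only [pull, Matrix.mulVec_zero, Pi.zero_apply, sub_zero]
  simp only [hp, H.normal _ ((mem_newDom hMN).1 hx), mul_zero, add_zero]

/-- Every linear relation between the entries of a symmetric form can be brought, by a change of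
basis, to one of three normal forms, according to the sign of the discriminant. -/
theorem exists_basis {k : Fin 3 → ℝ} (hk : k ≠ 0) : ∃ N : Matrix (Fin 2) (Fin 2) ℝ, N.det ≠ 0 ∧
    ((∀ a b c : ℝ, k 0 * a + k 1 * b + k 2 * c = 0 →
      N 0 0 * (N 0 0 * a + N 0 1 * b) + N 0 1 * (N 0 0 * b + N 0 1 * c) +
      (N 1 0 * (N 1 0 * a + N 1 1 * b) + N 1 1 * (N 1 0 * b + N 1 1 * c)) = 0) ∨
    (∀ a b c : ℝ, k 0 * a + k 1 * b + k 2 * c = 0 →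
      N 0 0 * (N 1 0 * a + N 1 1 * b) + N 0 1 * (N 1 0 * b + N 1 1 * c) = 0) ∨
    (∀ a b c : ℝ, k 0 * a + k 1 * b + k 2 * c = 0 →
      N 0 0 * (N 0 0 * a + N 0 1 * b) + N 0 1 * (N 0 0 * b + N 0 1 * c) = 0)) := by
  by_cases h0 : k 0 = 0
  · by_cases h1 : k 1 = 0
    · have h2 : k 2 ≠ 0 := fun h2 => hk (funext fun i => by fin_cases i <;> assumption)
      refine ⟨!![0, 1; 1, 0], by simp, Or.inr (Or.inr fun a b c h => ?_)⟩
      simp only [h0, h1, zero_mul, zero_add, mul_eq_zero, h2, false_or] at h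
      simp [h]
    · refine ⟨!![0, 1; k 1, k 2], by simp [h1], Or.inr (Or.inl fun a b c h => ?_)⟩
      simp
      rw [h0] at h
      linarith
  · rcases lt_trichotomy (k 1 ^ 2 - 4 * k 0 * k 2) 0 with hd | hd | hd
    · have hpos : 0 < (4 * k 0 * k 2 - k 1 ^ 2) / (4 * k 0 ^ 2) :=
        div_pos (by linarith) (by positivity)
      set s := √((4 * k 0 * k 2 - k 1 ^ 2) / (4 * k 0 ^ 2)) with hs
      have hs2 : s * s = (4 * k 0 * k 2 - k 1 ^ 2) / (4 * k 0 ^ 2) := Real.mul_self_sqrt hpos.le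
      refine ⟨!![1, k 1 / (2 * k 0); 0, s], by simpa using (Real.sqrt_pos.2 hpos).ne',
        Or.inl fun a b c h => ?_⟩
      have hs3 : k 0 * (s * s) * (4 * k 0) = 4 * k 0 * k 2 - k 1 ^ 2 := by
        rw [hs2]
        field_simp
      simp
      field_simp
      linear_combination 4 * k 0 * h + c * hs3
    · refine ⟨!![1, k 1 / (2 * k 0); 0, 1], by simp, Or.inr (Or.inr fun a b c h => ?_)⟩
      simp
      field_simp
      linear_combination 4 * k 0 * h + c * hd
    · set s := √(k 1 ^ 2 - 4 * k 0 * k 2) with hs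
      have hs2 : s * s = k 1 ^ 2 - 4 * k 0 * k 2 := Real.mul_self_sqrt hd.le
      have hs0 : s ≠ 0 := (Real.sqrt_pos.2 hd).ne'
      refine ⟨!![1, (k 1 - s) / (2 * k 0); 1, (k 1 + s) / (2 * k 0)], ?_,
        Or.inr (Or.inl fun a b c h => ?_)⟩
      · rw [Matrix.det_fin_two_of]
        intro h
        apply hs0
        field_simp at h
        linarith
      · simp
        field_simp
        linear_combination 4 * k 0 * h - c * hs2

end Normalisation

/-! ### Separable Hamiltonians -/

section Descent

variable {D : Set (Vec 2)} {h : Vec 2 × Vec 2 → ℝ} {P : Vec 2 × Vec 2 → Vec 2}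

theorem exists_coord_eq {i : Fin 2} (j : Fin 2) {w : ℝ × ℝ}
    (hw : w ∈ ((fun x : Vec 2 => x i) '' D) ×ˢ (univ : Set ℝ)) :
    ∃ z ∈ D ×ˢ (univ : Set (Vec 2)), coord i j z = w := by
  obtain ⟨x, hx, hxw⟩ := hw.1
  exact ⟨(x, fun _ => w.2), ⟨hx, trivial⟩, Prod.ext hxw rfl⟩

theorem dd_of_eq_comp_coord (hD : IsOpen D) {i j : Fin 2} {f : Vec 2 × Vec 2 → ℝ} {g : ℝ × ℝ → ℝ}
    (hg : AnalyticOnNhd ℝ g (((fun x : Vec 2 => x i) '' D) ×ˢ univ))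
    (hfg : EqOn f (fun z => g (coord i j z)) (D ×ˢ univ)) (e : Vec 2 × Vec 2) :
    EqOn (dd e f) (fun z => dd (coord i j e) g (coord i j z)) (D ×ˢ univ) := fun z hz => by
  rw [dd_congr_on (isOpen_phase hD) hfg e hz]
  exact dd_comp_coord (hg _ ⟨⟨z.1, hz.1, rfl⟩, trivial⟩) e

/-- A closed pair of functions on phase space that depend on one position and one momentum only is
the gradient of a function of these variables. -/
theorem exists_potential_comp_coord (hD : IsOpen D) (hDc : IsConnected D)
    {a b : Vec 2 × Vec 2 → ℝ} (ha : AnalyticOnNhd ℝ a (D ×ˢ univ))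
    (hb : AnalyticOnNhd ℝ b (D ×ˢ univ)) {i i' j j' : Fin 2} (hi : i ≠ i') (hj : j ≠ j')
    (haX : ∀ z ∈ D ×ˢ (univ : Set (Vec 2)), dd (eX i') a z = 0)
    (haP : ∀ z ∈ D ×ˢ (univ : Set (Vec 2)), dd (eP j') a z = 0)
    (hbX : ∀ z ∈ D ×ˢ (univ : Set (Vec 2)), dd (eX i') b z = 0)
    (hbP : ∀ z ∈ D ×ˢ (univ : Set (Vec 2)), dd (eP j') b z = 0)
    (hab : ∀ z ∈ D ×ˢ (univ : Set (Vec 2)), dd (eP j) a z = dd (eX i) b z) :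
    ∃ η : ℝ × ℝ → ℝ, AnalyticOnNhd ℝ η (((fun x : Vec 2 => x i) '' D) ×ˢ univ) ∧
      EqOn a (fun z => dd e1 η (coord i j z)) (D ×ˢ univ) ∧
      EqOn b (fun z => dd e2 η (coord i j z)) (D ×ˢ univ) := by
  obtain ⟨α, hα, hαa⟩ := exists_eq_comp_coord hD hDc ha hi hj haX haP
  obtain ⟨β, hβ, hβb⟩ := exists_eq_comp_coord hD hDc hb hi hj hbX hbP
  obtain ⟨η, hη, hηd⟩ := exists_potential (isOpen_projection hD i) (isConnected_projection hDc i)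
    hα hβ (by
      intro w hw
      obtain ⟨z, hz, rfl⟩ := exists_coord_eq j hw
      have := hab z hz
      rw [dd_of_eq_comp_coord hD hα hαa _ hz, dd_of_eq_comp_coord hD hβ hβb _ hz, coord_eP_self,
        coord_eX_self] at this
      exact this)
  exact ⟨η, hη,
    fun z hz => (hαa z hz).trans (hηd _ ⟨⟨z.1, hz.1, rfl⟩, trivial⟩).1.symm,
    fun z hz => (hβb z hz).trans (hηd _ ⟨⟨z.1, hz.1, rfl⟩, trivial⟩).2.symm⟩

/-- A velocity that depends on one position and one momentum only is the velocity of a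
Hamiltonian of one degree of freedom, provided the force is also that of the latter. -/
theorem exists_good1_of_velocity (hD : IsOpen D) (hDc : IsConnected D) (hr : Reg D h P)
    (hv : VelInd D h) {i j : Fin 2} {η : ℝ × ℝ → ℝ}
    (hη : AnalyticOnNhd ℝ η (((fun x : Vec 2 => x i) '' D) ×ˢ univ))
    (hb : EqOn (dd (eP i) h) (fun z => dd e2 η (coord i j z)) (D ×ˢ univ))
    (hne : ∀ z ∈ D ×ˢ (univ : Set (Vec 2)), dd (eP j) (dd (eP i) h) z ≠ 0)
    (hF : ∀ z ∈ D ×ˢ (univ : Set (Vec 2)), frc h i z =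
      dd (eX i) (dd (eP i) h) z * dd (eP i) h z -
        dd e1 η (coord i j z) * dd (eP j) (dd (eP i) h) z) :
    ∃ Q F, Good1 ((fun x : Vec 2 => x i) '' D) η Q F := by
  set I := (fun x : Vec 2 => x i) '' D with hI
  have hb2 := analyticOnNhd_dd hη e2
  have hne' : ∀ w ∈ I ×ˢ (univ : Set ℝ), dd e2 (dd e2 η) w ≠ 0 := by
    intro w hw
    obtain ⟨z, hz, rfl⟩ := exists_coord_eq j hw
    have := hne z hz
    rwa [dd_of_eq_comp_coord hD hb2 hb _ hz, coord_eP_self] at this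
  -- the momentum derivative of the velocity has no zeros, so the velocity is injective
  have hinj : ∀ t ∈ I, ∀ p q, dd e2 η (t, p) = dd e2 η (t, q) → p = q := by
    intro t ht
    have hderiv : ∀ p, HasDerivAt (fun p => dd e2 η (t, p)) (dd e2 (dd e2 η) (t, p)) p := fun p =>
      hasDerivAt_snd (hb2 _ ⟨ht, trivial⟩)
    have hlt : ∀ p q, p < q → dd e2 η (t, p) ≠ dd e2 η (t, q) := by
      intro p q hpq heq
      obtain ⟨c, -, hc⟩ := exists_hasDerivAt_eq_zero hpq
        (fun s _ => (hderiv s).continuousAt.continuousWithinAt) heq fun s _ => hderiv s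
      exact hne' (t, c) ⟨ht, trivial⟩ hc
    intro p q heq
    by_contra hpq
    rcases lt_or_gt_of_ne hpq with hlt' | hlt'
    · exact hlt p q hlt' heq
    · exact hlt q p hlt' heq.symm
  have hex : ∀ t ∈ I, ∃ x ∈ D, x i = t := fun t ht => ht
  choose! c hcD hci using hex
  have hval : ∀ y ∈ D, ∀ v, dd e2 η (y i, P (y, Pi.single i v) j) = v := by
    intro y hy v
    have h1 := congrFun (hr.right y hy (Pi.single i v)) i
    rw [vel, hb ⟨hy, trivial⟩] at h1
    simpa [coord_apply] using h1
  obtain ⟨F, hF'⟩ := hv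
  refine ⟨fun w => P (c w.1, Pi.single i w.2) j, fun t => F (c t) i, isOpen_projection hD i,
    isConnected_projection hDc i, hη, ?_, ?_, ?_, ?_⟩
  · rintro ⟨t₀, v₀⟩ ⟨ht₀, -⟩
    let y : ℝ × ℝ → Vec 2 × Vec 2 := fun w =>
      (c t₀ + (w.1 - t₀) • (Pi.single i 1 : Vec 2), w.2 • (Pi.single i 1 : Vec 2))
    have hy : AnalyticAt ℝ y (t₀, v₀) :=
      (analyticAt_const.add ((analyticAt_fst.sub analyticAt_const).smul analyticAt_const)).prod
        (analyticAt_snd.smul analyticAt_const)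
    have hy0 : y (t₀, v₀) = (c t₀, v₀ • (Pi.single i 1 : Vec 2)) := by simp [y]
    have hQ : AnalyticAt ℝ (fun w => P (y w) j) (t₀, v₀) := by
      have h1 : AnalyticAt ℝ (fun w => P (y w)) (t₀, v₀) :=
        AnalyticAt.comp_of_eq (hr.anP _ ⟨hcD t₀ ht₀, trivial⟩) hy hy0
      exact AnalyticAt.comp (g := fun v : Vec 2 => v j)
        ((ContinuousLinearMap.proj (R := ℝ) (φ := fun _ : Fin 2 => ℝ) j).analyticAt _) h1
    refine hQ.congr ?_
    have hev : ∀ᶠ w in 𝓝 (t₀, v₀), (y w).1 ∈ D := by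
      have h1 := continuous_fst.continuousAt.comp hy.continuousAt
      refine h1.eventually (p := fun x => x ∈ D) ?_
      simp only [Function.comp, hy0]
      exact hD.mem_nhds (hcD t₀ ht₀)
    filter_upwards [hev] with w hw
    have hyi : (y w).1 i = w.1 := by simp [y, hci t₀ ht₀]
    have hwI : w.1 ∈ I := ⟨_, hw, hyi⟩
    have hyw : y w = ((y w).1, Pi.single i w.2) := by
      refine Prod.ext rfl ?_
      funext k
      simp [y, Pi.single_apply]
    refine hinj w.1 hwI _ _ ?_
    have h1 := hval _ hw w.2
    rw [← hyw, hyi] at h1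
    have h2 := hval _ (hcD _ hwI) w.2
    rw [hci _ hwI] at h2
    rw [h1, h2]
  · intro t ht p
    refine hinj t ht _ _ ?_
    have := hval _ (hcD t ht) (dd e2 η (t, p))
    rwa [hci t ht] at this
  · intro t ht v
    have := hval _ (hcD t ht) v
    rwa [hci t ht] at this
  · intro t ht p
    have hz : (c t, (fun _ => p : Vec 2)) ∈ D ×ˢ (univ : Set (Vec 2)) := ⟨hcD t ht, trivial⟩
    have h1 := hF _ hz
    have hw : coord i j (c t, (fun _ => p : Vec 2)) = (t, p) := Prod.ext (hci t ht) rfl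
    rw [hF' _ (hcD t ht), dd_of_eq_comp_coord hD hb2 hb _ hz, dd_of_eq_comp_coord hD hb2 hb _ hz,
      hb hz, coord_eX_self, coord_eP_self] at h1
    simp only [hw] at h1
    exact h1.symm

theorem Good1.add_const {I : Set ℝ} {η Q : ℝ × ℝ → ℝ} {F : ℝ → ℝ} (hη : Good1 I η Q F) (c : ℝ) :
    Good1 I (fun w => η w + c) Q F := by
  have hdd : ∀ e, dd e (fun w => η w + c) = dd e η := fun e => funext fun w => by simp [dd]
  refine ⟨hη.isOpen, hη.conn, fun z hz => (hη.an z hz).add analyticAt_const, hη.anQ, ?_, ?_, ?_⟩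
  · rw [hdd]
    exact hη.left
  · rw [hdd]
    exact hη.right
  · simp only [br1, hdd]
    exact hη.force

end Descent

section Hyperbolic

variable {D : Set (Vec 2)} {H : PhaseFun 2} {h : Vec 2 × Vec 2 → ℝ} {P : Vec 2 × Vec 2 → Vec 2}

/-- If one entry of `hessVec` vanishes then in the second case of the alternative the constant vector
may be taken to be a coordinate vector. -/
theorem NormalHam.alternative_of_hessVec_eq_zero (H : NormalHam D h P) {m : Fin 3}
    (hm : ∀ z ∈ D ×ˢ (univ : Set (Vec 2)), hessVec h m z = 0) :
    (∀ z ∈ D ×ˢ (univ : Set (Vec 2)), ∀ i j,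
      hessVec h i z * hessVec h j (z.1, 0) = hessVec h j z * hessVec h i (z.1, 0)) ∨
    ∀ i, i ≠ m → ∀ z ∈ D ×ˢ (univ : Set (Vec 2)), jacVec h i z = 0 := by
  rcases H.alternative with hQ | ⟨k, hk, hka, hkw⟩
  · exact Or.inl hQ
  by_cases hk0 : ∀ i, i ≠ m → k i = 0
  · right
    have hkm : k m ≠ 0 := fun h0 => hk (funext fun i => by
      by_cases him : i = m
      · rw [him]
        exact h0
      · exact hk0 i him)
    intro i hi z hz
    have := hkw z hz i m
    rw [hk0 i hi, mul_zero] at this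
    exact (mul_eq_zero.1 this).resolve_right hkm
  · left
    push Not at hk0
    obtain ⟨i, him, hi⟩ := hk0
    intro z hz
    have hz0 : (z.1, (0 : Vec 2)) ∈ D ×ˢ (univ : Set (Vec 2)) := ⟨hz.1, trivial⟩
    have hu : ∀ z ∈ D ×ˢ (univ : Set (Vec 2)), hessVec h 0 z * (Pi.single m 1 : Fin 3 → ℝ) 0 +
        hessVec h 1 z * (Pi.single m 1 : Fin 3 → ℝ) 1 +
        hessVec h 2 z * (Pi.single m 1 : Fin 3 → ℝ) 2 = 0 := by
      intro z hz
      have := hm z hz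
      fin_cases m <;> simpa using this
    have hc : ∀ l, (crossProduct (fun i => hessVec h i z) (fun i => hessVec h i (z.1, 0))) l = 0 := by
      intro l
      have := crossProduct_mul_eq_zero (a := fun i => hessVec h i z)
        (b := fun i => hessVec h i (z.1, 0)) (w := k) (u := Pi.single m 1)
        (by have := hka z hz; linarith) (by have := hka _ hz0; linarith) (hu z hz) (hu _ hz0) l i m
      simpa [him, hi] using this
    intro a b
    have h0 := hc 0
    have h1 := hc 1
    have h2 := hc 2
    simp only [cross_apply, Matrix.cons_val] at h0 h1 h2
    fin_cases a <;> fin_cases b <;> simp <;> linarith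

theorem NormalHam.dd_eX_velocity_zero (H : NormalHam D h P) (i k : Fin 2) {x : Vec 2}
    (hx : x ∈ D) : dd (eX k) (dd (eP i) h) (x, 0) = 0 := by
  have h1 := dd_comp_clm (f := dd (eP i) h) (ContinuousLinearMap.inl ℝ (Vec 2) (Vec 2)) (z := x)
    (analyticAt_dd (H.an (x, 0) ⟨hx, trivial⟩) _) (Pi.single k 1)
  rw [dd_eq_zero_of_eqOn_const H.isOpen (f := fun y =>
    dd (eP i) h (ContinuousLinearMap.inl ℝ (Vec 2) (Vec 2) y))
    (fun y hy => H.normal y hy i) _ x hx] at h1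
  exact h1.symm

/-- A Hamiltonian whose mixed second momentum derivative vanishes, and whose force components
depend on one position each, has no mixed second derivatives at all. -/
theorem NormalHam.mixed_eq_zero (H : NormalHam D h P)
    (hA : ∀ z ∈ D ×ˢ (univ : Set (Vec 2)), dd (eP 1) (dd (eP 0) h) z = 0)
    (hJ : ∀ z ∈ D ×ˢ (univ : Set (Vec 2)), dd (eX 1) (frc h 0) z = 0) :
    (∀ z ∈ D ×ˢ (univ : Set (Vec 2)), dd (eX 1) (dd (eP 0) h) z = 0) ∧
    (∀ z ∈ D ×ˢ (univ : Set (Vec 2)), dd (eX 0) (dd (eP 1) h) z = 0) ∧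
    ∀ z ∈ D ×ˢ (univ : Set (Vec 2)), dd (eX 1) (dd (eX 0) h) z = 0 := by
  have hUo := isOpen_phase H.isOpen
  have a := fun e => analyticOnNhd_dd H.an e
  have aa := fun e e' => analyticOnNhd_dd (a e) e'
  have hA' : ∀ z ∈ D ×ˢ (univ : Set (Vec 2)), dd (eP 0) (dd (eP 1) h) z = 0 := fun z hz => by
    rw [dd_comm (H.an z hz), hA z hz]
  have hdet : ∀ z ∈ D ×ˢ (univ : Set (Vec 2)), dd (eP 0) (dd (eP 0) h) z ≠ 0 ∧
      dd (eP 1) (dd (eP 1) h) z ≠ 0 := by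
    intro z hz
    have := H.toReg.det_ne_zero hz
    simp only [hess, hA z hz] at this
    constructor <;> intro h0 <;> simp [h0] at this
  have hrel : ∀ z ∈ D ×ˢ (univ : Set (Vec 2)), dd (eX 1) (dd (eP 0) h) z *
      dd (eP 1) (dd (eP 1) h) z = dd (eX 0) (dd (eP 1) h) z * dd (eP 0) (dd (eP 0) h) z := by
    intro z hz
    have := (H.velInd.br_eq_zero H.an 0 1 hz).2
    rw [br_two, hA z hz, hA' z hz] at this
    linarith
  -- the common ratio does not depend on the momenta
  let ρ : Vec 2 × Vec 2 → ℝ := fun z => dd (eX 1) (dd (eP 0) h) z / dd (eP 0) (dd (eP 0) h) z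
  have hρ' : EqOn ρ (fun z => dd (eX 0) (dd (eP 1) h) z / dd (eP 1) (dd (eP 1) h) z)
      (D ×ˢ univ) := by
    intro z hz
    have := hrel z hz
    simp only [ρ]
    rw [div_eq_div_iff (hdet z hz).1 (hdet z hz).2, this]
  have hρ0 : ∀ x ∈ D, ∀ p, ρ (x, p) = 0 := by
    intro x hx p
    have h0 : ρ (x, 0) = 0 := by simp [ρ, H.dd_eX_velocity_zero 0 1 hx]
    rw [← h0]
    refine eq_of_dd_eP_eq_zero (D := D)
      (fun z hz => (aa _ _ z hz).div (aa _ _ z hz) (hdet z hz).1) (fun i z hz => ?_) hx p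
    fin_cases i
    · change dd (eP 0) ρ z = 0
      rw [dd_congr_on hUo hρ' _ hz, dd_div (aa _ _ z hz) (aa _ _ z hz) (hdet z hz).2,
        dd_comm (a _ z hz) (eP 0) (eX 0), dd_comm (a _ z hz) (eP 0) (eP 1),
        dd_eq_zero_of_eqOn_const hUo hA' _ z hz, dd_eq_zero_of_eqOn_const hUo hA' _ z hz]
      simp
    · change dd (eP 1) (fun z => dd (eX 1) (dd (eP 0) h) z / dd (eP 0) (dd (eP 0) h) z) z = 0
      rw [dd_div (aa _ _ z hz) (aa _ _ z hz) (hdet z hz).1,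
        dd_comm (a _ z hz) (eP 1) (eX 1), dd_comm (a _ z hz) (eP 1) (eP 0),
        dd_eq_zero_of_eqOn_const hUo hA _ z hz, dd_eq_zero_of_eqOn_const hUo hA _ z hz]
      simp
  have hB01 : ∀ z ∈ D ×ˢ (univ : Set (Vec 2)), dd (eX 1) (dd (eP 0) h) z = 0 := fun z hz =>
    (div_eq_zero_iff.1 (hρ0 z.1 hz.1 z.2)).resolve_right (hdet z hz).1
  have hB10 : ∀ z ∈ D ×ˢ (univ : Set (Vec 2)), dd (eX 0) (dd (eP 1) h) z = 0 := fun z hz =>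
    (div_eq_zero_iff.1 ((hρ' hz).symm.trans (hρ0 z.1 hz.1 z.2))).resolve_right (hdet z hz).2
  refine ⟨hB01, hB10, fun z hz => ?_⟩
  have hf : EqOn (frc h 0) (fun z => dd (eX 0) (dd (eP 0) h) z * dd (eP 0) h z -
      dd (eX 0) h z * dd (eP 0) (dd (eP 0) h) z) (D ×ˢ univ) := by
    intro z hz
    simp only [frc, br_two]
    rw [hB01 z hz, hA z hz]
    ring
  have h1 := hJ z hz
  rw [dd_congr_on hUo hf _ hz, dd_sub ((aa _ _ z hz).fun_mul (a _ z hz))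
    ((a _ z hz).fun_mul (aa _ _ z hz)), dd_mul (aa _ _ z hz) (a _ z hz),
    dd_mul (a _ z hz) (aa _ _ z hz), dd_comm (a _ z hz) (eX 1) (eX 0),
    dd_comm (a _ z hz) (eX 1) (eP 0), dd_eq_zero_of_eqOn_const hUo hB01 _ z hz,
    dd_eq_zero_of_eqOn_const hUo hB01 _ z hz, hB01 z hz] at h1
  have h2 : dd (eX 1) (dd (eX 0) h) z * dd (eP 0) (dd (eP 0) h) z = 0 := by linarith
  exact (mul_eq_zero.1 h2).resolve_right (hdet z hz).1

/-- The mixed second derivatives of `H` vanish, so that each velocity depends on its own position and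
momentum only, and each integrates to a Hamiltonian of one degree of freedom. -/
theorem NormalHam.isSeparable (hH : NormalHam D (unc H) P)
    (hA : ∀ z ∈ D ×ˢ (univ : Set (Vec 2)), hess (unc H) 0 1 z = 0)
    (hJ : ∀ z ∈ D ×ˢ (univ : Set (Vec 2)), forceJac (unc H) 0 1 z = 0) : IsSeparable D H := by
  have hD := hH.isOpen
  have hUo := isOpen_phase hD
  have a := fun e => analyticOnNhd_dd hH.an e
  obtain ⟨hB01, hB10, hC⟩ := hH.mixed_eq_zero hA hJ
  have c : ∀ {e e' : Vec 2 × Vec 2}, (∀ z ∈ D ×ˢ (univ : Set (Vec 2)), dd e (dd e' (unc H)) z = 0) →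
      ∀ z ∈ D ×ˢ (univ : Set (Vec 2)), dd e' (dd e (unc H)) z = 0 := fun hz z hzU => by
    rw [dd_comm (hH.an z hzU), hz z hzU]
  have hdet : ∀ z ∈ D ×ˢ (univ : Set (Vec 2)), dd (eP 0) (dd (eP 0) (unc H)) z ≠ 0 ∧
      dd (eP 1) (dd (eP 1) (unc H)) z ≠ 0 := by
    intro z hz
    have := hH.toReg.det_ne_zero hz
    have h0 := hA z hz
    simp only [hess] at this h0
    rw [h0] at this
    constructor <;> intro h0 <;> simp [h0] at this
  have hpot : ∀ i i' : Fin 2, i ≠ i' →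
      (∀ z ∈ D ×ˢ (univ : Set (Vec 2)), dd (eX i') (dd (eX i) (unc H)) z = 0) →
      (∀ z ∈ D ×ˢ (univ : Set (Vec 2)), dd (eP i') (dd (eX i) (unc H)) z = 0) →
      (∀ z ∈ D ×ˢ (univ : Set (Vec 2)), dd (eX i') (dd (eP i) (unc H)) z = 0) →
      (∀ z ∈ D ×ˢ (univ : Set (Vec 2)), dd (eP i') (dd (eP i) (unc H)) z = 0) →
      (∀ z ∈ D ×ˢ (univ : Set (Vec 2)), dd (eP i) (dd (eP i) (unc H)) z ≠ 0) →
      ∃ η Q F, Good1 ((fun x : Vec 2 => x i) '' D) η Q F ∧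
        EqOn (dd (eX i) (unc H)) (fun z => dd e1 η (coord i i z)) (D ×ˢ univ) ∧
        EqOn (dd (eP i) (unc H)) (fun z => dd e2 η (coord i i z)) (D ×ˢ univ) := by
    intro i i' hi h1 h2 h3 h4 h5
    obtain ⟨η, hη, hη1, hη2⟩ := exists_potential_comp_coord hD hH.conn (a (eX i)) (a (eP i)) hi hi
      h1 h2 h3 h4 (fun z hz => dd_comm (hH.an z hz) _ _)
    obtain ⟨Q, F, hQ⟩ := exists_good1_of_velocity hD hH.conn hH.toReg hH.velInd hη hη2 h5 (by
      intro z hz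
      have h0 : _ = dd e1 η (coord i i z) := hη1 hz
      rw [← h0, frc, br_two]
      have h3 := h3 z hz
      have h4 := h4 z hz
      fin_cases i <;> fin_cases i' <;> simp [-Fin.isValue] at hi h3 h4 ⊢ <;> rw [h3, h4] <;> ring)
    exact ⟨η, Q, F, hQ, hη1, hη2⟩
  obtain ⟨α, Q₁, F₁, hα, hα1, hα2⟩ := hpot 0 1 (by decide) hC (c hB10) hB01 hA fun z hz =>
    (hdet z hz).1
  obtain ⟨β, Q₂, F₂, hβ, hβ1, hβ2⟩ := hpot 1 0 (by decide) (c hC) (c hB01) hB10 (c hA) fun z hz =>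
    (hdet z hz).2
  have hα0 : ∀ z ∈ D ×ˢ (univ : Set (Vec 2)), AnalyticAt ℝ α (coord 0 0 z) := fun z hz =>
    hα.an _ ⟨⟨z.1, hz.1, rfl⟩, trivial⟩
  have hβ0 : ∀ z ∈ D ×ˢ (univ : Set (Vec 2)), AnalyticAt ℝ β (coord 1 1 z) := fun z hz =>
    hβ.an _ ⟨⟨z.1, hz.1, rfl⟩, trivial⟩
  have hsum : ∀ z ∈ D ×ˢ (univ : Set (Vec 2)),
      AnalyticAt ℝ (fun z => α (coord 0 0 z) + β (coord 1 1 z)) z := fun z hz =>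
    (analyticAt_comp_coord (hα0 z hz)).add (analyticAt_comp_coord (hβ0 z hz))
  have hX0 : coord 1 1 (eX 0) = 0 := coord_eX_of_ne (by decide)
  have hX1 : coord 0 0 (eX 1) = 0 := coord_eX_of_ne (by decide)
  have hP0 : coord 1 1 (eP 0) = 0 := coord_eP_of_ne (by decide)
  have hP1 : coord 0 0 (eP 1) = 0 := coord_eP_of_ne (by decide)
  have hd : ∀ e, ∀ z ∈ D ×ˢ (univ : Set (Vec 2)),
      dd e (fun z => unc H z - (α (coord 0 0 z) + β (coord 1 1 z))) z = dd e (unc H) z -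
        (dd (coord 0 0 e) α (coord 0 0 z) + dd (coord 1 1 e) β (coord 1 1 z)) := by
    intro e z hz
    rw [dd_sub (hH.an z hz) (hsum z hz), dd_separable (hα0 z hz) (hβ0 z hz)]
  obtain ⟨x₀, hx₀⟩ := hH.conn.nonempty
  have hconst := const_of_dd_eq_zero hD hH.conn
    (fun z hz => (hH.an z hz).sub (hsum z hz)) (fun i z hz => by
      refine (hd _ z hz).trans ?_
      fin_cases i
      · simp [hX0, coord_eX_self, dd_zero_dir, hα1 hz]
      · simp [hX1, coord_eX_self, dd_zero_dir, hβ1 hz]) (fun i z hz => by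
      refine (hd _ z hz).trans ?_
      fin_cases i
      · simp [hP0, coord_eP_self, dd_zero_dir, hα2 hz]
      · simp [hP1, coord_eP_self, dd_zero_dir, hβ2 hz])
  set k := unc H (x₀, 0) - (α (coord 0 0 (x₀, 0)) + β (coord 1 1 (x₀, 0)))
  refine ⟨_, _, fun x p => α (x, p) + k, fun x p => β (x, p), isGood1D_iff.2 ⟨_, _, hα.add_const k⟩,
    isGood1D_iff.2 ⟨_, _, hβ⟩, fun x hx => ⟨⟨x, hx, rfl⟩, ⟨x, hx, rfl⟩⟩, fun x hx p => ?_⟩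
  have := hconst (x, p) ⟨hx, trivial⟩ (x₀, 0) ⟨hx₀, trivial⟩
  change unc H (x, p) - (α (x 0, p 0) + β (x 1, p 1)) = k at this
  change unc H (x, p) = _
  linarith

end Hyperbolic

/-! ### Reduction to Seesaw Hamiltonians -/

section Parabolic

variable {D : Set (Vec 2)} {H : PhaseFun 2} {h : Vec 2 × Vec 2 → ℝ} {P : Vec 2 × Vec 2 → Vec 2}

/-- If the Hamiltonian is affine in `p_x` and the first component of the force depends on `x` only,
then the Hamiltonian is affine in `y` as well, and the velocity along `x` does not depend on `y`. -/
theorem NormalHam.affine_of_hess_eq_zero (H : NormalHam D h P)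
    (hA : ∀ z ∈ D ×ˢ (univ : Set (Vec 2)), dd (eP 0) (dd (eP 0) h) z = 0)
    (hJ : ∀ z ∈ D ×ˢ (univ : Set (Vec 2)), dd (eX 1) (frc h 0) z = 0) :
    (∀ z ∈ D ×ˢ (univ : Set (Vec 2)), dd (eP 1) (dd (eP 0) h) z ≠ 0) ∧
    (∀ z ∈ D ×ˢ (univ : Set (Vec 2)), dd (eX 1) (dd (eP 0) h) z = 0) ∧
    (∀ z ∈ D ×ˢ (univ : Set (Vec 2)), dd (eP 1) (dd (eX 1) h) z = dd (eX 0) (dd (eP 0) h) z) ∧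
    ∀ z ∈ D ×ˢ (univ : Set (Vec 2)), dd (eX 1) (dd (eX 1) h) z = 0 := by
  have hUo := isOpen_phase H.isOpen
  have a := fun e => analyticOnNhd_dd H.an e
  have aa := fun e e' => analyticOnNhd_dd (a e) e'
  have hr1 : ∀ z ∈ D ×ˢ (univ : Set (Vec 2)), dd (eP 1) (dd (eP 0) h) z ≠ 0 := by
    intro z hz h0
    refine H.toReg.det_ne_zero hz ?_
    simp only [hess, hA z hz, h0]
    ring
  have hvv : ∀ z ∈ D ×ˢ (univ : Set (Vec 2)), dd (eX 0) (dd (eP 0) h) z * dd (eP 1) (dd (eP 0) h) z +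
      dd (eX 1) (dd (eP 0) h) z * dd (eP 1) (dd (eP 1) h) z -
      dd (eP 1) (dd (eX 1) h) z * dd (eP 1) (dd (eP 0) h) z = 0 := by
    intro z hz
    have := (H.velInd.br_eq_zero H.an 0 1 hz).2
    rw [br_two, hA z hz, dd_comm (H.an z hz) (eP 0) (eP 1), dd_comm (H.an z hz) (eX 1) (eP 1)] at this
    linear_combination this
  -- the ratio of `∂_y v_x` to `∂_{p_y} v_x` does not depend on the momenta
  have hy : ∀ z ∈ D ×ˢ (univ : Set (Vec 2)), dd (eX 1) (dd (eP 0) h) z = 0 := by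
    have hPX : ∀ e, ∀ z ∈ D ×ˢ (univ : Set (Vec 2)), dd (eP 0) (dd e (dd (eP 0) h)) z = 0 := by
      intro e z hz
      rw [dd_comm (a _ z hz)]
      exact dd_eq_zero_of_eqOn_const hUo hA _ z hz
    have hratio : ∀ z ∈ D ×ˢ (univ : Set (Vec 2)),
        dd (eX 1) (dd (eP 0) h) z * dd (eP 1) (dd (eP 1) (dd (eP 0) h)) z =
          dd (eP 1) (dd (eX 1) (dd (eP 0) h)) z * dd (eP 1) (dd (eP 0) h) z := by
      intro z hz
      have h1 := dd_eq_zero_of_eqOn_const hUo hvv (eP 0) z hz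
      rw [dd_sub (((aa _ _ z hz).fun_mul (aa _ _ z hz)).fun_add ((aa _ _ z hz).fun_mul (aa _ _ z hz)))
        ((aa _ _ z hz).fun_mul (aa _ _ z hz)), dd_add ((aa _ _ z hz).fun_mul (aa _ _ z hz))
        ((aa _ _ z hz).fun_mul (aa _ _ z hz)), dd_mul (aa _ _ z hz) (aa _ _ z hz),
        dd_mul (aa _ _ z hz) (aa _ _ z hz), dd_mul (aa _ _ z hz) (aa _ _ z hz), hPX _ z hz,
        hPX _ z hz, hPX _ z hz, dd_comm (a _ z hz) (eP 0) (eP 1), dd_comm (a _ z hz) (eP 0) (eP 1),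
        dd_comm_inner (H.an z hz) (eP 1) (eP 0) (eP 1),
        dd_comm_inner (H.an z hz) (eP 1) (eP 0) (eX 1)] at h1
      linear_combination h1
    let ρ : Vec 2 × Vec 2 → ℝ := fun z => dd (eX 1) (dd (eP 0) h) z / dd (eP 1) (dd (eP 0) h) z
    intro z hz
    have hρ : ρ (z.1, z.2) = ρ (z.1, 0) := by
      refine eq_of_dd_eP_eq_zero (D := D)
        (fun z hz => (aa _ _ z hz).div (aa _ _ z hz) (hr1 z hz)) (fun i z hz => ?_) hz.1 z.2
      change dd (eP i) (fun z => dd (eX 1) (dd (eP 0) h) z / dd (eP 1) (dd (eP 0) h) z) z = 0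
      rw [dd_div (aa _ _ z hz) (aa _ _ z hz) (hr1 z hz)]
      fin_cases i
      · change (dd (eP 0) (dd (eX 1) (dd (eP 0) h)) z * _ -
          _ * dd (eP 0) (dd (eP 1) (dd (eP 0) h)) z) / _ = 0
        rw [hPX _ z hz, hPX _ z hz]
        simp
      · change (dd (eP 1) (dd (eX 1) (dd (eP 0) h)) z * _ -
          _ * dd (eP 1) (dd (eP 1) (dd (eP 0) h)) z) / _ = 0
        rw [hratio z hz, sub_self, zero_div]
    have h0 : ρ (z.1, 0) = 0 := by simp [ρ, H.dd_eX_velocity_zero 0 1 hz.1]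
    exact (div_eq_zero_iff.1 (hρ.trans h0)).resolve_right (hr1 z hz)
  refine ⟨hr1, hy, fun z hz => ?_, fun z hz => ?_⟩
  · have h1 := hvv z hz
    rw [hy z hz] at h1
    exact mul_right_cancel₀ (hr1 z hz) (by linarith)
  · have hf : EqOn (frc h 0) (fun z => dd (eX 0) (dd (eP 0) h) z * dd (eP 0) h z -
        dd (eX 1) h z * dd (eP 1) (dd (eP 0) h) z) (D ×ˢ univ) := by
      intro z hz
      simp only [frc, br_two]
      rw [hy z hz, hA z hz]
      ring
    have h1 := hJ z hz
    rw [dd_congr_on hUo hf _ hz, dd_sub ((aa _ _ z hz).fun_mul (a _ z hz))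
      ((a _ z hz).fun_mul (aa _ _ z hz)), dd_mul (aa _ _ z hz) (a _ z hz),
      dd_mul (a _ z hz) (aa _ _ z hz), dd_comm (a _ z hz) (eX 1) (eX 0),
      dd_comm (a _ z hz) (eX 1) (eP 1), dd_eq_zero_of_eqOn_const hUo hy _ z hz,
      dd_eq_zero_of_eqOn_const hUo hy _ z hz, hy z hz] at h1
    have h2 : dd (eX 1) (dd (eX 1) h) z * dd (eP 1) (dd (eP 0) h) z = 0 := by linarith
    exact (mul_eq_zero.1 h2).resolve_right (hr1 z hz)

/-- The Seesaw form with an unspecified term `s(x, p_y)`: the coefficients of `y` and of `p_x` in `H`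
are the derivatives of a function `η`, and what is left of the force is one equation for `s`. -/
theorem NormalHam.exists_eq_seesaw (H : NormalHam D h P)
    (hA : ∀ z ∈ D ×ˢ (univ : Set (Vec 2)), hess h 0 0 z = 0)
    (hJ : ∀ z ∈ D ×ˢ (univ : Set (Vec 2)), forceJac h 0 1 z = 0) :
    ∃ (η Q s : ℝ × ℝ → ℝ) (F g : ℝ → ℝ), Good1 ((fun x : Vec 2 => x 0) '' D) η Q F ∧
      (∀ x ∈ (fun x : Vec 2 => x 0) '' D, dd e2 η (x, 0) = 0) ∧
      AnalyticOnNhd ℝ s (((fun x : Vec 2 => x 0) '' D) ×ˢ univ) ∧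
      (∀ x ∈ (fun x : Vec 2 => x 0) '' D, ∀ p, seesawForce η s (x, p) = g x) ∧
      EqOn h (seesaw (dd e1 η) (dd e2 η) s) (D ×ˢ univ) := by
  have hD := H.isOpen
  have hUo := isOpen_phase hD
  have a := fun e => analyticOnNhd_dd H.an e
  obtain ⟨hr1, hy, hcl, hyy⟩ := H.affine_of_hess_eq_zero hA hJ
  obtain ⟨η, hη, hη1, hη2⟩ := exists_potential_comp_coord (i := 0) (i' := 1) (j := 1) (j' := 0) hD
    H.conn (a (eX 1)) (a (eP 0)) (by decide) (by decide) hyy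
    (fun z hz => by rw [dd_comm (H.an z hz), hy z hz]) hy hA hcl
  obtain ⟨Q, F, hQ⟩ := exists_good1_of_velocity hD H.conn H.toReg H.velInd hη hη2 hr1 (by
    intro z hz
    have h0 : _ = dd e1 η (coord 0 1 z) := hη1 hz
    have h1 := hA z hz
    simp only [hess] at h1
    rw [← h0, frc, br_two, hy z hz, h1]
    ring)
  have hm : ∀ z ∈ D ×ˢ (univ : Set (Vec 2)),
      coord 0 1 z ∈ ((fun x : Vec 2 => x 0) '' D) ×ˢ (univ : Set ℝ) := fun z hz =>
    ⟨⟨z.1, hz.1, rfl⟩, trivial⟩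
  have hηx := analyticOnNhd_dd hη e1
  have hηp := analyticOnNhd_dd hη e2
  have hc : ∀ w : ℝ × ℝ, AnalyticAt ℝ (fun _ : ℝ × ℝ => (0 : ℝ)) w := fun _ => analyticAt_const
  have hsee : ∀ z ∈ D ×ˢ (univ : Set (Vec 2)),
      AnalyticAt ℝ (seesaw (dd e1 η) (dd e2 η) fun _ => 0) z := fun z hz =>
    analyticAt_seesaw (hηx _ (hm z hz)) (hηp _ (hm z hz)) (hc _)
  obtain ⟨s, hs, hsh⟩ := exists_eq_comp_coord hD H.conn
    (f := fun z => h z - seesaw (dd e1 η) (dd e2 η) (fun _ => 0) z)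
    (fun z hz => (H.an z hz).sub (hsee z hz)) (i := 0) (i' := 1) (j := 1) (j' := 0) (by decide)
    (by decide) (fun z hz => by
      rw [dd_sub (H.an z hz) (hsee z hz), dd_eX1_seesaw (hηx _ (hm z hz)) (hηp _ (hm z hz)) (hc _)]
      exact sub_eq_zero.2 (hη1 hz)) (fun z hz => by
      rw [dd_sub (H.an z hz) (hsee z hz), dd_eP0_seesaw (hηx _ (hm z hz)) (hηp _ (hm z hz)) (hc _)]
      exact sub_eq_zero.2 (hη2 hz))
  have hh : EqOn h (seesaw (dd e1 η) (dd e2 η) s) (D ×ˢ univ) := by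
    intro z hz
    have := hsh z hz
    simp only [seesaw] at this ⊢
    linarith
  obtain ⟨F₁, hF₁⟩ := H.velInd
  have hex : ∀ t ∈ (fun x : Vec 2 => x 0) '' D, ∃ x ∈ D, x 0 = t := fun t ht => ht
  choose! c hcD hci using hex
  refine ⟨η, Q, s, F, fun t => F₁ (c t) 1 - c t 1 * deriv F t, hQ, fun t ht => ?_, hs,
    fun t ht p => ?_, hh⟩
  · have h1 := hη2 (x := (c t, 0)) ⟨hcD t ht, trivial⟩
    rw [H.normal _ (hcD t ht)] at h1
    simpa [coord_apply, hci t ht] using h1.symm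
  · have hz : (c t, (fun _ => p : Vec 2)) ∈ D ×ˢ (univ : Set (Vec 2)) := ⟨hcD t ht, trivial⟩
    have h1 := (frc_seesaw hD hQ hs (fun x hx => ⟨x, hx, rfl⟩) hh hz).2
    simp only [hF₁ _ (hcD t ht), coord_apply, hci t ht] at h1
    linarith

/-- The two types of Seesaw Hamiltonian arise according to whether the force of `η` vanishes
identically. -/
theorem NormalHam.exists_seesaw (hH : NormalHam D (unc H) P)
    (hA : ∀ z ∈ D ×ˢ (univ : Set (Vec 2)), hess (unc H) 0 0 z = 0)
    (hJ : ∀ z ∈ D ×ˢ (univ : Set (Vec 2)), forceJac (unc H) 0 1 z = 0) :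
    IsSeesawB D H ∨ ∃ H', Permissible (D, H) (D, H') ∧ IsSeesawA D H' := by
  obtain ⟨η, Q, s, F, g, hη, hn, hs, hg, hh⟩ := hH.exists_eq_seesaw hA hJ
  set I := (fun x : Vec 2 => x 0) '' D
  have hDI : ∀ x ∈ D, x 0 ∈ I := fun x hx => ⟨x, hx, rfl⟩
  by_cases hF : ∀ x ∈ I, F x = 0
  · left
    obtain ⟨r, c, d, u, R, w, hr, hrb, hrd, hc, hd, hu, hR, hw, hwR, hηr, hse⟩ :=
      hη.exists_seesawB hF hn hs hg
    refine ⟨I, r, c, d, u, R, fun x p => w (x, p), hη.isOpen, hη.conn, hr, hrb, hrd, hc, hd, hu, hR,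
      hw, hwR, hDI, fun x hx p => ?_⟩
    have h1 := hh (x := (x, p)) ⟨hx, trivial⟩
    simp only [unc, seesaw, coord_apply] at h1
    rw [h1, hη.dd_e1_eq_zero hF hn _ ⟨hDI x hx, trivial⟩, hηr _ (hDI x hx), hse _ (hDI x hx)]
    ring
  · right
    push Not at hF
    obtain ⟨G, V, u, w, hG, hV, hu, hw, hwu, hse⟩ := hη.exists_seesawA hF hn hs hg
    -- the term `V(x) ∂_pη` is absorbed by a shift of `p_x`
    let W : Vec 2 → Vec 2 := fun x => V (x 0) • (Pi.single 0 1 : Vec 2)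
    have hVx : ∀ x ∈ D, HasFDerivAt W ((deriv V (x 0) •
        (ContinuousLinearMap.proj 0 : Vec 2 →L[ℝ] ℝ)).smulRight (Pi.single 0 1 : Vec 2)) x := by
      intro x hx
      have h1 : HasFDerivAt (fun x : Vec 2 => x 0) (ContinuousLinearMap.proj 0 : Vec 2 →L[ℝ] ℝ) x :=
        (ContinuousLinearMap.proj (R := ℝ) (φ := fun _ : Fin 2 => ℝ) 0).hasFDerivAt
      exact ((hV _ (hDI x hx)).differentiableAt.hasDerivAt.comp_hasFDerivAt x h1).smul_const _
    refine ⟨fun x p => H x (p - W x), Relation.ReflTransGen.single (Or.inr ⟨W, fun x hx => ?_,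
      fun x hx i j => ?_, rfl, fun x hx p => by simp only [add_sub_cancel_right]⟩), I, fun x p => η (x, p), G,
      u, fun x p => w (x, p), isGood1D_iff.2 ⟨Q, F, hη⟩, ?_, ?_, hu, hw, ?_, hDI, fun x hx p => ?_⟩
    · have h1 : AnalyticAt ℝ (fun x : Vec 2 => V (x 0)) x :=
        AnalyticAt.comp (hV _ (hDI x hx))
          ((ContinuousLinearMap.proj (R := ℝ) (φ := fun _ : Fin 2 => ℝ) 0).analyticAt x)
      exact h1.smul analyticAt_const
    · rw [(hVx x hx).fderiv]
      fin_cases i <;> fin_cases j <;> simp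
    · exact (force_lift1_ne_zero_iff hη).2 hF
    · rintro _ ⟨x, hx, q, rfl⟩
      exact hG _ ⟨(x, q), ⟨hx, trivial⟩, rfl⟩
    · intro x hx hux q
      beta_reduce
      rw [hwu x hx hux q, dd_e1_eq_deriv (hη.an _ ⟨hx, trivial⟩)]
    · have h1 := hh (x := (x, p - W x)) ⟨hx, trivial⟩
      have hW0 : (p - W x) 0 = p 0 - V (x 0) := by simp [W]
      have hW1 : (p - W x) 1 = p 1 := by simp [W]
      simp only [unc, seesaw, coord_apply, hW0, hW1] at h1
      have han := hη.an (x 0, p 1) ⟨hDI x hx, trivial⟩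
      beta_reduce
      rw [h1, hse _ (hDI x hx), dd_e1_eq_deriv han, dd_e2_eq_deriv han]
      ring

end Parabolic

/-! ### The classification -/

/-- The linear relation between the entries of `∂v/∂p` is brought to its normal form by a change of
basis. In that basis one entry vanishes or the trace does, and each case leads to a listed form. -/
theorem exists_listedForm {D : Set (Vec 2)} {H : PhaseFun 2} {P : Vec 2 × Vec 2 → Vec 2}
    (hH : NormalHam D (unc H) P) :
    ∃ D' H', Permissible (D, H) (D', H') ∧ IsListedForm D' H' := by
  rcases hH.alternative with hQ | ⟨k, hk, hka, -⟩
  · exact ⟨D, H, .refl, Or.inl (hH.isAnisotropicQuadratic_of_parallel hQ)⟩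
  obtain ⟨N, hN, hcases⟩ := exists_basis hk
  have hMN : N⁻¹ * N = 1 := Matrix.nonsing_inv_mul N (isUnit_iff_ne_zero.2 hN)
  have hperm := permissible_newHam (D := D) (H := H) (V := 0) hMN analyticOnNhd_const (by
    intro x _ i j
    have : fderiv ℝ (0 : Vec 2 → Vec 2) x = 0 := by simp
    rw [this]
    rfl)
  obtain ⟨P', hH'⟩ := hH.linear hMN
  change NormalHam (newDom N D) (unc (newHam N N⁻¹ 0 H)) P' at hH'
  have hess' : ∀ i j, ∀ z ∈ newDom N D ×ˢ (univ : Set (Vec 2)),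
      hess (unc (newHam N N⁻¹ 0 H)) i j z = _ := fun i j z hz =>
    hess_pull (V := 0) hMN hH.isOpen analyticOnNhd_const hH.an i j hz
  have hka' : ∀ z ∈ newDom N D ×ˢ (univ : Set (Vec 2)),
      k 0 * hess (unc H) 0 0 (pull N N⁻¹ 0 z) + k 1 * hess (unc H) 0 1 (pull N N⁻¹ 0 z) +
        k 2 * hess (unc H) 1 1 (pull N N⁻¹ 0 z) = 0 := fun z hz => hka _ (pull_mem hMN hz)
  rcases hcases with hE | hHy | hPa
  · refine ⟨_, _, hperm, Or.inl (hH'.isAnisotropicQuadratic_of_harmonic fun z hz => ?_)⟩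
    rw [hess' 0 0 z hz, hess' 1 1 z hz]
    exact hE _ _ _ (hka' z hz)
  · have hA : ∀ z ∈ newDom N D ×ˢ (univ : Set (Vec 2)),
        hess (unc (newHam N N⁻¹ 0 H)) 0 1 z = 0 := fun z hz =>
      (hess' 0 1 z hz).trans (hHy _ _ _ (hka' z hz))
    rcases hH'.alternative_of_hessVec_eq_zero (m := 1) hA with hQ | hJ
    · exact ⟨_, _, hperm, Or.inl (hH'.isAnisotropicQuadratic_of_parallel hQ)⟩
    · exact ⟨_, _, hperm, Or.inr (Or.inl (hH'.isSeparable hA (hJ 2 (by decide))))⟩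
  · have hA : ∀ z ∈ newDom N D ×ˢ (univ : Set (Vec 2)),
        hess (unc (newHam N N⁻¹ 0 H)) 0 0 z = 0 := fun z hz =>
      (hess' 0 0 z hz).trans (hPa _ _ _ (hka' z hz))
    rcases hH'.alternative_of_hessVec_eq_zero (m := 0) hA with hQ | hJ
    · exact ⟨_, _, hperm, Or.inl (hH'.isAnisotropicQuadratic_of_parallel hQ)⟩
    · rcases hH'.exists_seesaw hA (hJ 2 (by decide)) with hB | ⟨H'', hp, hSA⟩
      · exact ⟨_, _, hperm, Or.inr (Or.inr (Or.inr hB))⟩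
      · exact ⟨_, _, hperm.trans hp, Or.inr (Or.inr (Or.inl hSA))⟩

end HamForce

theorem mainTheorem1 (D : Set (HamForce.Vec 2)) (hD : IsOpen D) (hDc : IsConnected D)
    (H : HamForce.PhaseFun 2) :
    (HamForce.IsRegular D H → HamForce.VelocityIndependent D H → ¬ HamForce.IsIsotropicSHM D H →
      ∃ (D' : Set (HamForce.Vec 2)) (H' : HamForce.PhaseFun 2),
        HamForce.Permissible (D, H) (D', H') ∧ HamForce.IsListedForm D' H') ∧
    (HamForce.IsListedForm D H →
      HamForce.IsRegular D H ∧ HamForce.VelocityIndependent D H) := by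
  refine ⟨fun hr hv ha => ?_, fun hL => hL.regular hD⟩
  obtain ⟨P, hP⟩ := HamForce.isRegular_iff.1 hr
  have hV := (HamForce.velocityIndependent_iff hP.an).1 hv
  obtain ⟨P', hH⟩ := HamForce.normalHam_gauge hD hDc hP hV (by
    rintro ⟨a, b, hab⟩
    refine ha ⟨a, b, fun x hx p => funext fun i => ?_⟩
    rw [HamForce.force_eq (hP.an (x, p) ⟨hx, trivial⟩), hab x hx p i]
    rfl)
  obtain ⟨D', H', hperm, hL⟩ := HamForce.exists_listedForm
    (H := HamForce.newHam 1 1 (fun x => -P (x, 0)) H) hH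
  exact ⟨D', H', (HamForce.permissible_newHam (one_mul 1)
    (HamForce.analyticOnNhd_zero_velocity hP)
    (HamForce.curlFree_zero_velocity hD hP hV)).trans hperm, hL⟩
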